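/- **Setting.** A pairwise Markov random field consists of a finite simple graph $G=(V,E)$ with $V=\{1,\dots,n\}$, a finite nonempty alphabet $\Sigma$, and nonnegative potentials $\phi_v:\Sigma\to\mathbb R_+$ ($v\in V$), $\psi_{uv}:\Sigma^2\to\mathbb R_+$ ($uv\in E$). Put $\mathcal H(x)=\sum_{v\in V}\phi_v(x_v)+\sum_{uv\in E}\psi_{uv}(x_u,x_v)$ for $x\in\Sigma^n$; a MAP assignment $x^*$ is a maximizer of $\Pr[x]\propto e^{\mathcal H(x)}$. Let $d^*$ be the maximum degree of $G$. *Minor-e*$(G,r,\Lambda)$: start with $B=\emptyset$. For $i=0,\dots,r-1$: in each connected component of $G_i=(V,E\setminus B)$ (with the current $B$) choose an arbitrary root (possibly depending on $i$ and $G_i$), draw $L$ uniformly from $\{0,\dots,\Lambda-1\}$, independently of all other draws, and after treating all components of $G_i$ add to $B$ all edges of these components at breadth-first-search levels $L,\Lambda+L,2\Lambda+L,\dots$, where the level of an edge is the distance in $G_i$ from the root of its component to its nearer endpoint. Output $B$. *Mode* with Minor-e: compute $B$ by Minor-e, and for each connected component of $(V,E\setminus B)$ find an exact MAP assignment of the field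 restricted to this component (arbitrary if there are several). The output $\hat x$ is the union of these assignments. **Theorem.** Let $\varepsilon>0$, let $G$ exclude $K_{r,r}$ as a minor, and let $\Lambda=\lceil r(d^*+1)/\varepsilon\rceil$. 1. For all choices of roots and of exact MAP assignments of the components, the output $\hat x$ of Mode with Minor-e$(G,r,\Lambda)$ satisfies $$\mathbb E\big[\mathcal H(x^*)-\mathcal H(\hat x)\big]\le\varepsilon\,\mathcal H(x^*).$$ 2. There is one program $P$ for a randomized real random access machine that, for all inputs with $n,|\Sigma|,\Lambda\ge1$ (field given by adjacency lists and tables of potentials, and numbers $r,\Lambda$), implements Mode with Minor-e$(G,r,\Lambda)$: for some choice of roots not depending on the random numbers, and for all values of the random numbers, it halts with a possible output of Mode. (Unit-cost instructions: addition and truncated subtraction of natural numbers, addition and comparison of reals, access to array cells, tests, and drawing a number from $\{0,\dots,\Lambda-1\}$.) It has the following running times for all values of the random numbers. (a) For every $r$ there is a constant $C$, depending only on $r$, such that for all $n\ge1$, all $\varepsilon>0$ and all fields with $n$ vertices whose graph excludes $K_{r,r}$ as a minor, with $\Lambda$ as above, $P$ takes at most $$C\,n\,D\,|\Sigma|^{D^{C\Lambda}}\quad\text{steps,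 where } D=\max\{d^*,2\}.$$ In particular this is $n\,d^*\,|\Sigma|^{{d^*}^{O(\Lambda)}}$ if $d^*\ge 2$. (b) Let $r$ and $|\Sigma|$ be fixed. For every sequence of such inputs with $n\to\infty$ and $\varepsilon^{-1}d^*\log d^*=o(\log\log n)$ ($\varepsilon>0$ and the field may vary along the sequence, and $0\log 0=0$), $P$ takes $o(n^{1+\delta})$ steps for every $\delta>0$. -/

import Mathlib

open Filter Asymptotics
open scoped BigOperators

/-! ### Graph minors -/

/-- `H` is a minor of `G`: there are pairwise disjoint, connected (in particular nonempty) branch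
sets in `G`, one for each vertex of `H`, with an edge of `G` between the branch sets of any two
adjacent vertices of `H`. -/
def IsMinor {W V : Type*} (H : SimpleGraph W) (G : SimpleGraph V) : Prop :=
  ∃ branch : W → Set V,
    (∀ w, (G.induce (branch w)).Connected) ∧
    (∀ w w', w ≠ w' → Disjoint (branch w) (branch w')) ∧
    (∀ w w', H.Adj w w' → ∃ a ∈ branch w, ∃ b ∈ branch w', G.Adj a b)

/-- `G` excludes `K_{r,r}` as a minor. -/
def ExcludesKrr {V : Type*} (G : SimpleGraph V) (r : ℕ) : Prop :=
  ¬ IsMinor (completeBipartiteGraph (Fin r) (Fin r)) G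

/-! ### Pairwise Markov random fields -/

/-- A pairwise Markov random field on the vertex set `V` with alphabet `S`: a graph with
nonnegative potentials. The values of `ψ` at non-adjacent pairs are never used. -/
structure MRF (V S : Type) where
  graph : SimpleGraph V
  φ : V → S → ℝ
  ψ : V → V → S → S → ℝ
  φ_nonneg : ∀ v x, 0 ≤ φ v x
  ψ_nonneg : ∀ u v x y, 0 ≤ ψ u v x y
  ψ_symm : ∀ u v x y, ψ u v x y = ψ v u y x

/-- The term `ψ_{uv}(x_u, x_v)` of an unordered pair `uv`. -/
def MRF.edgeTerm {V S : Type} (M : MRF V S) (x : V → S) : Sym2 V → ℝ :=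
  Sym2.lift ⟨fun u v => M.ψ u v (x u) (x v), fun u v => M.ψ_symm u v (x u) (x v)⟩

open Classical in
/-- `H(x)`, the sum of `φ_v(x_v)` over the vertices and of `ψ_{uv}(x_u, x_v)` over the edges. -/
noncomputable def MRF.energy {V S : Type} [Fintype V] (M : MRF V S) (x : V → S) : ℝ :=
  ∑ v, M.φ v (x v) + ∑ e ∈ Finset.univ.filter (fun e => e ∈ M.graph.edgeSet), M.edgeTerm x e

/-- The probability of the assignment `x`, proportional to `exp (H(x))`. -/
noncomputable def MRF.prob {V S : Type} [Fintype V] [DecidableEq V] [Fintype S]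
    (M : MRF V S) (x : V → S) : ℝ :=
  Real.exp (M.energy x) / ∑ y : V → S, Real.exp (M.energy y)

/-- `x` is a maximum a posteriori assignment. -/
def MRF.IsMAP {V S : Type} [Fintype V] [DecidableEq V] [Fintype S]
    (M : MRF V S) (x : V → S) : Prop :=
  ∀ y, M.prob y ≤ M.prob x

open Classical in
/-- The maximum vertex degree `d*`. -/
noncomputable def MRF.maxDeg {V S : Type} [Fintype V] (M : MRF V S) : ℕ :=
  M.graph.maxDegree

/-! ### The decomposition `Minor-e` -/

/-- A rule for the arbitrary choice of a root in each connected component `c` of the current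
graph `H` in round `i`. -/
structure RootRule (V : Type) where
  pick : ℕ → (H : SimpleGraph V) → H.ConnectedComponent → V
  pick_mem : ∀ i H c, pick i H c ∈ c.supp

/-- The level of an edge `uv` in the breadth-first search of `H` from `root`: the distance from
the root to the endpoint nearer to the root. Edges at the root have level `0`. -/
noncomputable def edgeLevel {V : Type} (H : SimpleGraph V) (root : V) : Sym2 V → ℕ :=
  Sym2.lift ⟨fun u v => min (H.dist root u) (H.dist root v), fun _ _ => min_comm _ _⟩

/-- One round: in each component `c` of `H`, with root `root c`, the edges at the levels
`L, Λ + L, 2Λ + L, …`, where `L = L (root c)` is the number drawn for this component. -/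
def bfsCut {V : Type} {Λ : ℕ} (H : SimpleGraph V) (root : H.ConnectedComponent → V)
    (L : V → Fin Λ) : Set (Sym2 V) :=
  {e | e ∈ H.edgeSet ∧ ∃ c : H.ConnectedComponent, (∀ v ∈ e, v ∈ c.supp) ∧
    ∃ k : ℕ, edgeLevel H (root c) e = k * Λ + L (root c)}

/-- The random numbers used in `r` rounds: `L i v` is used in round `i` for the component with
root `v` (if there is one). They are independent and uniform on `{0, …, Λ - 1}`, that is, the
family `L` is uniform on this finite type. -/
abbrev Draws (n r Λ : ℕ) : Type := Fin r → Fin n → Fin Λ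

/-- The set `B` of edges put out by `Minor-e (G, r, Λ)` for the root choices `ρ` and the random
numbers `L`: round `i` works on the graph `G_i = (V, E \ B)` with the current `B`. -/
def minorE {n Λ : ℕ} (G : SimpleGraph (Fin n)) (ρ : RootRule (Fin n)) :
    (r : ℕ) → Draws n r Λ → Set (Sym2 (Fin n))
  | 0, _ => ∅
  | i + 1, L =>
      minorE G ρ i (Fin.init L) ∪
        bfsCut (G.deleteEdges (minorE G ρ i (Fin.init L)))
          (ρ.pick i (G.deleteEdges (minorE G ρ i (Fin.init L)))) (L (Fin.last i))

/-! ### The algorithm `Mode` -/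

open Classical in
/-- The energy of the Markov random field restricted to a connected component `c` of
`(V, E \ B)`; it depends only on the values of `x` on `c`. -/
noncomputable def MRF.componentEnergy {V S : Type} [Fintype V] (M : MRF V S)
    (B : Set (Sym2 V)) (c : (M.graph.deleteEdges B).ConnectedComponent) (x : V → S) : ℝ :=
  ∑ v ∈ Finset.univ.filter (fun v => v ∈ c.supp), M.φ v (x v) +
    ∑ e ∈ Finset.univ.filter
        (fun e => e ∈ (M.graph.deleteEdges B).edgeSet ∧ ∀ v ∈ e, v ∈ c.supp), M.edgeTerm x e

/-- `x` is a possible output of `Mode` when the decomposition step has put out `B`: on every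
connected component of `(V, E \ B)` it is an exact MAP assignment of that component. -/
def MRF.IsModeOutput {V S : Type} [Fintype V] (M : MRF V S) (B : Set (Sym2 V))
    (x : V → S) : Prop :=
  ∀ (c : (M.graph.deleteEdges B).ConnectedComponent) (y : V → S),
    M.componentEnergy B c y ≤ M.componentEnergy B c x

/-! ### A randomized real random access machine with a step count -/

/-- Programs. The arguments `x y z` are names of integer registers, `u v w` names of real
registers, `a` names of arrays, and `idx` is the list of the integer registers that hold the
indices of the array cell. -/
inductive Cmd : Type
  | skip
  | set (x k : ℕ)
  | add (x y z : ℕ)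
  | sub (x y z : ℕ)
  | load (x a : ℕ) (idx : List ℕ)
  | store (a : ℕ) (idx : List ℕ) (x : ℕ)
  | draw (x y z : ℕ)
  | rload (u a : ℕ) (idx : List ℕ)
  | rstore (a : ℕ) (idx : List ℕ) (u : ℕ)
  | radd (u v w : ℕ)
  | seq (c d : Cmd)
  | ifLt (x y : ℕ) (c d : Cmd)
  | ifRLt (u v : ℕ) (c d : Cmd)
  | whileLt (x y : ℕ) (c : Cmd)

/-- Registers and arrays, holding natural numbers (`reg`, `mem`) or real numbers
(`rreg`, `rmem`). -/
structure MState where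
  reg : ℕ → ℕ
  rreg : ℕ → ℝ
  mem : ℕ → List ℕ → ℕ
  rmem : ℕ → List ℕ → ℝ

/-- The assignment `x := k`. -/
def MState.setReg (s : MState) (x k : ℕ) : MState :=
  { s with reg := Function.update s.reg x k }

/-- The assignment `u := t` of a real register. -/
def MState.setRReg (s : MState) (u : ℕ) (t : ℝ) : MState :=
  { s with rreg := Function.update s.rreg u t }

/-- The assignment `a[i] := k`, where `i` is a list of indices. -/
def MState.setMem (s : MState) (a : ℕ) (i : List ℕ) (k : ℕ) : MState :=
  { s with mem := Function.update s.mem a (Function.update (s.mem a) i k) }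

/-- The assignment `a[i] := t` in a real array. -/
def MState.setRMem (s : MState) (a : ℕ) (i : List ℕ) (t : ℝ) : MState :=
  { s with rmem := Function.update s.rmem a (Function.update (s.rmem a) i t) }

/-- `Exec ω c s t s'`: with the random source `ω`, the program `c` started in the state `s` halts
after exactly `t` steps, in the state `s'`. Each basic instruction and each test is one step. The
random source can be read only by `draw`, which puts the random number `ω i v` into a register. -/
inductive Exec (ω : ℕ → ℕ → ℕ) : Cmd → MState → ℕ → MState → Prop
  | skip (s : MState) : Exec ω .skip s 1 s
  | set (s : MState) (x k : ℕ) : Exec ω (.set x k) s 1 (s.setReg x k)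
  | add (s : MState) (x y z : ℕ) :
      Exec ω (.add x y z) s 1 (s.setReg x (s.reg y + s.reg z))
  | sub (s : MState) (x y z : ℕ) :
      Exec ω (.sub x y z) s 1 (s.setReg x (s.reg y - s.reg z))
  | load (s : MState) (x a : ℕ) (idx : List ℕ) :
      Exec ω (.load x a idx) s 1 (s.setReg x (s.mem a (idx.map s.reg)))
  | store (s : MState) (a : ℕ) (idx : List ℕ) (x : ℕ) :
      Exec ω (.store a idx x) s 1 (s.setMem a (idx.map s.reg) (s.reg x))
  | draw (s : MState) (x y z : ℕ) :
      Exec ω (.draw x y z) s 1 (s.setReg x (ω (s.reg y) (s.reg z)))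
  | rload (s : MState) (u a : ℕ) (idx : List ℕ) :
      Exec ω (.rload u a idx) s 1 (s.setRReg u (s.rmem a (idx.map s.reg)))
  | rstore (s : MState) (a : ℕ) (idx : List ℕ) (u : ℕ) :
      Exec ω (.rstore a idx u) s 1 (s.setRMem a (idx.map s.reg) (s.rreg u))
  | radd (s : MState) (u v w : ℕ) :
      Exec ω (.radd u v w) s 1 (s.setRReg u (s.rreg v + s.rreg w))
  | seq {c d : Cmd} {s s' s'' : MState} {t t' : ℕ} :
      Exec ω c s t s' → Exec ω d s' t' s'' → Exec ω (.seq c d) s (t + t') s''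
  | ifLt_true {x y : ℕ} {c d : Cmd} {s s' : MState} {t : ℕ} :
      s.reg x < s.reg y → Exec ω c s t s' → Exec ω (.ifLt x y c d) s (t + 1) s'
  | ifLt_false {x y : ℕ} {c d : Cmd} {s s' : MState} {t : ℕ} :
      ¬ s.reg x < s.reg y → Exec ω d s t s' → Exec ω (.ifLt x y c d) s (t + 1) s'
  | ifRLt_true {u v : ℕ} {c d : Cmd} {s s' : MState} {t : ℕ} :
      s.rreg u < s.rreg v → Exec ω c s t s' → Exec ω (.ifRLt u v c d) s (t + 1) s'
  | ifRLt_false {u v : ℕ} {c d : Cmd} {s s' : MState} {t : ℕ} :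
      ¬ s.rreg u < s.rreg v → Exec ω d s t s' → Exec ω (.ifRLt u v c d) s (t + 1) s'
  | whileLt_true {x y : ℕ} {c : Cmd} {s s' s'' : MState} {t t' : ℕ} :
      s.reg x < s.reg y → Exec ω c s t s' → Exec ω (.whileLt x y c) s' t' s'' →
      Exec ω (.whileLt x y c) s (t + t' + 1) s''
  | whileLt_false {x y : ℕ} {c : Cmd} {s : MState} :
      ¬ s.reg x < s.reg y → Exec ω (.whileLt x y c) s 1 s

/-! ### Input and output of programs -/

/-- `nbr` lists the neighbours of every vertex, without repetition and in any order. -/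
def IsAdjacencyList {n : ℕ} (G : SimpleGraph (Fin n)) (nbr : Fin n → List (Fin n)) : Prop :=
  ∀ v, (nbr v).Nodup ∧ ∀ u, u ∈ nbr v ↔ G.Adj v u

/-- The random source that holds the random numbers of `Minor-e`. -/
def drawSource {n r Λ : ℕ} (L : Draws n r Λ) (i v : ℕ) : ℕ :=
  if h : i < r ∧ v < n then (L ⟨i, h.1⟩ ⟨v, h.2⟩ : ℕ) else 0

/-- The `k`-th entry of the adjacency list of `v`, if there is one. -/
def nbrAt {n : ℕ} (nbr : Fin n → List (Fin n)) (v k : ℕ) : Option (Fin n) :=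
  if h : v < n then (nbr ⟨v, h⟩)[k]? else none

/-- The initial state. Integer registers `0, 1, 2, 3` hold `n`, `r`, `Λ` and `|Σ| = q`. Integer
array `0` holds the degrees (cell `[v]`) and integer array `1` the adjacency lists (cell `[v, k]`
is the `k`-th neighbour of `v`). Real array `0` holds `φ_v(x)` in cell `[v, x]`, and real array
`1` holds, in cell `[v, k, x, y]`, the value `ψ_{vu}(x, y)` for the `k`-th neighbour `u` of `v`.
Everything else is `0`. -/
def inputState {n q : ℕ} (M : MRF (Fin n) (Fin q)) (nbr : Fin n → List (Fin n)) (r Λ : ℕ) :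
    MState where
  reg
    | 0 => n
    | 1 => r
    | 2 => Λ
    | 3 => q
    | _ => 0
  rreg _ := 0
  mem
    | 0, [v] => if h : v < n then (nbr ⟨v, h⟩).length else 0
    | 1, [v, k] => ((nbrAt nbr v k).map Fin.val).getD 0
    | _, _ => 0
  rmem
    | 0, [v, x] => if h : v < n ∧ x < q then M.φ ⟨v, h.1⟩ ⟨x, h.2⟩ else 0
    | 1, [v, k, x, y] =>
        if h : v < n ∧ x < q ∧ y < q then
          ((nbrAt nbr v k).map fun u => M.ψ ⟨v, h.1⟩ u ⟨x, h.2.1⟩ ⟨y, h.2.2⟩).getD 0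
        else 0
    | _, _ => 0

/-- The final state `s` holds the assignment `x` in integer array `2`. -/
def Outputs {n q : ℕ} (s : MState) (x : Fin n → Fin q) : Prop :=
  ∀ v : Fin n, s.mem 2 [(v : ℕ)] = (x v : ℕ)

/-- The program `P` implements `Mode` with `Minor-e (G, r, Λ)`: on every input there is a choice
of roots, not depending on the random numbers, such that for all random numbers `P` halts and
puts out an assignment that `Mode` can produce from the edge set given by `Minor-e` for these
roots and these random numbers. -/
def ImplementsMode (P : Cmd) : Prop :=
  ∀ (n q r Λ : ℕ), 0 < n → 0 < q → 0 < Λ →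
  ∀ (M : MRF (Fin n) (Fin q)) (nbr : Fin n → List (Fin n)), IsAdjacencyList M.graph nbr →
    ∃ ρ : RootRule (Fin n), ∀ L : Draws n r Λ,
      ∃ (t : ℕ) (s : MState) (x : Fin n → Fin q),
        Exec (drawSource L) P (inputState M nbr r Λ) t s ∧ Outputs s x ∧
          M.IsModeOutput (minorE M.graph ρ r L) x

/-- The parameter `Λ = ⌈r (d* + 1) / ε⌉`. -/
noncomputable def lam {n q : ℕ} (M : MRF (Fin n) (Fin q)) (r : ℕ) (ε : ℝ) : ℕ :=
  ⌈(r : ℝ) * ((M.maxDeg : ℝ) + 1) / ε⌉₊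

/-!
Each of the `r` rounds cuts a given edge with probability at most `1 / Λ`. Optimality on the
components bounds the loss `H x* - H x̂` by the terms of `x*` on the cut edges, so its expectation
is at most `(r / Λ) * H x*`.

The running time rests on the argument of Klein, Plotkin and Rao. Suppose that a component left
after `r` rounds contains two vertices that are far apart in `G`; then it contains `r` vertices that
are pairwise far apart. A round leaves each component within a band of `Λ` breadth-first-search
levels. Going back through the rounds, the tree of each round below the band gives a connected set
avoiding what was built inside the band, and tree paths of length `O(Λ)` connect it to branch sets
that start from the `r` vertices and stay near them, hence disjoint. The `r` lower trees and the `r`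
branch sets form a `K_{r,r}` minor. So components have diameter `O(Λ)` and at most `D ^ O(Λ)`
vertices, and exhaustive search over the assignments of a component is affordable.
-/

/-! ### Reasoning about programs -/

theorem Exec.deterministic {ω : ℕ → ℕ → ℕ} {c : Cmd} {s s' : MState} {t : ℕ}
    (h : Exec ω c s t s') : ∀ {t₂ : ℕ} {s₂ : MState}, Exec ω c s t₂ s₂ → t = t₂ ∧ s' = s₂ := by
  induction h <;> intro t₂ s₂ h₂ <;> cases h₂ <;> grind

/-- The program `c`, started in `s`, halts, and its step count and final state satisfy `Q`. -/
def Wp (ω : ℕ → ℕ → ℕ) (c : Cmd) (s : MState) (Q : ℕ → MState → Prop) : Prop :=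
  ∃ t s', Exec ω c s t s' ∧ Q t s'

section Wp

variable {ω : ℕ → ℕ → ℕ} {Q : ℕ → MState → Prop} {s : MState}

theorem Wp.mono {c : Cmd} {R : ℕ → MState → Prop} (h : Wp ω c s Q)
    (hQR : ∀ t s', Q t s' → R t s') : Wp ω c s R := by
  obtain ⟨t, s', he, hq⟩ := h
  exact ⟨t, s', he, hQR _ _ hq⟩

@[simp] theorem wp_skip : Wp ω .skip s Q ↔ Q 1 s :=
  ⟨fun ⟨_, _, he, hq⟩ => by cases he; exact hq, fun h => ⟨_, _, .skip s, h⟩⟩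

@[simp] theorem wp_set {x k : ℕ} : Wp ω (.set x k) s Q ↔ Q 1 (s.setReg x k) :=
  ⟨fun ⟨_, _, he, hq⟩ => by cases he; exact hq, fun h => ⟨_, _, .set s x k, h⟩⟩

@[simp] theorem wp_add {x y z : ℕ} :
    Wp ω (.add x y z) s Q ↔ Q 1 (s.setReg x (s.reg y + s.reg z)) :=
  ⟨fun ⟨_, _, he, hq⟩ => by cases he; exact hq, fun h => ⟨_, _, .add s x y z, h⟩⟩

@[simp] theorem wp_sub {x y z : ℕ} :
    Wp ω (.sub x y z) s Q ↔ Q 1 (s.setReg x (s.reg y - s.reg z)) :=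
  ⟨fun ⟨_, _, he, hq⟩ => by cases he; exact hq, fun h => ⟨_, _, .sub s x y z, h⟩⟩

@[simp] theorem wp_load {x a : ℕ} {idx : List ℕ} :
    Wp ω (.load x a idx) s Q ↔ Q 1 (s.setReg x (s.mem a (idx.map s.reg))) :=
  ⟨fun ⟨_, _, he, hq⟩ => by cases he; exact hq, fun h => ⟨_, _, .load s x a idx, h⟩⟩

@[simp] theorem wp_store {x a : ℕ} {idx : List ℕ} :
    Wp ω (.store a idx x) s Q ↔ Q 1 (s.setMem a (idx.map s.reg) (s.reg x)) :=
  ⟨fun ⟨_, _, he, hq⟩ => by cases he; exact hq, fun h => ⟨_, _, .store s a idx x, h⟩⟩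

@[simp] theorem wp_draw {x y z : ℕ} :
    Wp ω (.draw x y z) s Q ↔ Q 1 (s.setReg x (ω (s.reg y) (s.reg z))) :=
  ⟨fun ⟨_, _, he, hq⟩ => by cases he; exact hq, fun h => ⟨_, _, .draw s x y z, h⟩⟩

@[simp] theorem wp_rload {u a : ℕ} {idx : List ℕ} :
    Wp ω (.rload u a idx) s Q ↔ Q 1 (s.setRReg u (s.rmem a (idx.map s.reg))) :=
  ⟨fun ⟨_, _, he, hq⟩ => by cases he; exact hq, fun h => ⟨_, _, .rload s u a idx, h⟩⟩

@[simp] theorem wp_radd {u v w : ℕ} :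
    Wp ω (.radd u v w) s Q ↔ Q 1 (s.setRReg u (s.rreg v + s.rreg w)) :=
  ⟨fun ⟨_, _, he, hq⟩ => by cases he; exact hq, fun h => ⟨_, _, .radd s u v w, h⟩⟩

@[simp] theorem wp_seq {c d : Cmd} :
    Wp ω (.seq c d) s Q ↔ Wp ω c s fun t s' => Wp ω d s' fun t' s'' => Q (t + t') s'' := by
  constructor
  · rintro ⟨_, _, he, hq⟩
    cases he with
    | seq h1 h2 => exact ⟨_, _, h1, _, _, h2, hq⟩
  · rintro ⟨_, _, h1, _, _, h2, hq⟩
    exact ⟨_, _, .seq h1 h2, hq⟩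

@[simp] theorem wp_ifLt {x y : ℕ} {c d : Cmd} :
    Wp ω (.ifLt x y c d) s Q ↔
      if s.reg x < s.reg y then Wp ω c s fun t s' => Q (t + 1) s'
      else Wp ω d s fun t s' => Q (t + 1) s' := by
  split_ifs with h
  · constructor
    · rintro ⟨_, _, he, hq⟩
      cases he with
      | ifLt_true _ he => exact ⟨_, _, he, hq⟩
      | ifLt_false hn _ => exact absurd h hn
    · rintro ⟨_, _, he, hq⟩
      exact ⟨_, _, .ifLt_true h he, hq⟩
  · constructor
    · rintro ⟨_, _, he, hq⟩
      cases he with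
      | ifLt_true hn _ => exact absurd hn h
      | ifLt_false _ he => exact ⟨_, _, he, hq⟩
    · rintro ⟨_, _, he, hq⟩
      exact ⟨_, _, .ifLt_false h he, hq⟩

open Classical in
@[simp] theorem wp_ifRLt {u v : ℕ} {c d : Cmd} :
    Wp ω (.ifRLt u v c d) s Q ↔
      if s.rreg u < s.rreg v then Wp ω c s fun t s' => Q (t + 1) s'
      else Wp ω d s fun t s' => Q (t + 1) s' := by
  split_ifs with h
  · constructor
    · rintro ⟨_, _, he, hq⟩
      cases he with
      | ifRLt_true _ he => exact ⟨_, _, he, hq⟩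
      | ifRLt_false hn _ => exact absurd h hn
    · rintro ⟨_, _, he, hq⟩
      exact ⟨_, _, .ifRLt_true h he, hq⟩
  · constructor
    · rintro ⟨_, _, he, hq⟩
      cases he with
      | ifRLt_true hn _ => exact absurd hn h
      | ifRLt_false _ he => exact ⟨_, _, he, hq⟩
    · rintro ⟨_, _, he, hq⟩
      exact ⟨_, _, .ifRLt_false h he, hq⟩

end Wp

namespace MState

variable (s : MState)

@[simp] theorem reg_setReg (x k y : ℕ) :
    (s.setReg x k).reg y = if y = x then k else s.reg y := by
  simp [setReg, Function.update_apply]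

@[simp] theorem rreg_setReg (x k : ℕ) : (s.setReg x k).rreg = s.rreg := rfl
@[simp] theorem mem_setReg (x k : ℕ) : (s.setReg x k).mem = s.mem := rfl
@[simp] theorem rmem_setReg (x k : ℕ) : (s.setReg x k).rmem = s.rmem := rfl

@[simp] theorem rreg_setRReg (x : ℕ) (k : ℝ) (y : ℕ) :
    (s.setRReg x k).rreg y = if y = x then k else s.rreg y := by
  simp [setRReg, Function.update_apply]
@[simp] theorem reg_setRReg (x : ℕ) (k : ℝ) : (s.setRReg x k).reg = s.reg := rfl
@[simp] theorem mem_setRReg (x : ℕ) (k : ℝ) : (s.setRReg x k).mem = s.mem := rfl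

@[simp] theorem mem_setMem (a : ℕ) (i : List ℕ) (k b : ℕ) (j : List ℕ) :
    (s.setMem a i k).mem b j = if b = a ∧ j = i then k else s.mem b j := by
  by_cases h : b = a
  · subst h; simp [setMem, Function.update_apply]
  · simp [setMem, h]
@[simp] theorem reg_setMem (a : ℕ) (i : List ℕ) (k : ℕ) : (s.setMem a i k).reg = s.reg := rfl

end MState

/-- `c` may write the integer register `x`. -/
def Cmd.wrReg (x : ℕ) : Cmd → Bool
  | .set y _ | .add y _ _ | .sub y _ _ | .load y _ _ | .draw y _ _ => x == y
  | .seq c d | .ifLt _ _ c d | .ifRLt _ _ c d => c.wrReg x || d.wrReg x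
  | .whileLt _ _ c => c.wrReg x
  | _ => false

/-- `c` may write the real register `x`. -/
def Cmd.wrRReg (x : ℕ) : Cmd → Bool
  | .rload y _ _ | .radd y _ _ => x == y
  | .seq c d | .ifLt _ _ c d | .ifRLt _ _ c d => c.wrRReg x || d.wrRReg x
  | .whileLt _ _ c => c.wrRReg x
  | _ => false

/-- `c` may write the integer array `a`. -/
def Cmd.wrMem (a : ℕ) : Cmd → Bool
  | .store b _ _ => a == b
  | .seq c d | .ifLt _ _ c d | .ifRLt _ _ c d => c.wrMem a || d.wrMem a
  | .whileLt _ _ c => c.wrMem a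
  | _ => false

/-- `c` may write the real array `a`. -/
def Cmd.wrRMem (a : ℕ) : Cmd → Bool
  | .rstore b _ _ => a == b
  | .seq c d | .ifLt _ _ c d | .ifRLt _ _ c d => c.wrRMem a || d.wrRMem a
  | .whileLt _ _ c => c.wrRMem a
  | _ => false

/-- `s'` agrees with `s` on everything that `c` cannot write. -/
structure Frame (c : Cmd) (s s' : MState) : Prop where
  reg : ∀ x, c.wrReg x = false → s'.reg x = s.reg x
  rreg : ∀ x, c.wrRReg x = false → s'.rreg x = s.rreg x
  mem : ∀ a, c.wrMem a = false → s'.mem a = s.mem a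
  rmem : ∀ a, c.wrRMem a = false → s'.rmem a = s.rmem a

theorem Frame.refl (c : Cmd) (s : MState) : Frame c s s :=
  ⟨fun _ _ => rfl, fun _ _ => rfl, fun _ _ => rfl, fun _ _ => rfl⟩

theorem Frame.trans {c : Cmd} {s s' s'' : MState} (h : Frame c s s') (h' : Frame c s' s'') :
    Frame c s s'' :=
  ⟨fun x hx => (h'.reg x hx).trans (h.reg x hx), fun x hx => (h'.rreg x hx).trans (h.rreg x hx),
    fun x hx => (h'.mem x hx).trans (h.mem x hx), fun x hx => (h'.rmem x hx).trans (h.rmem x hx)⟩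

theorem Frame.setReg {c : Cmd} {x : ℕ} (h : c.wrReg x = true) (s : MState) (k : ℕ) :
    Frame c s (s.setReg x k) := by
  refine ⟨fun y hy => ?_, fun _ _ => rfl, fun _ _ => rfl, fun _ _ => rfl⟩
  rw [MState.reg_setReg, if_neg]
  rintro rfl
  simp [h] at hy

theorem Frame.setRReg {c : Cmd} {u : ℕ} (h : c.wrRReg u = true) (s : MState) (t : ℝ) :
    Frame c s (s.setRReg u t) := by
  refine ⟨fun _ _ => rfl, fun y hy => ?_, fun _ _ => rfl, fun _ _ => rfl⟩
  rw [MState.rreg_setRReg, if_neg]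
  rintro rfl
  simp [h] at hy

theorem Frame.weaken {c d : Cmd} {s s' : MState} (h : Frame c s s')
    (h1 : ∀ x, d.wrReg x = false → c.wrReg x = false)
    (h2 : ∀ x, d.wrRReg x = false → c.wrRReg x = false)
    (h3 : ∀ x, d.wrMem x = false → c.wrMem x = false)
    (h4 : ∀ x, d.wrRMem x = false → c.wrRMem x = false) : Frame d s s' :=
  ⟨fun x hx => h.reg x (h1 x hx), fun x hx => h.rreg x (h2 x hx),
    fun x hx => h.mem x (h3 x hx), fun x hx => h.rmem x (h4 x hx)⟩

theorem Frame.seq {c d : Cmd} {s s' s'' : MState} (h : Frame c s s') (h' : Frame d s' s'') :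
    Frame (.seq c d) s s'' := by
  refine (Frame.weaken h ?_ ?_ ?_ ?_).trans (Frame.weaken h' ?_ ?_ ?_ ?_) <;>
    simp +contextual [Cmd.wrReg, Cmd.wrRReg, Cmd.wrMem, Cmd.wrRMem]

theorem Exec.frame {ω : ℕ → ℕ → ℕ} {c : Cmd} {s s' : MState} {t : ℕ} (h : Exec ω c s t s') :
    Frame c s s' := by
  induction h with
  | seq _ _ ih1 ih2 => exact ih1.seq ih2
  | ifLt_true _ _ ih | ifLt_false _ _ ih | ifRLt_true _ _ ih | ifRLt_false _ _ ih =>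
    refine Frame.weaken ih ?_ ?_ ?_ ?_ <;>
      simp +contextual [Cmd.wrReg, Cmd.wrRReg, Cmd.wrMem, Cmd.wrRMem]
  | whileLt_true _ _ _ ih1 ih2 =>
    refine (Frame.weaken ih1 ?_ ?_ ?_ ?_).trans ih2 <;>
      simp [Cmd.wrReg, Cmd.wrRReg, Cmd.wrMem, Cmd.wrRMem]
  | whileLt_false => exact Frame.refl _ _
  | _ =>
    constructor <;> intro x hx <;>
    simp_all [Cmd.wrReg, Cmd.wrRReg, Cmd.wrMem, Cmd.wrRMem, MState.setReg, MState.setRReg,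
      MState.setMem, MState.setRMem]

theorem Wp.withFrame {ω : ℕ → ℕ → ℕ} {c : Cmd} {s : MState} {Q : ℕ → MState → Prop}
    (h : Wp ω c s Q) : Wp ω c s fun t s' => Q t s' ∧ Frame c s s' := by
  obtain ⟨t, s', he, hq⟩ := h
  exact ⟨t, s', he, hq, he.frame⟩

/-- The invariant `I k t` describes the state after `k` iterations,
which took `t` steps; the number `N` bounds the number of iterations. -/
theorem Wp.whileLt_acc {ω : ℕ → ℕ → ℕ} {c : Cmd} {x y : ℕ} {s : MState} (N : ℕ)
    (I : ℕ → ℕ → MState → Prop) (h0 : I 0 0 s)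
    (step : ∀ k t s', Frame (.whileLt x y c) s s' → I k t s' → s'.reg x < s'.reg y →
      k < N ∧ Wp ω c s' fun t' s'' => I (k + 1) (t + t' + 1) s'') :
    Wp ω (.whileLt x y c) s fun t s' => ∃ k t₁, t = t₁ + 1 ∧ I k t₁ s' ∧ ¬ s'.reg x < s'.reg y := by
  suffices H : ∀ k t₀ s', Frame (.whileLt x y c) s s' → I k t₀ s' →
      Wp ω (.whileLt x y c) s' fun t s'' =>
        ∃ k t₁, t₀ + t = t₁ + 1 ∧ I k t₁ s'' ∧ ¬ s''.reg x < s''.reg y by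
    simpa only [zero_add] using H 0 0 s (.refl _ _) h0
  intro k t₀ s' hf hI
  induction hm : N - k using Nat.strong_induction_on generalizing k s' t₀ with
  | _ m ih =>
    by_cases hc : s'.reg x < s'.reg y
    · obtain ⟨hk, t', s₁, he, hI'⟩ := step k t₀ s' hf hI hc
      have hf' : Frame (.whileLt x y c) s' s₁ :=
        he.frame.weaken (fun _ h => h) (fun _ h => h) (fun _ h => h) fun _ h => h
      obtain ⟨t'', s₂, he', k', t₁, ht, hI'', hn⟩ := ih (N - (k + 1)) (by omega) (k + 1) _ s₁
        (hf.trans hf') hI' rfl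
      exact ⟨_, _, .whileLt_true hc he he', k', t₁, by omega, hI'', hn⟩
    · exact ⟨_, _, .whileLt_false hc, k, t₀, rfl, hI, hc⟩

theorem Wp.whileLt {ω : ℕ → ℕ → ℕ} {c : Cmd} {x y : ℕ} {s : MState} (N τ : ℕ)
    (I : ℕ → MState → Prop) (h0 : I 0 s)
    (step : ∀ k s', Frame (.whileLt x y c) s s' → I k s' → s'.reg x < s'.reg y →
      k < N ∧ Wp ω c s' fun t s'' => t ≤ τ ∧ I (k + 1) s'') :
    Wp ω (.whileLt x y c) s fun t s' =>
      ∃ k, t ≤ k * (τ + 1) + 1 ∧ I k s' ∧ ¬ s'.reg x < s'.reg y := by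
  refine (Wp.whileLt_acc N (fun k t s' => t ≤ k * (τ + 1) ∧ I k s') ⟨by simp, h0⟩ ?_).mono ?_
  · rintro k t s' hf ⟨ht, hI⟩ hlt
    obtain ⟨hk, hw⟩ := step k s' hf hI hlt
    exact ⟨hk, hw.mono fun t' s'' ⟨_, hI'⟩ => ⟨by rw [add_mul]; omega, hI'⟩⟩
  · rintro t s' ⟨k, t₁, rfl, ⟨ht, hI⟩, hn⟩
    exact ⟨k, by omega, hI, hn⟩

local infixr:60 " ;; " => Cmd.seq

local notation "rOne" => (4 : ℕ)

/-- `while x < y do (c; x := x + 1)` -/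
def Cmd.countTo (x y : ℕ) (c : Cmd) : Cmd :=
  .whileLt x y (c ;; .add x x rOne)

/-- `c` can be the body of a loop that counts in the register `x` up to the register `y`. -/
def Cmd.keepsCount (x y : ℕ) (c : Cmd) : Bool :=
  x != y && x != rOne && !c.wrReg x && !c.wrReg y && !c.wrReg rOne

theorem Wp.countTo_acc {ω : ℕ → ℕ → ℕ} {c : Cmd} {x y a N : ℕ} {s : MState}
    (I : ℕ → ℕ → MState → Prop) (hc : c.keepsCount x y = true)
    (hx : s.reg x = a) (hy : s.reg y = a + N) (h1 : s.reg rOne = 1) (h0 : I 0 0 s)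
    (step : ∀ k < N, ∀ t s', Frame (.countTo x y c) s s' → s'.reg x = a + k → I k t s' →
      Wp ω c s' fun t' s'' => I (k + 1) (t + t' + 2) (s''.setReg x (a + k + 1))) :
    Wp ω (.countTo x y c) s fun t s' => ∃ t₁, t = t₁ + 1 ∧ I N t₁ s' := by
  simp only [Cmd.keepsCount, Bool.and_eq_true, bne_iff_ne, Bool.not_eq_true'] at hc
  obtain ⟨⟨⟨⟨hxy, hx1⟩, hcx⟩, hcy⟩, hc1⟩ := hc
  have keep : ∀ z, z ≠ x → c.wrReg z = false → (Cmd.countTo x y c).wrReg z = false := by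
    simp +contextual [Cmd.countTo, Cmd.wrReg]
  refine (Wp.whileLt_acc N (fun k t s' => s'.reg x = a + k ∧ k ≤ N ∧ I k t s')
    ⟨hx, N.zero_le, h0⟩ ?_).withFrame.mono ?_
  · rintro k t s' hf ⟨hxk, -, hI⟩ hlt
    rw [hxk, hf.reg y (keep y hxy.symm hcy), hy, add_lt_add_iff_left] at hlt
    refine ⟨hlt, wp_seq.2 <| (step k hlt t s' hf hxk hI).withFrame.mono ?_⟩
    rintro t' s'' ⟨hI', hf'⟩
    have hone : s''.reg rOne = 1 := by
      rw [hf'.reg _ hc1, hf.reg _ (keep _ hx1.symm hc1), h1]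
    rw [wp_add, hf'.reg x hcx, hxk, hone]
    exact ⟨by simp [add_assoc], hlt, by simpa only [add_assoc] using hI'⟩
  · rintro t s' ⟨⟨k, t₁, ht, ⟨hxk, hk, hI⟩, hn⟩, hf⟩
    rw [hxk, hf.reg y (keep y hxy.symm hcy), hy] at hn
    obtain rfl : k = N := by omega
    exact ⟨t₁, ht, hI⟩

theorem Wp.countTo {ω : ℕ → ℕ → ℕ} {c : Cmd} {x y a N : ℕ} {s : MState} (τ : ℕ)
    (I : ℕ → MState → Prop) (hc : c.keepsCount x y = true)
    (hx : s.reg x = a) (hy : s.reg y = a + N) (h1 : s.reg rOne = 1) (h0 : I 0 s)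
    (step : ∀ k < N, ∀ s', Frame (.countTo x y c) s s' → s'.reg x = a + k → I k s' →
      Wp ω c s' fun t' s'' => t' ≤ τ ∧ I (k + 1) (s''.setReg x (a + k + 1))) :
    Wp ω (.countTo x y c) s fun t s' => t ≤ N * (τ + 2) + 1 ∧ I N s' := by
  refine (Wp.countTo_acc (fun k t s' => t ≤ k * (τ + 2) ∧ I k s') hc hx hy h1
    ⟨by simp, h0⟩ ?_).mono ?_
  · rintro k hk t s' hf hxk ⟨ht, hI⟩
    refine (step k hk s' hf hxk hI).mono ?_
    exact fun t' s'' ⟨_, hI'⟩ => ⟨by rw [add_mul]; omega, hI'⟩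
  · rintro t s' ⟨t₁, rfl, ht, hI⟩
    exact ⟨by omega, hI⟩

/-- `for x = 0, …, y - 1 do c` -/
def Cmd.forLt (x y : ℕ) (c : Cmd) : Cmd :=
  .set x 0 ;; .countTo x y c

theorem Wp.forLt_acc {ω : ℕ → ℕ → ℕ} {c : Cmd} {x y N : ℕ} {s : MState}
    (I : ℕ → ℕ → MState → Prop) (hc : c.keepsCount x y = true)
    (hy : s.reg y = N) (h1 : s.reg rOne = 1) (h0 : I 0 0 (s.setReg x 0))
    (step : ∀ k < N, ∀ t s', Frame (.forLt x y c) s s' → s'.reg x = k → I k t s' →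
      Wp ω c s' fun t' s'' => I (k + 1) (t + t' + 2) (s''.setReg x (k + 1))) :
    Wp ω (.forLt x y c) s fun t s' => ∃ t₁, t = t₁ + 2 ∧ I N t₁ s' := by
  have hne : y ≠ x ∧ rOne ≠ x := by
    simp only [Cmd.keepsCount, Bool.and_eq_true, bne_iff_ne] at hc
    exact ⟨hc.1.1.1.1.symm, hc.1.1.1.2.symm⟩
  refine wp_seq.2 <| wp_set.2 <| (Wp.countTo_acc (a := 0) (N := N) I hc (by simp)
    (by simp [hne, hy]) (by simp [hne, h1]) h0 ?_).mono ?_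
  · intro k hk t s' hf hxk hI
    rw [zero_add] at hxk ⊢
    exact step k hk t s' ((Exec.set (ω := ω) s x 0).frame.seq hf) hxk hI
  · rintro t s' ⟨t₁, rfl, hI⟩
    exact ⟨t₁, by omega, hI⟩

theorem Wp.forLt_sum {ω : ℕ → ℕ → ℕ} {c : Cmd} {x y N : ℕ} {s : MState} (τ : ℕ → ℕ)
    (I : ℕ → MState → Prop) (hc : c.keepsCount x y = true)
    (hy : s.reg y = N) (h1 : s.reg rOne = 1) (h0 : I 0 (s.setReg x 0))
    (step : ∀ k < N, ∀ s', Frame (.forLt x y c) s s' → s'.reg x = k → I k s' →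
      Wp ω c s' fun t' s'' => t' ≤ τ k ∧ I (k + 1) (s''.setReg x (k + 1))) :
    Wp ω (.forLt x y c) s fun t s' => t ≤ ∑ k ∈ Finset.range N, (τ k + 2) + 2 ∧ I N s' := by
  refine (Wp.forLt_acc (fun k t s' => t ≤ ∑ j ∈ Finset.range k, (τ j + 2) ∧ I k s') hc hy h1
    ⟨by simp, h0⟩ ?_).mono ?_
  · rintro k hk t s' hf hxk ⟨ht, hI⟩
    refine (step k hk s' hf hxk hI).mono fun t' s'' ⟨_, hI'⟩ => ⟨?_, hI'⟩
    rw [Finset.sum_range_succ]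
    omega
  · rintro t s' ⟨t₁, rfl, ht, hI⟩
    exact ⟨by omega, hI⟩

theorem Wp.forLt {ω : ℕ → ℕ → ℕ} {c : Cmd} {x y N : ℕ} {s : MState} (τ : ℕ)
    (I : ℕ → MState → Prop) (hc : c.keepsCount x y = true)
    (hy : s.reg y = N) (h1 : s.reg rOne = 1) (h0 : I 0 (s.setReg x 0))
    (step : ∀ k < N, ∀ s', Frame (.forLt x y c) s s' → s'.reg x = k → I k s' →
      Wp ω c s' fun t' s'' => t' ≤ τ ∧ I (k + 1) (s''.setReg x (k + 1))) :
    Wp ω (.forLt x y c) s fun t s' => t ≤ N * (τ + 2) + 2 ∧ I N s' := by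
  simpa using Wp.forLt_sum (fun _ => τ) I hc hy h1 h0 step

/-! ### Breadth-first search -/

section LeastReachable

variable {V : Type*} [Fintype V] [LinearOrder V] (H : SimpleGraph V)

open Classical in
/-- The least vertex of the connected component of `v`; it serves as the root of the component. -/
noncomputable def leastReachable (v : V) : V :=
  ({u | H.Reachable v u} : Finset V).min' ⟨v, by simp⟩

variable {u v : V}

theorem reachable_leastReachable (v : V) : H.Reachable v (leastReachable H v) := by
  classical
  have := Finset.min'_mem ({u | H.Reachable v u} : Finset V) ⟨v, by simp⟩
  exact (Finset.mem_filter.1 this).2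

variable {H}

theorem leastReachable_le (h : H.Reachable v u) : leastReachable H v ≤ u := by
  classical
  exact Finset.min'_le _ _ (by simpa using h)

theorem leastReachable_eq_iff : leastReachable H v = leastReachable H u ↔ H.Reachable v u where
  mp h := (reachable_leastReachable H v).trans (h ▸ (reachable_leastReachable H u).symm)
  mpr h := le_antisymm (leastReachable_le (h.trans (reachable_leastReachable H u)))
    (leastReachable_le (h.symm.trans (reachable_leastReachable H v)))

theorem leastReachable_leastReachable (v : V) :
    leastReachable H (leastReachable H v) = leastReachable H v :=
  leastReachable_eq_iff.2 (reachable_leastReachable H v).symm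

end LeastReachable

/-- The root rule that picks the least vertex of every component. -/
noncomputable def leastRule (V : Type) [Fintype V] [LinearOrder V] : RootRule V where
  pick _ H c := leastReachable H c.out
  pick_mem _ H c := by
    rw [SimpleGraph.ConnectedComponent.mem_supp_iff]
    exact (SimpleGraph.ConnectedComponent.eq.2 (reachable_leastReachable H c.out).symm).trans
      (Quot.out_eq c)

theorem leastRule_pick {V : Type} [Fintype V] [LinearOrder V] (i : ℕ) (H : SimpleGraph V) (v : V) :
    (leastRule V).pick i H (H.connectedComponentMk v) = leastReachable H v :=
  leastReachable_eq_iff.2 (SimpleGraph.ConnectedComponent.eq.1 (Quot.out_eq _))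

section Distance

variable {V : Type*} {H : SimpleGraph V} {s x y : V}

theorem dist_le_dist_add_one_of_adj (h : H.Adj x y) : H.dist s y ≤ H.dist s x + 1 := by
  rcases h.diff_dist_adj (u := s) with h | h | h <;> omega

theorem exists_adj_dist_add_one_eq (h : H.Reachable s x) (hne : H.dist s x ≠ 0) :
    ∃ y, H.Adj y x ∧ H.Reachable s y ∧ H.dist s y + 1 = H.dist s x := by
  obtain ⟨p, hp⟩ := h.exists_walk_length_eq_dist
  have hnil : ¬ p.Nil := fun hn => hne (hp ▸ SimpleGraph.Walk.length_eq_zero_iff.2 hn)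
  have hadj := p.adj_penultimate hnil
  refine ⟨p.penultimate, hadj, p.dropLast.reachable,
    le_antisymm ?_ (dist_le_dist_add_one_of_adj hadj)⟩
  rw [← hp, ← SimpleGraph.Walk.length_dropLast_add_one hnil]
  exact Nat.succ_le_succ (SimpleGraph.dist_le _)

end Distance

/-- The state of a breadth-first search of `H` from `s`: the vertices in `p` are finished, those
in `w` wait in the queue. -/
structure BfsInv {V : Type*} (H : SimpleGraph V) (s : V) (p w : List V) : Prop where
  nodup : (p ++ w).Nodup
  start : s ∈ p ++ w
  reach : ∀ x ∈ p ++ w, H.Reachable s x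
  sorted : w.Pairwise fun x y => H.dist s x ≤ H.dist s y
  near : ∀ x ∈ w, ∀ y ∈ p ++ w, H.dist s y ≤ H.dist s x + 1
  closed : ∀ x ∈ p, ∀ y, H.Adj x y → y ∈ p ++ w

namespace BfsInv

variable {V : Type*} {H : SimpleGraph V} {s v u : V} {p w : List V}

theorem init (H : SimpleGraph V) (s : V) : BfsInv H s [] [s] := by
  constructor <;> simp

theorem dist_le_of_mem (h : BfsInv H s p (v :: w)) {x : V} (hx : x ∈ v :: w) :
    H.dist s v ≤ H.dist s x := by
  rcases List.mem_cons.1 hx with rfl | hx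
  · rfl
  · exact (List.pairwise_cons.1 h.sorted).1 x hx

theorem mem_of_dist_le (h : BfsInv H s p (v :: w)) {x : V} (hx : H.Reachable s x)
    (hd : H.dist s x ≤ H.dist s v) : x ∈ p ++ v :: w := by
  induction hm : H.dist s x generalizing x with
  | zero => exact hx.dist_eq_zero_iff.1 hm ▸ h.start
  | succ d ih =>
    obtain ⟨y, hyx, hy, hyd⟩ := exists_adj_dist_add_one_eq hx (by omega)
    rcases List.mem_append.1 (ih hy (by omega) (by omega)) with hp | hw
    · exact h.closed y hp x hyx
    · have := h.dist_le_of_mem hw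
      omega

theorem dist_eq_of_notMem (h : BfsInv H s p (v :: w)) (hvu : H.Adj v u) (hu : u ∉ p ++ v :: w) :
    H.dist s u = H.dist s v + 1 := by
  refine le_antisymm (dist_le_dist_add_one_of_adj hvu) ?_
  by_contra hlt
  exact hu (h.mem_of_dist_le ((h.reach v (by simp)).trans hvu.reachable) (by omega))

theorem push (h : BfsInv H s p (v :: w)) (hvu : H.Adj v u) (hu : u ∉ p ++ v :: w) :
    BfsInv H s p (v :: (w ++ [u])) := by
  have hd := h.dist_eq_of_notMem hvu hu
  have hle : ∀ x ∈ p ++ v :: w, H.dist s x ≤ H.dist s u := fun x hx =>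
    hd ▸ h.near v (by simp) x hx
  have hv : ∀ x ∈ v :: w, H.dist s u ≤ H.dist s x + 1 := fun x hx => by
    have := h.dist_le_of_mem hx
    omega
  rw [← List.cons_append]
  constructor
  · rw [← List.append_assoc]
    exact h.nodup.append (List.nodup_singleton u) (by simpa using hu)
  · rw [← List.append_assoc]
    exact List.mem_append_left _ h.start
  · rw [← List.append_assoc, List.forall_mem_append]
    exact ⟨h.reach, by simpa using (h.reach v (by simp)).trans hvu.reachable⟩
  · refine List.pairwise_append.2 ⟨h.sorted, List.pairwise_singleton _ u, fun x hx y hy => ?_⟩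
    exact List.mem_singleton.1 hy ▸ hle x (List.mem_append_right _ hx)
  · simp only [← List.append_assoc, List.forall_mem_append, List.mem_singleton, forall_eq]
    simp only [List.forall_mem_append] at hle
    exact ⟨fun x hx => ⟨List.forall_mem_append.1 (h.near x hx), hv x hx⟩,
      ⟨fun x hx => (hle.1 x hx).trans (Nat.le_succ _),
        fun x hx => (hle.2 x hx).trans (Nat.le_succ _)⟩, Nat.le_succ _⟩
  · rw [← List.append_assoc]
    exact fun x hx y hxy => List.mem_append_left _ (h.closed x hx y hxy)

theorem pop (h : BfsInv H s p (v :: w)) (hv : ∀ u, H.Adj v u → u ∈ p ++ v :: w) :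
    BfsInv H s (p ++ [v]) w := by
  have e : p ++ [v] ++ w = p ++ v :: w := by simp
  constructor
  · exact e ▸ h.nodup
  · exact e ▸ h.start
  · exact e ▸ h.reach
  · exact (List.pairwise_cons.1 h.sorted).2
  · exact e ▸ fun x hx => h.near x (List.mem_cons_of_mem _ hx)
  · rw [e, List.forall_mem_append]
    exact ⟨h.closed, by simpa using hv⟩

theorem mem_iff (h : BfsInv H s p []) (x : V) : x ∈ p ↔ H.Reachable s x := by
  refine ⟨fun hx => h.reach x (by simpa using hx), fun ⟨q⟩ => ?_⟩
  have hclosed : ∀ {a b : V} (_ : H.Walk a b), a ∈ p → b ∈ p := by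
    intro a b q
    induction q with
    | nil => exact id
    | cons hab _ ih => exact fun ha => ih (by simpa using h.closed _ ha _ hab)
  exact hclosed q (by simpa using h.start)

end BfsInv

/-! ### The registers and the input of the program -/

local notation "rN" => (0 : ℕ)
local notation "rRounds" => (1 : ℕ)
local notation "rLam" => (2 : ℕ)
local notation "rAlph" => (3 : ℕ)
local notation "rZero" => (5 : ℕ)
local notation "rRound" => (6 : ℕ)
local notation "rRoot" => (7 : ℕ)
local notation "rHead" => (8 : ℕ)
local notation "rTail" => (9 : ℕ)
local notation "rV" => (10 : ℕ)
local notation "rDeg" => (11 : ℕ)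
local notation "rIdx" => (12 : ℕ)
local notation "rU" => (13 : ℕ)
local notation "rMark" => (14 : ℕ)
local notation "rLev" => (15 : ℕ)
local notation "rLevU" => (16 : ℕ)
local notation "rPhase" => (17 : ℕ)
local notation "rFlag" => (18 : ℕ)
local notation "rStart" => (19 : ℕ)
local notation "rEnd" => (20 : ℕ)
local notation "rPos" => (21 : ℕ)
local notation "rCarry" => (22 : ℕ)
local notation "rLab" => (23 : ℕ)
local notation "rLabU" => (24 : ℕ)
local notation "fZero" => (0 : ℕ)
local notation "fBest" => (1 : ℕ)
local notation "fCur" => (2 : ℕ)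
local notation "fTmp" => (3 : ℕ)
local notation "aDeg" => (0 : ℕ)
local notation "aNbr" => (1 : ℕ)
local notation "aOut" => (2 : ℕ)
local notation "aLev" => (3 : ℕ)
local notation "aQueue" => (4 : ℕ)
local notation "aPhase" => (5 : ℕ)
local notation "aCut" => (6 : ℕ)
local notation "aStart" => (7 : ℕ)
local notation "aEnd" => (8 : ℕ)
local notation "aLab" => (9 : ℕ)
local notation "faPhi" => (0 : ℕ)
local notation "faPsi" => (1 : ℕ)

/-- The state holds the input and the constants `0` and `1`. The lists `nbr v` may be shorter than
those of the input, because the program can discard edges. -/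
structure HoldsInput {n q : ℕ} (M : MRF (Fin n) (Fin q)) (nbr : Fin n → List (Fin n)) (Λ : ℕ)
    (s : MState) : Prop where
  size : s.reg rN = n
  period : s.reg rLam = Λ
  alph : s.reg rAlph = q
  one : s.reg rOne = 1
  zero : s.reg rZero = 0
  fzero : s.rreg fZero = 0
  deg : ∀ v : Fin n, s.mem aDeg [(v : ℕ)] = (nbr v).length
  adj : ∀ (v : Fin n) (k : ℕ) (h : k < (nbr v).length), s.mem aNbr [(v : ℕ), k] = (nbr v)[k]
  phi : ∀ (v : Fin n) (x : Fin q), s.rmem faPhi [(v : ℕ), (x : ℕ)] = M.φ v x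
  psi : ∀ (v : Fin n) (k : ℕ) (h : k < (nbr v).length) (x y : Fin q),
    s.rmem faPsi [(v : ℕ), k, (x : ℕ), (y : ℕ)] = M.ψ v (nbr v)[k] x y

/-- `c` writes nothing that `HoldsInput` is about. -/
def Cmd.keepsInput (c : Cmd) : Bool :=
  [rN, rLam, rAlph, rOne, rZero].all (!c.wrReg ·) && !c.wrRReg fZero &&
    [aDeg, aNbr].all (!c.wrMem ·) && [faPhi, faPsi].all (!c.wrRMem ·)

theorem HoldsInput.frame {n q Λ : ℕ} {M : MRF (Fin n) (Fin q)} {nbr : Fin n → List (Fin n)}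
    {c : Cmd} {s s' : MState} (h : HoldsInput M nbr Λ s) (hf : Frame c s s')
    (hc : c.keepsInput = true) : HoldsInput M nbr Λ s' := by
  simp only [Cmd.keepsInput, List.all_cons, List.all_nil, Bool.and_eq_true, Bool.not_eq_true',
    and_true] at hc
  obtain ⟨⟨⟨⟨hN, hΛ, hq, h1, h0⟩, hz⟩, hdeg, hnbr⟩, hphi, hpsi⟩ := hc
  exact ⟨hf.reg _ hN ▸ h.size, hf.reg _ hΛ ▸ h.period, hf.reg _ hq ▸ h.alph, hf.reg _ h1 ▸ h.one,
    hf.reg _ h0 ▸ h.zero, hf.rreg _ hz ▸ h.fzero, hf.mem _ hdeg ▸ h.deg, hf.mem _ hnbr ▸ h.adj,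
    hf.rmem _ hphi ▸ h.phi, hf.rmem _ hpsi ▸ h.psi⟩

/-- The array of cut marks says which pairs of `nbr` are still adjacent in the current graph. -/
def HoldsCut {n : ℕ} (nbr : Fin n → List (Fin n)) (R : Fin n → Fin n → Prop) (s : MState) : Prop :=
  ∀ v, ∀ u ∈ nbr v, s.mem aCut [(v : ℕ), (u : ℕ)] = 0 ↔ R v u

/-- Run `c` for all neighbours `rU` of the vertex `rV` along edges that have not been cut. -/
def Cmd.forNbrs (c : Cmd) : Cmd :=
  .load rDeg aDeg [rV] ;;
  .forLt rIdx rDeg (.load rU aNbr [rV, rIdx] ;; .load rMark aCut [rV, rU] ;;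
    .ifLt rMark rOne c .skip)

/-- `c` can be the body of `Cmd.forNbrs`. -/
def Cmd.keepsNbrs (c : Cmd) : Bool :=
  c.keepsInput && [rV, rIdx, rDeg].all (!c.wrReg ·)

theorem Cmd.forNbrs_of_keepsNbrs {c : Cmd} (hc : c.keepsNbrs = true) :
    (Cmd.forNbrs c).keepsInput = true ∧ (Cmd.forNbrs c).wrReg rV = false ∧
      Cmd.keepsCount rIdx rDeg (.load rU aNbr [rV, rIdx] ;; .load rMark aCut [rV, rU] ;;
        .ifLt rMark rOne c .skip) = true := by
  simp only [Cmd.keepsNbrs, List.all_cons, List.all_nil, Bool.and_eq_true, Bool.not_eq_true',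
    and_true] at hc
  obtain ⟨hcin, hcv, hci, hcd⟩ := hc
  have hone : c.wrReg rOne = false := by simp_all [Cmd.keepsInput]
  refine ⟨?_, ?_, by simp [Cmd.keepsCount, Cmd.wrReg, hci, hcd, hone]⟩
  · simpa [Cmd.keepsInput, Cmd.forNbrs, Cmd.forLt, Cmd.countTo, Cmd.wrReg, Cmd.wrRReg, Cmd.wrMem,
      Cmd.wrRMem] using hcin
  · simpa [Cmd.forNbrs, Cmd.forLt, Cmd.countTo, Cmd.wrReg] using hcv

theorem Wp.forNbrs {ω : ℕ → ℕ → ℕ} {n q Λ : ℕ} {M : MRF (Fin n) (Fin q)}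
    {nbr : Fin n → List (Fin n)} {c : Cmd} {s : MState} {v : Fin n} (τ : ℕ)
    (I : List (Fin n) → MState → Prop) (hc : c.keepsNbrs = true) (hin : HoldsInput M nbr Λ s)
    (hv : s.reg rV = v)
    (hI : ∀ x ∈ [rIdx, rDeg, rU, rMark], ∀ k p s, I p s → I p (s.setReg x k)) (h0 : I [] s)
    (step : ∀ (p : List (Fin n)) (u : Fin n) s', p ++ [u] <+: nbr v → Frame (.forNbrs c) s s' →
      s'.reg rU = u → s'.reg rIdx = p.length → I p s' →
      (s'.mem aCut [(v : ℕ), (u : ℕ)] ≠ 0 → I (p ++ [u]) s') ∧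
      (s'.mem aCut [(v : ℕ), (u : ℕ)] = 0 → Wp ω c s' fun t s'' => t ≤ τ ∧ I (p ++ [u]) s'')) :
    Wp ω (.forNbrs c) s fun t s' => t ≤ (nbr v).length * (τ + 6) + 3 ∧ I (nbr v) s' := by
  obtain ⟨hkeep, hkv, hcount⟩ := Cmd.forNbrs_of_keepsNbrs hc
  simp only [List.forall_mem_cons] at hI
  obtain ⟨hI_idx, hI_deg, hI_u, hI_mark, -⟩ := hI
  set d := (nbr v).length
  have hdeg : (s.setReg rDeg (s.mem aDeg [s.reg rV])).reg rDeg = d := by simp [hv, hin.deg, d]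
  refine wp_seq.2 <| wp_load.2 <| (Wp.forLt (τ + 4) (fun k => I ((nbr v).take k)) hcount hdeg
    (by simp [hin.one]) (hI_idx _ _ _ (hI_deg _ _ _ h0)) ?_).mono ?_
  · intro k hk s' hf hidx hk'
    replace hf : Frame (.forNbrs c) s s' := (Exec.load (ω := ω) s rDeg aDeg [rV]).frame.seq hf
    have hin' := hin.frame hf hkeep
    have hv' : s'.reg rV = v := (hf.reg _ hkv).trans hv
    have hu : s'.mem aNbr [s'.reg rV, s'.reg rIdx] = (nbr v)[k] := by
      rw [hv', hidx, hin'.adj v k hk]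
    have hp : (nbr v).take k ++ [(nbr v)[k]] = (nbr v).take (k + 1) := List.take_concat_get' _ _ hk
    simp only [wp_seq, wp_load, wp_ifLt, wp_skip, List.map_cons, List.map_nil, hu]
    set s₂ := (s'.setReg rU (nbr v)[k]).setReg rMark _ with hs₂
    have hf₂ : Frame (.forNbrs c) s' s₂ := (Frame.setReg rfl _ _).trans (Frame.setReg rfl _ _)
    have hmark : s₂.reg rMark = s₂.mem aCut [(v : ℕ), ((nbr v)[k] : ℕ)] := by simp [hs₂, hv']
    obtain ⟨hskip, hrun⟩ := step _ _ s₂ (hp ▸ List.take_prefix _ _) (hf.trans hf₂) (by simp [hs₂])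
      (by simpa [hs₂, hidx] using hk.le) (hI_mark _ _ _ (hI_u _ _ _ hk'))
    rw [hp, ← hmark] at hskip hrun
    rw [show s₂.reg rOne = 1 from (hin'.frame hf₂ hkeep).one]
    split_ifs with hlt
    · exact (hrun (by omega)).mono fun t s'' ⟨_, hs''⟩ => ⟨by omega, hI_idx _ _ _ hs''⟩
    · exact ⟨by omega, hI_idx _ _ _ (hskip (by omega))⟩
  · rintro t s' ⟨ht, hs'⟩
    rw [List.take_length] at hs'
    exact ⟨by linarith, hs'⟩

/-- Run `c` for all vertices `rV` in the segment of the queue from `rStart` to `rEnd`. -/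
def Cmd.forSegment (c : Cmd) : Cmd :=
  .add rPos rStart rZero ;; .countTo rPos rEnd (.load rV aQueue [rPos] ;; c)

/-- `c` can be the body of `Cmd.forSegment`. -/
def Cmd.keepsSegment (c : Cmd) : Bool :=
  [rStart, rEnd, rPos, rOne].all (!c.wrReg ·) && !c.wrMem aQueue

/-- The registers `rStart` and `rEnd` delimit the segment `m` of the queue. -/
def AtSegment {n : ℕ} (m : List (Fin n)) (s : MState) : Prop :=
  s.reg rEnd = s.reg rStart + m.length ∧
    ∀ (j : ℕ) (h : j < m.length), s.mem aQueue [s.reg rStart + j] = m[j]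

theorem AtSegment.frame {n : ℕ} {m : List (Fin n)} {c : Cmd} {s s' : MState} (h : AtSegment m s)
    (hf : Frame c s s') (hc : c.wrReg rStart = false ∧ c.wrReg rEnd = false ∧
      c.wrMem aQueue = false) : AtSegment m s' := by
  rw [AtSegment, hf.reg _ hc.1, hf.reg _ hc.2.1, hf.mem _ hc.2.2]
  exact h

theorem Wp.forSegment {ω : ℕ → ℕ → ℕ} {n : ℕ} {c : Cmd} {s : MState} {m : List (Fin n)} (τ : ℕ)
    (I : List (Fin n) → MState → Prop) (hc : c.keepsSegment = true) (hm : AtSegment m s)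
    (hone : s.reg rOne = 1) (hzero : s.reg rZero = 0)
    (hI : ∀ x ∈ [rPos, rV], ∀ k p s, I p s → I p (s.setReg x k)) (h0 : I [] s)
    (step : ∀ (p : List (Fin n)) (v : Fin n) s', p ++ [v] <+: m → Frame (.forSegment c) s s' →
      s'.reg rV = v → I p s' → Wp ω c s' fun t s'' => t ≤ τ ∧ I (p ++ [v]) s'') :
    Wp ω (.forSegment c) s fun t s' => t ≤ m.length * (τ + 3) + 2 ∧ I m s' := by
  simp only [Cmd.keepsSegment, List.all_cons, List.all_nil, Bool.and_eq_true, Bool.not_eq_true',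
    and_true] at hc
  obtain ⟨⟨hcs, hce, hcp, hc1⟩, hcq⟩ := hc
  have hframe : (Cmd.forSegment c).wrReg rStart = false ∧ (Cmd.forSegment c).wrReg rEnd = false ∧
      (Cmd.forSegment c).wrMem aQueue = false := by
    simp [Cmd.forSegment, Cmd.countTo, Cmd.wrReg, Cmd.wrMem, hcs, hce, hcq]
  have hcount : Cmd.keepsCount rPos rEnd (.load rV aQueue [rPos] ;; c) = true := by
    simp [Cmd.keepsCount, Cmd.wrReg, hce, hcp, hc1]
  simp only [List.forall_mem_cons] at hI
  obtain ⟨hI_pos, hI_v, -⟩ := hI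
  refine wp_seq.2 <| wp_add.2 <| (Wp.countTo (a := s.reg rStart) (N := m.length) (τ + 1)
    (fun k => I (m.take k)) hcount (by simp [hzero])
    (by simp [hm.1]) (by simp [hone]) (hI_pos _ _ _ h0) ?_).mono ?_
  · intro k hk s' hf hpos hk'
    replace hf : Frame (.forSegment c) s s' :=
      (Exec.add (ω := ω) s rPos rStart rZero).frame.seq hf
    have hp : m.take k ++ [m[k]] = m.take (k + 1) := List.take_concat_get' _ _ hk
    have hv : s'.mem aQueue [s'.reg rPos] = m[k] := by
      have := (hm.frame hf hframe).2 k hk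
      rwa [hf.reg _ hframe.1, ← hpos] at this
    have hw := step _ _ (s'.setReg rV m[k]) (hp ▸ List.take_prefix _ _)
      (hf.trans (Frame.setReg rfl _ _)) (by simp) (hI_v _ _ _ hk')
    simp only [wp_seq, wp_load, List.map_cons, List.map_nil, hv]
    exact hw.mono fun t s'' ⟨_, hs''⟩ => ⟨by omega, hI_pos _ _ _ (hp ▸ hs'')⟩
  · rintro t s' ⟨ht, hs'⟩
    rw [List.take_length] at hs'
    exact ⟨by linarith, hs'⟩

/-! ### The program for breadth-first search -/

/-- The residue modulo `Λ` of the level `d` minus the drawn number `a`, for `a ≤ Λ`. -/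
def phase (Λ a d : ℕ) : ℕ := (d + (Λ - a)) % Λ

theorem phase_zero (Λ a : ℕ) : phase Λ a 0 = if Λ - a < Λ then Λ - a else 0 := by
  rw [phase, zero_add]
  split_ifs with h
  · exact Nat.mod_eq_of_lt h
  · rw [(Nat.sub_le Λ a).antisymm (not_lt.1 h), Nat.mod_self]

theorem phase_succ {Λ : ℕ} (hΛ : 0 < Λ) (a d : ℕ) :
    phase Λ a (d + 1) = if phase Λ a d + 1 < Λ then phase Λ a d + 1 else 0 := by
  have hlt : phase Λ a d < Λ := Nat.mod_lt _ hΛ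
  have hmod : phase Λ a (d + 1) = (phase Λ a d + 1) % Λ := by
    rw [phase, phase, Nat.mod_add_mod, add_right_comm]
  split_ifs with h
  · rw [hmod, Nat.mod_eq_of_lt h]
  · rw [hmod, show phase Λ a d + 1 = Λ by omega, Nat.mod_self]

theorem phase_eq_zero_iff {Λ a d : ℕ} (ha : a < Λ) : phase Λ a d = 0 ↔ ∃ k, d = k * Λ + a := by
  rw [phase, ← Nat.dvd_iff_mod_eq_zero]
  constructor
  · rintro ⟨k, hk⟩
    obtain _ | k := k
    · omega
    · exact ⟨k, by rw [mul_comm] at hk; rw [add_mul] at hk; omega⟩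
  · rintro ⟨k, rfl⟩
    exact ⟨k + 1, by rw [mul_add, mul_comm]; omega⟩

section TreeLevel

variable {n : ℕ} (H : SimpleGraph (Fin n))

/-- The distance of a vertex to the root of its component. -/
noncomputable def treeLevel (v : Fin n) : ℕ := H.dist (leastReachable H v) v

/-- The phase of a vertex when the number `a r` is drawn for the component with root `r`. -/
noncomputable def treePhase (Λ : ℕ) (a : Fin n → ℕ) (v : Fin n) : ℕ :=
  phase Λ (a (leastReachable H v)) (treeLevel H v)

end TreeLevel

/-- `rPhase := rPhase % rLam`, for `rPhase ≤ rLam` -/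
def wrapPhase : Cmd := .ifLt rPhase rLam .skip (.set rPhase 0)

def pushVertex : Cmd :=
  .store aLev [rU] rLev ;; .store aPhase [rU] rPhase ;; .store aQueue [rTail] rU ;;
    .add rTail rTail rOne

def visit : Cmd := .load rFlag aLev [rU] ;; .ifLt rFlag rOne pushVertex .skip

def bfsPop : Cmd :=
  .load rV aQueue [rHead] ;; .add rHead rHead rOne ;; .load rLev aLev [rV] ;; .add rLev rLev rOne ;;
    .load rPhase aPhase [rV] ;; .add rPhase rPhase rOne ;; wrapPhase

def bfsStep : Cmd := bfsPop ;; .forNbrs visit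

def bfsStart : Cmd :=
  .add rU rRoot rZero ;; .set rLev 1 ;; .draw rPhase rRound rRoot ;; .sub rPhase rLam rPhase ;;
    wrapPhase ;; pushVertex

/-- Search the component of `rRoot`, unless a smaller root has already reached it. -/
def bfsSearch : Cmd :=
  .load rFlag aLev [rRoot] ;; .ifLt rFlag rOne bfsStart .skip ;; .whileLt rHead rTail bfsStep

/-- The vertices visited from one root form a segment of the queue, whose ends are stored. -/
def bfsRoot : Cmd := .store aStart [rRoot] rTail ;; bfsSearch ;; .store aEnd [rRoot] rTail

def bfsAll : Cmd :=
  .forLt rV rN (.store aLev [rV] rZero) ;; .set rHead 0 ;; .set rTail 0 ;; .forLt rRoot rN bfsRoot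

/-- The queue has been filled with the vertices of `l`. The stored level is the level plus one,
so that `0` marks the vertices that are not in the queue. -/
structure Visited {n : ℕ} (lev ph : Fin n → ℕ) (l : List (Fin n)) (s : MState) : Prop where
  tail : s.reg rTail = l.length
  queue : ∀ (i : ℕ) (h : i < l.length), s.mem aQueue [i] = l[i]
  level_eq_zero : ∀ v ∉ l, s.mem aLev [(v : ℕ)] = 0
  level : ∀ v ∈ l, s.mem aLev [(v : ℕ)] = lev v + 1
  phase : ∀ v ∈ l, s.mem aPhase [(v : ℕ)] = ph v

section Visited

variable {ω : ℕ → ℕ → ℕ} {n : ℕ} {lev ph : Fin n → ℕ} {l : List (Fin n)} {s : MState} {u : Fin n}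

theorem Visited.congr (h : Visited lev ph l s) {s' : MState} (ht : s'.reg rTail = s.reg rTail)
    (hm : ∀ a ∈ [aLev, aQueue, aPhase], s'.mem a = s.mem a) : Visited lev ph l s' := by
  simp only [List.forall_mem_cons] at hm
  obtain ⟨hl, hq, hp, -⟩ := hm
  exact ⟨ht ▸ h.tail, hq ▸ h.queue, hl ▸ h.level_eq_zero, hl ▸ h.level, hp ▸ h.phase⟩

theorem Visited.setReg (h : Visited lev ph l s) {x : ℕ} (hx : rTail ≠ x) (k : ℕ) :
    Visited lev ph l (s.setReg x k) :=
  h.congr (by simp [hx]) fun _ _ => rfl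

theorem Visited.wp_pushVertex (h : Visited lev ph l s) (hone : s.reg rOne = 1) (hu : s.reg rU = u)
    (hlev : s.reg rLev = lev u + 1) (hph : s.reg rPhase = ph u) :
    Wp ω pushVertex s fun t s' => t = 4 ∧ Visited lev ph (l ++ [u]) s' := by
  simp only [pushVertex, wp_seq, wp_store, wp_add]
  refine ⟨trivial, ?_, ?_, ?_, ?_, ?_⟩
  · simp [h.tail, hone]
  · intro i hi
    rw [List.length_append, List.length_singleton] at hi
    rcases Nat.lt_succ_iff_lt_or_eq.1 hi with hi | rfl
    · simp [h.tail, hi.ne, h.queue i hi, List.getElem_append_left hi]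
    · simp [h.tail, hu]
  · intro v hv
    rw [List.mem_append, List.mem_singleton, not_or] at hv
    simp [hu, Fin.val_inj, hv.2, h.level_eq_zero v hv.1]
  · intro v hv
    by_cases hvu : v = u
    · simp [hvu, hu, hlev]
    · simp [hu, Fin.val_inj, hvu, h.level v (by simpa [hvu] using hv)]
  · intro v hv
    by_cases hvu : v = u
    · simp [hvu, hu, hph]
    · simp [hu, Fin.val_inj, hvu, h.phase v (by simpa [hvu] using hv)]

theorem Visited.wp_visit (h : Visited lev ph l s) (hone : s.reg rOne = 1) (hu : s.reg rU = u)
    (hul : u ∉ l → s.reg rLev = lev u + 1 ∧ s.reg rPhase = ph u) :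
    Wp ω visit s fun t s' => t ≤ 6 ∧ Visited lev ph (if u ∈ l then l else l ++ [u]) s' := by
  simp only [visit, wp_seq, wp_load, wp_ifLt, List.map_cons, List.map_nil, hu]
  by_cases hmem : u ∈ l
  · simpa [hone, h.level u hmem, hmem] using h.setReg (by decide) _
  · have hw := (h.setReg (x := rFlag) (by decide) 0).wp_pushVertex (ω := ω) (by simpa using hone)
      (by simpa using hu) (by simpa using (hul hmem).1) (by simpa using (hul hmem).2)
    simp only [h.level_eq_zero u hmem, if_neg hmem]
    simpa [hone] using hw.mono fun t s' ⟨_, hs'⟩ => ⟨by omega, hs'⟩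

end Visited

theorem wp_wrapPhase {ω : ℕ → ℕ → ℕ} {s : MState} {Q : ℕ → MState → Prop} {k : ℕ}
    (hk : k = if s.reg rPhase < s.reg rLam then s.reg rPhase else 0)
    (hQ : Q 2 (s.setReg rPhase k)) :
    Wp ω wrapPhase s Q := by
  rw [wrapPhase, wp_ifLt]
  split_ifs at hk ⊢ with h
  · simpa [hk, MState.setReg] using hQ
  · simpa [hk] using hQ

/-- The state of the program while it searches the component of `r`: the vertices of `l` belong
to other components, and the search has finished those of `p` and holds those of `w`. -/
structure Searching {n : ℕ} (H : SimpleGraph (Fin n)) (Λ : ℕ) (a : Fin n → ℕ) (r : Fin n)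
    (l p w : List (Fin n)) (s : MState) : Prop where
  inv : BfsInv H r p w
  visited : Visited (treeLevel H) (treePhase H Λ a) (l ++ (p ++ w)) s
  head : s.reg rHead = l.length + p.length

section Search

variable {ω : ℕ → ℕ → ℕ} {n q Λ : ℕ} {M : MRF (Fin n) (Fin q)} {nbr : Fin n → List (Fin n)}
  {H : SimpleGraph (Fin n)} {s : MState} {a : Fin n → ℕ} {r : Fin n} {l p w : List (Fin n)}

theorem treeLevel_of_reachable (hr : leastReachable H r = r) {v : Fin n} (hv : H.Reachable r v) :
    treeLevel H v = H.dist r v := by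
  rw [treeLevel, leastReachable_eq_iff.2 hv.symm, hr]

theorem treePhase_of_reachable (hr : leastReachable H r = r) {v : Fin n} (hv : H.Reachable r v) :
    treePhase H Λ a v = phase Λ (a r) (H.dist r v) := by
  rw [treePhase, treeLevel_of_reachable hr hv, leastReachable_eq_iff.2 hv.symm, hr]

/-- The invariant of the loop over the neighbours of `v`. -/
def Expanding (H : SimpleGraph (Fin n)) (Λ : ℕ) (a : Fin n → ℕ) (r : Fin n) (l p : List (Fin n))
    (v : Fin n) (us : List (Fin n)) (s : MState) : Prop :=
  ∃ w, BfsInv H r p (v :: w) ∧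
    Visited (treeLevel H) (treePhase H Λ a) (l ++ (p ++ v :: w)) s ∧
    ∀ u ∈ us, H.Adj v u → u ∈ p ++ v :: w

theorem Expanding.wp_visit {v u : Fin n} {us : List (Fin n)} (h : Expanding H Λ a r l p v us s)
    (hr : leastReachable H r = r) (hl : ∀ x ∈ l, ¬ H.Reachable r x) (hvu : H.Adj v u)
    (hone : s.reg rOne = 1) (hu : s.reg rU = u) (hlev : s.reg rLev = H.dist r v + 2)
    (hph : s.reg rPhase = phase Λ (a r) (H.dist r v + 1)) :
    Wp ω visit s fun t s' => t ≤ 6 ∧ Expanding H Λ a r l p v (us ++ [u]) s' := by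
  obtain ⟨w, hinv, hvis, hus⟩ := h
  have hru : H.Reachable r u := (hinv.reach v (by simp)).trans hvu.reachable
  have hmem : u ∈ l ++ (p ++ v :: w) ↔ u ∈ p ++ v :: w := by
    rw [List.mem_append, or_iff_right fun hul => hl u hul hru]
  refine (hvis.wp_visit hone hu fun hul => ?_).mono fun t s' ⟨ht, hs'⟩ => ⟨ht, ?_⟩
  · have hd := hinv.dist_eq_of_notMem hvu (mt hmem.2 hul)
    rw [treeLevel_of_reachable hr hru, treePhase_of_reachable hr hru, hd]
    exact ⟨hlev, hph⟩
  · simp only [hmem] at hs'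
    split_ifs at hs' with hul
    · refine ⟨w, hinv, hs', fun x hx hvx => ?_⟩
      rcases List.mem_append.1 hx with hx | hx
      · exact hus x hx hvx
      · exact List.mem_singleton.1 hx ▸ hul
    · refine ⟨w ++ [u], hinv.push hvu hul, by simpa using hs', fun x hx hvx => ?_⟩
      rcases List.mem_append.1 hx with hx | hx
      · have := hus x hx hvx
        simp only [List.mem_append, List.mem_cons] at this ⊢
        tauto
      · simp_all

theorem Searching.wp_bfsPop {v : Fin n} (h : Searching H Λ a r l p (v :: w) s)
    (hin : HoldsInput M nbr Λ s) (hΛ : 0 < Λ) (hr : leastReachable H r = r) :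
    Wp ω bfsPop s fun t s' => t = 8 ∧ s'.reg rV = v ∧ s'.reg rHead = l.length + p.length + 1 ∧
      s'.reg rLev = H.dist r v + 2 ∧ s'.reg rPhase = phase Λ (a r) (H.dist r v + 1) := by
  have hrv : H.Reachable r v := h.inv.reach v (by simp)
  have hlen : l.length + p.length < (l ++ (p ++ v :: w)).length := by simp
  have hv : s.mem aQueue [l.length + p.length] = v := by rw [h.visited.queue _ hlen]; simp
  have hlev : s.mem aLev [(v : ℕ)] = H.dist r v + 1 := by
    rw [h.visited.level v (by simp), treeLevel_of_reachable hr hrv]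
  have hph : s.mem aPhase [(v : ℕ)] = phase Λ (a r) (H.dist r v) := by
    rw [h.visited.phase v (by simp), treePhase_of_reachable hr hrv]
  simp only [bfsPop, wp_seq, wp_load, wp_add, List.map_cons, List.map_nil]
  apply wp_wrapPhase (k := phase Λ (a r) (H.dist r v + 1)) <;>
    simp [phase_succ hΛ, hin.one, hin.period, hv, hlev, hph, h.head]

theorem Searching.wp_bfsStep {v : Fin n} {A : ℕ} (h : Searching H Λ a r l p (v :: w) s)
    (hin : HoldsInput M nbr Λ s) (hcut : HoldsCut nbr H.Adj s) (hΛ : 0 < Λ)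
    (hnbr : ∀ v u, H.Adj v u → u ∈ nbr v) (hA : ∀ v, (nbr v).length ≤ A)
    (hr : leastReachable H r = r) (hl : ∀ x ∈ l, ¬ H.Reachable r x) :
    Wp ω bfsStep s fun t s' => t ≤ 12 * A + 11 ∧ ∃ w', Searching H Λ a r l (p ++ [v]) w' s' := by
  refine wp_seq.2 <| (h.wp_bfsPop hin hΛ hr).withFrame.mono ?_
  rintro _ s₁ ⟨⟨rfl, hv, hhead, hlev, hph⟩, hf₁⟩
  have hin₁ := hin.frame hf₁ rfl
  have hvis₁ := h.visited.congr (hf₁.reg rTail rfl) fun a ha => hf₁.mem a (by fin_cases ha <;> rfl)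
  refine (Wp.forNbrs 6 (Expanding H Λ a r l p v) rfl hin₁ hv ?_ ⟨w, h.inv, hvis₁, by simp⟩
    ?_).withFrame.mono ?_
  · rintro x hx k us s' ⟨w', hinv, hvis, hus⟩
    exact ⟨w', hinv, hvis.setReg (by rintro rfl; simp at hx) k, hus⟩
  · intro us u s' hus hf hu _ hI
    have hadj : s'.mem aCut [(v : ℕ), (u : ℕ)] = 0 ↔ H.Adj v u := by
      rw [hf.mem aCut rfl, hf₁.mem aCut rfl]
      exact hcut v u (hus.subset (by simp))
    refine ⟨fun hne => ?_, fun h0 => hI.wp_visit hr hl (hadj.1 h0) (hin₁.frame hf rfl).one hu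
      ((hf.reg rLev rfl).trans hlev) ((hf.reg rPhase rfl).trans hph)⟩
    obtain ⟨w', hinv, hvis, hmem⟩ := hI
    refine ⟨w', hinv, hvis, fun x hx hvx => ?_⟩
    rcases List.mem_append.1 hx with hx | hx
    · exact hmem x hx hvx
    · exact absurd (hadj.2 (List.mem_singleton.1 hx ▸ hvx)) hne
  · rintro t s' ⟨⟨ht, w', hinv, hvis, hmem⟩, hf⟩
    have := Nat.mul_le_mul_right 12 (hA v)
    refine ⟨by omega, w', hinv.pop fun u hvu => hmem u (hnbr v u hvu) hvu, by simpa using hvis, ?_⟩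
    rw [hf.reg rHead rfl, hhead, List.length_append, List.length_singleton, add_assoc]

theorem Searching.wp_bfsStart (h : Visited (treeLevel H) (treePhase H Λ a) l s)
    (hhead : s.reg rHead = l.length) (hin : HoldsInput M nbr Λ s) (hroot : s.reg rRoot = r)
    (hr : leastReachable H r = r) (ha : ω (s.reg rRound) r = a r) :
    Wp ω bfsStart s fun t s' => t = 10 ∧ Searching H Λ a r l [] [r] s' := by
  simp only [bfsStart, wp_seq, wp_add, wp_set, wp_draw, wp_sub]
  refine wp_wrapPhase (k := phase Λ (a r) 0) (by simp [phase_zero, hin.period, hroot, ha]) ?_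
  set s₁ := MState.setReg _ rPhase (phase Λ (a r) 0) with hs₁
  have hvis : Visited (treeLevel H) (treePhase H Λ a) l s₁ :=
    h.congr (by simp [hs₁]) fun _ _ => rfl
  refine (hvis.wp_pushVertex (u := r) (by simp [hs₁, hin.one]) (by simp [hs₁, hin.zero, hroot])
    (by simp [hs₁, treeLevel, hr]) (by simp [hs₁, treePhase, treeLevel, hr])).withFrame.mono ?_
  rintro _ s' ⟨⟨rfl, hs'⟩, hf⟩
  refine ⟨rfl, .init H r, by simpa using hs', ?_⟩
  rw [hf.reg rHead rfl]
  simp [hs₁, hhead]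

theorem Searching.wp_whileLt_bfsStep {A : ℕ} (h : Searching H Λ a r l [] [r] s)
    (hin : HoldsInput M nbr Λ s) (hcut : HoldsCut nbr H.Adj s) (hΛ : 0 < Λ)
    (hnbr : ∀ v u, H.Adj v u → u ∈ nbr v) (hA : ∀ v, (nbr v).length ≤ A)
    (hr : leastReachable H r = r) (hl : ∀ x ∈ l, ¬ H.Reachable r x) :
    Wp ω (.whileLt rHead rTail bfsStep) s fun t s' => ∃ m, t ≤ m.length * (12 * A + 12) + 1 ∧
      Searching H Λ a r l m [] s' := by
  refine (Wp.whileLt n (12 * A + 11)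
    (fun k s' => ∃ p w, p.length = k ∧ Searching H Λ a r l p w s') ⟨[], [r], rfl, h⟩ ?_).mono ?_
  · rintro _ s' hf ⟨p, w, rfl, hs'⟩ hlt
    obtain _ | ⟨v, w⟩ := w
    · simp [hs'.head, hs'.visited.tail] at hlt
    · refine ⟨?_, (hs'.wp_bfsStep (hin.frame hf rfl) ?_ hΛ hnbr hA hr hl).mono ?_⟩
      · have := hs'.inv.nodup.length_le_card
        simp only [List.length_append, List.length_cons, Fintype.card_fin] at this
        omega
      · rw [HoldsCut, hf.mem aCut rfl]
        exact hcut
      · exact fun t s'' ⟨ht, w', hw'⟩ => ⟨ht, p ++ [v], w', by simp, hw'⟩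
  · rintro t s' ⟨_, ht, ⟨p, w, rfl, hs'⟩, hlt⟩
    obtain rfl : w = [] := by
      rw [hs'.head, hs'.visited.tail, List.length_append, List.length_append] at hlt
      exact List.length_eq_zero_iff.1 (by omega)
    exact ⟨p, ht, hs'⟩

end Search

/-- The ends of the segment of the queue `l` that holds the component with root `r` are stored; if
`r` is not a root, the segment is empty. -/
def HoldsSegment {n : ℕ} (H : SimpleGraph (Fin n)) (l : List (Fin n)) (r : Fin n) (s : MState) :
    Prop :=
  ∃ p m w, l = p ++ m ++ w ∧ (∀ x, x ∈ m ↔ leastReachable H x = r) ∧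
    s.mem aStart [(r : ℕ)] = p.length ∧ s.mem aEnd [(r : ℕ)] = p.length + m.length

/-- The components of the roots less than `k` have been searched. -/
structure Searched {n : ℕ} (H : SimpleGraph (Fin n)) (Λ : ℕ) (a : Fin n → ℕ) (k : ℕ)
    (l : List (Fin n)) (s : MState) : Prop where
  nodup : l.Nodup
  mem_iff : ∀ v : Fin n, v ∈ l ↔ ((leastReachable H v : Fin n) : ℕ) < k
  visited : Visited (treeLevel H) (treePhase H Λ a) l s
  head : s.reg rHead = l.length
  segment : ∀ r : Fin n, (r : ℕ) < k → HoldsSegment H l r s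

section SearchAll

variable {ω : ℕ → ℕ → ℕ} {n q Λ A k : ℕ} {M : MRF (Fin n) (Fin q)} {nbr : Fin n → List (Fin n)}
  {H : SimpleGraph (Fin n)} {s : MState} {a : Fin n → ℕ} {r : Fin n} {l : List (Fin n)}

theorem wp_bfsSearch (hl : ∀ v : Fin n, v ∈ l ↔ leastReachable H v < r)
    (hvis : Visited (treeLevel H) (treePhase H Λ a) l s) (hhead : s.reg rHead = l.length)
    (hin : HoldsInput M nbr Λ s) (hcut : HoldsCut nbr H.Adj s) (hΛ : 0 < Λ)
    (hnbr : ∀ v u, H.Adj v u → u ∈ nbr v) (hA : ∀ v, (nbr v).length ≤ A)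
    (hroot : s.reg rRoot = r) (ha : ω (s.reg rRound) r = a r) :
    Wp ω bfsSearch s fun t s' => ∃ m, t ≤ m.length * (12 * A + 12) + 13 ∧
      m.Nodup ∧ (∀ v : Fin n, v ∈ m ↔ leastReachable H v = r) ∧
      Visited (treeLevel H) (treePhase H Λ a) (l ++ m) s' ∧
      s'.reg rHead = l.length + m.length := by
  set s₁ := s.setReg rFlag (s.mem aLev [s.reg rRoot]) with hs₁
  have hvis₁ : Visited (treeLevel H) (treePhase H Λ a) l s₁ := hvis.setReg (by decide) _
  have hf₁ : Frame bfsSearch s s₁ := .setReg rfl _ _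
  have hin₁ : HoldsInput M nbr Λ s₁ := hin.frame hf₁ rfl
  have hflag : s₁.reg rFlag = s.mem aLev [(r : ℕ)] := by simp [hs₁, hroot]
  have hone : s₁.reg rOne = 1 := hin₁.one
  simp only [bfsSearch, wp_seq, wp_load, wp_ifLt, List.map_cons, List.map_nil, ← hs₁, hflag, hone]
  by_cases hr : leastReachable H r = r
  · have hrl : r ∉ l := by rw [hl, hr]; exact lt_irrefl _
    have hunreach : ∀ x ∈ l, ¬ H.Reachable r x := by
      intro x hx hrx
      rw [hl, ← leastReachable_eq_iff.2 hrx, hr] at hx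
      exact hx.false
    rw [hvis.level_eq_zero r hrl, if_pos one_pos]
    refine (Searching.wp_bfsStart hvis₁ (by simpa [hs₁] using hhead) hin₁
      (by simpa [hs₁] using hroot) hr (by simpa [hs₁] using ha)).withFrame.mono ?_
    rintro _ s₂ ⟨⟨rfl, hs₂⟩, hf₂⟩
    refine (hs₂.wp_whileLt_bfsStep (hin₁.frame hf₂ rfl) ?_ hΛ hnbr hA hr hunreach).mono ?_
    · rw [HoldsCut, hf₂.mem aCut rfl]
      exact hcut
    · rintro t s' ⟨m, ht, hs'⟩
      refine ⟨m, by omega, by simpa using hs'.inv.nodup, fun v => ?_, by simpa using hs'.visited,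
        hs'.head⟩
      rw [hs'.inv.mem_iff, ← leastReachable_eq_iff, hr, eq_comm]
  · have hlt : leastReachable H r < r := lt_of_le_of_ne (leastReachable_le .rfl) hr
    rw [hvis.level r ((hl r).2 hlt), if_neg (by simp), wp_skip]
    refine ⟨1, s₁, .whileLt_false ?_, [], by simp, List.nodup_nil, fun v => ?_,
      by simpa using hvis₁, by simpa [hs₁] using hhead⟩
    · rw [hvis₁.tail]
      simp [hs₁, hhead]
    · refine ⟨fun hv => absurd hv (List.not_mem_nil), fun hv => absurd ?_ hr⟩
      rw [← hv, leastReachable_leastReachable]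

theorem Searched.wp_bfsRoot (h : Searched H Λ a r l s) (hin : HoldsInput M nbr Λ s)
    (hcut : HoldsCut nbr H.Adj s) (hΛ : 0 < Λ) (hnbr : ∀ v u, H.Adj v u → u ∈ nbr v)
    (hA : ∀ v, (nbr v).length ≤ A) (hroot : s.reg rRoot = r) (ha : ω (s.reg rRound) r = a r) :
    Wp ω bfsRoot s fun t s' => ∃ m, t ≤ m.length * (12 * A + 12) + 15 ∧
      Searched H Λ a (r + 1) (l ++ m) s' := by
  rw [bfsRoot, wp_seq, wp_store, wp_seq]
  set s₁ := s.setMem aStart _ _ with hs₁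
  have hf₁ := (Exec.store (ω := ω) s aStart [rRoot] rTail).frame
  rw [← hs₁] at hf₁
  refine (wp_bfsSearch (s := s₁) h.mem_iff (h.visited.congr rfl fun x hx => hf₁.mem x ?_) h.head
    (hin.frame hf₁ rfl) ?_ hΛ hnbr hA hroot ha).withFrame.mono ?_
  · fin_cases hx <;> rfl
  · rw [HoldsCut, hf₁.mem aCut rfl]
    exact hcut
  rintro t s₂ ⟨⟨m, ht, hnodup, hm, hvis, hhead⟩, hf₂⟩
  have hf₃ := (Exec.store (ω := ω) s₂ aEnd [rRoot] rTail).frame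
  have hroot₂ : s₂.reg rRoot = r := (hf₂.reg rRoot rfl).trans hroot
  rw [wp_store]
  refine ⟨m, by omega, ?_, fun v => ?_, hvis.congr rfl fun x hx => hf₃.mem x ?_,
    by simpa using hhead, fun r' hr' => ?_⟩
  · refine h.nodup.append hnodup fun v hvl hvm => ?_
    exact ((h.mem_iff v).1 hvl).ne (by rw [(hm v).1 hvm])
  · rw [List.mem_append, h.mem_iff, hm, Nat.lt_succ_iff_lt_or_eq, Fin.val_inj]
  · fin_cases hx <;> rfl
  · rcases Nat.lt_succ_iff_lt_or_eq.1 hr' with hlt | heq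
    · obtain ⟨p, m', w, hl, hm', hstart, hend⟩ := h.segment r' hlt
      refine ⟨p, m', w ++ m, by simp [hl], hm', ?_, ?_⟩ <;>
        simp [hf₂.mem aStart rfl, hf₂.mem aEnd rfl, hroot₂, hroot, hs₁, hlt.ne, hstart, hend]
    · obtain rfl := Fin.val_inj.1 heq
      refine ⟨l, m, [], by simp, hm, ?_, ?_⟩ <;>
        simp [hf₂.mem aStart rfl, hroot, hroot₂, hs₁, h.visited.tail, hvis.tail]

theorem Searched.setReg (h : Searched H Λ a k l s) {x : ℕ} (hx : x ∉ [rHead, rTail]) (j : ℕ) :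
    Searched H Λ a k l (s.setReg x j) := by
  simp only [List.mem_cons, List.not_mem_nil, or_false, not_or] at hx
  exact ⟨h.nodup, h.mem_iff, h.visited.setReg (Ne.symm hx.2) j, by simp [Ne.symm hx.1, h.head],
    h.segment⟩

theorem wp_clearLevels (hin : HoldsInput M nbr Λ s) :
    Wp ω (.forLt rV rN (.store aLev [rV] rZero)) s fun t s' => t ≤ n * 3 + 2 ∧
      ∀ v : Fin n, s'.mem aLev [(v : ℕ)] = 0 := by
  refine (Wp.forLt 1 (fun k s' => ∀ v : Fin n, (v : ℕ) < k → s'.mem aLev [(v : ℕ)] = 0) rfl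
    hin.size hin.one (by simp) ?_).mono fun t s' ⟨ht, h⟩ => ⟨ht, fun v => h v v.2⟩
  intro k _ s' hf hk h
  rw [wp_store]
  refine ⟨le_rfl, fun v hv => ?_⟩
  rcases Nat.lt_succ_iff_lt_or_eq.1 hv with hv | hv
  · simp [hk, hv.ne, h v hv]
  · simp [hk, hv, hf.reg rZero rfl, hin.zero]

theorem wp_bfsAll (hin : HoldsInput M nbr Λ s) (hcut : HoldsCut nbr H.Adj s) (hΛ : 0 < Λ)
    (hnbr : ∀ v u, H.Adj v u → u ∈ nbr v) (hA : ∀ v, (nbr v).length ≤ A)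
    (ha : ∀ v : Fin n, ω (s.reg rRound) v = a v) :
    Wp ω bfsAll s fun t s' => t ≤ n * (12 * A + 32) + 6 ∧ ∃ l, Searched H Λ a n l s' := by
  refine wp_seq.2 <| (wp_clearLevels hin).withFrame.mono ?_
  rintro t₁ s₁ ⟨⟨ht₁, hlev⟩, hf₁⟩
  simp only [wp_seq, wp_set]
  set s₂ := (s₁.setReg rHead 0).setReg rTail 0
  have hin₂ : HoldsInput M nbr Λ s₂ :=
    ((hin.frame hf₁ rfl).frame (Frame.setReg (c := .set rHead 0) rfl _ _) rfl).frame
      (Frame.setReg (c := .set rTail 0) rfl _ _) rfl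
  refine (Wp.forLt_acc (fun k t s' => ∃ l, t ≤ k * 17 + l.length * (12 * A + 12) ∧
    Searched H Λ a k l s') rfl hin₂.size hin₂.one ⟨[], by simp, ?_⟩ ?_).mono ?_
  · refine Searched.setReg ⟨List.nodup_nil, by simp, ⟨rfl, by simp, ?_, by simp, by simp⟩, rfl,
      by simp⟩ (by decide) 0
    exact fun v _ => hlev v
  · rintro k hk t s' hf hroot ⟨l, ht, hs'⟩
    have hcut' : HoldsCut nbr H.Adj s' := by
      rw [HoldsCut, hf.mem aCut rfl]
      exact (hf₁.mem aCut rfl).symm ▸ hcut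
    have hround : s'.reg rRound = s.reg rRound := (hf.reg rRound rfl).trans (hf₁.reg rRound rfl)
    refine (Searched.wp_bfsRoot (r := ⟨k, hk⟩) hs' (hin₂.frame hf rfl) hcut' hΛ hnbr hA hroot
      (hround ▸ ha _)).mono ?_
    rintro t' s'' ⟨m, ht', hs''⟩
    refine ⟨l ++ m, ?_, hs''.setReg (by decide) _⟩
    rw [List.length_append, add_mul l.length, add_mul k]
    omega
  · rintro t s' ⟨t₁, rfl, l, ht, hs'⟩
    have hl := hs'.nodup.length_le_card.trans_eq (Fintype.card_fin n)
    have := Nat.mul_le_mul_right (12 * A + 12) hl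
    exact ⟨by linarith, l, hs'⟩

end SearchAll

/-! ### The decomposition step -/

theorem mk_mem_bfsCut_iff {V : Type} {H : SimpleGraph V} {Λ : ℕ} {root : H.ConnectedComponent → V}
    {L : V → Fin Λ} {v u : V} (h : H.Adj v u) :
    s(v, u) ∈ bfsCut H root L ↔
      ∃ k, min (H.dist (root (H.connectedComponentMk v)) v)
        (H.dist (root (H.connectedComponentMk v)) u) =
          k * Λ + L (root (H.connectedComponentMk v)) := by
  simp only [bfsCut, Set.mem_ofPred_eq, SimpleGraph.mem_edgeSet, h, true_and, Sym2.mem_iff,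
    forall_eq_or_imp, forall_eq, SimpleGraph.ConnectedComponent.mem_supp_iff]
  constructor
  · rintro ⟨_, ⟨rfl, -⟩, hlevel⟩
    exact hlevel
  · exact fun hlevel => ⟨_, ⟨rfl, SimpleGraph.ConnectedComponent.eq.2 h.symm.reachable⟩, hlevel⟩

section RoundGraph

variable {n Λ : ℕ} {G H : SimpleGraph (Fin n)}

/-- The graph on which round `i` of `Minor-e` works when the roots are the least vertices of the
components and `L i` is drawn in round `i`. -/
noncomputable def roundGraph (G : SimpleGraph (Fin n)) (L : ℕ → Fin n → Fin Λ) :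
    ℕ → SimpleGraph (Fin n)
  | 0 => G
  | i + 1 => (roundGraph G L i).deleteEdges
      (bfsCut (roundGraph G L i) ((leastRule (Fin n)).pick i (roundGraph G L i)) (L i))

theorem roundGraph_le (G : SimpleGraph (Fin n)) (L : ℕ → Fin n → Fin Λ) (i : ℕ) :
    roundGraph G L i ≤ G := by
  induction i with
  | zero => exact le_rfl
  | succ i ih => exact (SimpleGraph.deleteEdges_le _).trans ih

theorem deleteEdges_minorE (G : SimpleGraph (Fin n)) (L : ℕ → Fin n → Fin Λ) (r : ℕ) :
    G.deleteEdges (minorE G (leastRule (Fin n)) r fun i => L i) = roundGraph G L r := by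
  induction r with
  | zero => exact SimpleGraph.deleteEdges_empty
  | succ r ih =>
    have hinit : Fin.init (fun i : Fin (r + 1) => L i) = fun i : Fin r => L i := rfl
    rw [minorE, hinit, ← SimpleGraph.deleteEdges_deleteEdges, ih]
    rfl

theorem mk_mem_bfsCut_leastRule_iff {i : ℕ} {L : Fin n → Fin Λ} {v u : Fin n} (h : H.Adj v u) :
    s(v, u) ∈ bfsCut H ((leastRule (Fin n)).pick i H) L ↔
      ∃ k, min (treeLevel H v) (treeLevel H u) = k * Λ + L (leastReachable H v) := by
  have hroot : leastReachable H u = leastReachable H v := leastReachable_eq_iff.2 h.symm.reachable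
  rw [mk_mem_bfsCut_iff h, leastRule_pick, treeLevel, treeLevel, hroot]

theorem mk_mem_bfsCut_iff_treePhase {i : ℕ} {L : Fin n → Fin Λ} {v u : Fin n} (h : H.Adj v u) :
    s(v, u) ∈ bfsCut H ((leastRule (Fin n)).pick i H) L ↔
      (if treeLevel H v < treeLevel H u then treePhase H Λ (fun x => L x) v
        else treePhase H Λ (fun x => L x) u) = 0 := by
  have hroot : leastReachable H u = leastReachable H v := leastReachable_eq_iff.2 h.symm.reachable
  rw [mk_mem_bfsCut_leastRule_iff h]
  split_ifs with hlt
  · rw [min_eq_left hlt.le, treePhase, phase_eq_zero_iff (L _).2]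
  · rw [min_eq_right (not_lt.1 hlt), treePhase, hroot, phase_eq_zero_iff (L _).2]

theorem roundGraph_eq_bot (G : SimpleGraph (Fin n)) (L : ℕ → Fin n → Fin 1) {r : ℕ} (hr : 0 < r) :
    roundGraph G L r = ⊥ := by
  obtain ⟨r, rfl⟩ := Nat.exists_eq_succ_of_ne_zero hr.ne'
  rw [Nat.succ_eq_add_one, roundGraph, eq_bot_iff]
  intro v u hvu
  rw [SimpleGraph.deleteEdges_adj] at hvu
  exact hvu.2 <| (mk_mem_bfsCut_leastRule_iff hvu.1).2
    ⟨_, by rw [Fin.val_eq_zero, mul_one, add_zero]⟩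

end RoundGraph

/-- Load the phase of the endpoint of the edge from `rV` to `rU` that is nearer to the root. -/
def loadPhase : Cmd :=
  .load rLev aLev [rV] ;; .load rLevU aLev [rU] ;;
    .ifLt rLev rLevU (.load rFlag aPhase [rV]) (.load rFlag aPhase [rU])

def cutNbr : Cmd := loadPhase ;; .ifLt rFlag rOne (.store aCut [rV, rU] rOne) .skip

def cutAll : Cmd := .forLt rV rN (.forNbrs cutNbr)

def rounds : Cmd := .forLt rRound rRounds (bfsAll ;; cutAll)

section Rounds

variable {ω : ℕ → ℕ → ℕ} {n q Λ A : ℕ} {M : MRF (Fin n) (Fin q)} {nbr : Fin n → List (Fin n)}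
  {H : SimpleGraph (Fin n)} {B : Set (Sym2 (Fin n))} {s : MState} {a : Fin n → ℕ} {v u : Fin n}

/-- The levels and phases of all vertices are stored, and `B` is the set of edges that they put
out. -/
structure HoldsLevels (H : SimpleGraph (Fin n)) (Λ : ℕ) (a : Fin n → ℕ) (B : Set (Sym2 (Fin n)))
    (s : MState) : Prop where
  level : ∀ v : Fin n, s.mem aLev [(v : ℕ)] = treeLevel H v + 1
  phase : ∀ v : Fin n, s.mem aPhase [(v : ℕ)] = treePhase H Λ a v
  mem_iff : ∀ v u, H.Adj v u → (s(v, u) ∈ B ↔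
    (if treeLevel H v < treeLevel H u then treePhase H Λ a v else treePhase H Λ a u) = 0)

theorem HoldsLevels.congr (h : HoldsLevels H Λ a B s) {s' : MState}
    (hlev : s'.mem aLev = s.mem aLev) (hph : s'.mem aPhase = s.mem aPhase) :
    HoldsLevels H Λ a B s' :=
  ⟨hlev ▸ h.level, hph ▸ h.phase, h.mem_iff⟩

/-- The edges of `B` have been cut from `H` at the pairs in `P`. -/
def HoldsPartialCut (nbr : Fin n → List (Fin n)) (H : SimpleGraph (Fin n))
    (B : Set (Sym2 (Fin n))) (P : Fin n → Fin n → Prop) (s : MState) : Prop :=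
  HoldsCut nbr (fun w x => H.Adj w x ∧ (P w x → s(w, x) ∉ B)) s

theorem HoldsLevels.wp_loadPhase (h : HoldsLevels H Λ a B s) (hv : s.reg rV = v) (hu : s.reg rU = u)
    (hvu : H.Adj v u) :
    Wp ω loadPhase s fun t s' => t = 4 ∧ (s'.reg rFlag = 0 ↔ s(v, u) ∈ B) := by
  simp only [loadPhase, wp_seq, wp_load, wp_ifLt, List.map_cons, List.map_nil, hv,
    h.mem_iff v u hvu]
  simp only [Nat.reduceEqDiff, MState.reg_setReg, MState.mem_setReg, if_true, if_false, hu, hv,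
    h.level, h.phase, add_lt_add_iff_right]
  split_ifs <;> simp

theorem HoldsPartialCut.congr {P P' : Fin n → Fin n → Prop} (h : HoldsPartialCut nbr H B P s)
    (hP : ∀ w x, P' w x ↔ P w x ∨ w = v ∧ x = u) {s' : MState}
    (hmem : ∀ w x : Fin n, ¬ (w = v ∧ x = u) →
      s'.mem aCut [(w : ℕ), (x : ℕ)] = s.mem aCut [(w : ℕ), (x : ℕ)])
    (hvu : s'.mem aCut [(v : ℕ), (u : ℕ)] = 0 ↔ H.Adj v u ∧ s(v, u) ∉ B) :
    HoldsPartialCut nbr H B P' s' := by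
  intro w x hx
  by_cases hwx : w = v ∧ x = u
  · obtain ⟨rfl, rfl⟩ := hwx
    simp [hvu, hP]
  · rw [hmem w x hwx, h w x hx]
    simp only [hP, or_iff_left hwx]

theorem HoldsPartialCut.wp_cutNbr {P P' : Fin n → Fin n → Prop} (h : HoldsPartialCut nbr H B P s)
    (hP : ∀ w x, P' w x ↔ P w x ∨ w = v ∧ x = u) (hlev : HoldsLevels H Λ a B s)
    (hone : s.reg rOne = 1) (hv : s.reg rV = v) (hu : s.reg rU = u) (hvu : H.Adj v u)
    (hmark : s.mem aCut [(v : ℕ), (u : ℕ)] = 0) :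
    Wp ω cutNbr s fun t s' => t ≤ 6 ∧ HoldsPartialCut nbr H B P' s' := by
  refine wp_seq.2 <| (hlev.wp_loadPhase hv hu hvu).withFrame.mono ?_
  rintro _ s₁ ⟨⟨rfl, hflag⟩, hf⟩
  have hmem := hf.mem aCut rfl
  rw [wp_ifLt, hf.reg rOne rfl, hone]
  simp only [wp_store, wp_skip, List.map_cons, List.map_nil, hf.reg rV rfl, hf.reg rU rfl,
    hf.reg rOne rfl, hone, hv, hu]
  split_ifs with hlt
  · have hB := hflag.1 (Nat.lt_one_iff.1 hlt)
    refine ⟨le_rfl, h.congr hP (fun w x hwx => ?_) (by simp [hB])⟩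
    simp [hmem, Fin.val_inj, hwx]
  · have hB := mt (fun h => Nat.lt_one_iff.2 (hflag.2 h)) hlt
    exact ⟨le_rfl, h.congr hP (fun w x _ => by rw [hmem]) (by simp [hmem, hmark, hB, hvu])⟩

theorem HoldsPartialCut.wp_forNbrs_cutNbr (hcut : HoldsPartialCut nbr H B (fun w _ => w < v) s)
    (hin : HoldsInput M nbr Λ s) (hlev : HoldsLevels H Λ a B s) (hv : s.reg rV = v) :
    Wp ω (.forNbrs cutNbr) s fun t s' => t ≤ (nbr v).length * 12 + 3 ∧
      HoldsPartialCut nbr H B (fun w _ => w ≤ v) s' := by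
  have hP : ∀ (p : List (Fin n)) (u w x : Fin n), (w < v ∨ w = v ∧ x ∈ p ++ [u]) ↔
      (w < v ∨ w = v ∧ x ∈ p) ∨ w = v ∧ x = u := by
    intro p u w x
    rw [List.mem_append, List.mem_singleton, and_or_left, or_assoc]
  refine (Wp.forNbrs 6 (fun p => HoldsPartialCut nbr H B fun w x => w < v ∨ w = v ∧ x ∈ p) rfl hin
    hv (fun _ _ _ _ _ h => h) (by simpa using hcut) ?_).mono ?_
  · intro p u s' hpre hf hu _ hI
    have hmem : u ∈ nbr v := hpre.subset (by simp)
    refine ⟨fun hne => hI.congr (hP p u) (fun _ _ _ => rfl) ?_, fun h0 => ?_⟩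
    · refine iff_of_false hne fun hadj => hne ?_
      exact (hI v u hmem).2 ⟨hadj.1, fun _ => hadj.2⟩
    · exact hI.wp_cutNbr (hP p u) (hlev.congr (hf.mem aLev rfl) (hf.mem aPhase rfl))
        (hin.frame hf rfl).one ((hf.reg rV rfl).trans hv) hu ((hI v u hmem).1 h0).1 h0
  · rintro t s' ⟨ht, hs'⟩
    refine ⟨ht, fun w x hx => (hs' w x hx).trans (and_congr_right' (imp_congr_left ?_))⟩
    exact (or_congr_right (and_iff_left_of_imp fun hw => hw ▸ hx)).trans le_iff_lt_or_eq.symm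

theorem wp_cutAll (hcut : HoldsCut nbr H.Adj s) (hin : HoldsInput M nbr Λ s)
    (hlev : HoldsLevels H Λ a B s) (hA : ∀ v, (nbr v).length ≤ A) :
    Wp ω cutAll s fun t s' => t ≤ n * (12 * A + 5) + 2 ∧
      HoldsCut nbr (H.deleteEdges B).Adj s' := by
  refine (Wp.forLt (12 * A + 3) (fun k => HoldsPartialCut nbr H B fun w _ => (w : ℕ) < k) rfl
    hin.size hin.one (fun v u hu => (hcut v u hu).trans (by simp)) ?_).mono ?_
  · intro k hk s' hf hv hI
    refine (HoldsPartialCut.wp_forNbrs_cutNbr (v := ⟨k, hk⟩) hI (hin.frame hf rfl)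
      (hlev.congr (hf.mem aLev rfl) (hf.mem aPhase rfl)) hv).mono ?_
    rintro t s'' ⟨ht, hs''⟩
    have := hA ⟨k, hk⟩
    exact ⟨by omega, fun v u hu => (hs'' v u hu).trans (by simp [Fin.le_def])⟩
  · rintro t s' ⟨ht, hs'⟩
    exact ⟨ht, fun v u hu => (hs' v u hu).trans (by simp [SimpleGraph.deleteEdges_adj])⟩

theorem wp_rounds {G : SimpleGraph (Fin n)} {L : ℕ → Fin n → Fin Λ} {r : ℕ}
    (hin : HoldsInput M nbr Λ s) (hr : s.reg rRounds = r) (hcut : HoldsCut nbr G.Adj s)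
    (hΛ : 0 < Λ) (hnbr : ∀ v u, G.Adj v u → u ∈ nbr v) (hA : ∀ v, (nbr v).length ≤ A)
    (hL : ∀ i < r, ∀ v : Fin n, ω i v = L i v) :
    Wp ω rounds s fun t s' => t ≤ r * (n * (24 * A + 37) + 10) + 2 ∧ s'.reg rRound = r ∧
      HoldsCut nbr (roundGraph G L r).Adj s' := by
  refine (Wp.forLt (n * (24 * A + 37) + 8) (fun i s' => s'.reg rRound = i ∧
    HoldsCut nbr (roundGraph G L i).Adj s') rfl hr hin.one ⟨by simp, hcut⟩ ?_).mono
      fun t s' h => h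
  rintro i hi s' hf hround ⟨-, hcut'⟩
  have hin' := hin.frame hf rfl
  have hbfs := wp_bfsAll (ω := ω) (a := fun v => L i v) hin' hcut' hΛ
    (fun v u h => hnbr v u (roundGraph_le G L i h)) hA (by rw [hround]; exact hL i hi)
  refine wp_seq.2 <| hbfs.withFrame.mono ?_
  rintro t₁ s₁ ⟨⟨ht₁, l, hs₁⟩, hf₁⟩
  have hl : ∀ v, v ∈ l := fun v => (hs₁.mem_iff v).2 (Fin.is_lt _)
  have hlev : HoldsLevels (roundGraph G L i) Λ (fun v => L i v) (bfsCut (roundGraph G L i)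
      ((leastRule (Fin n)).pick i (roundGraph G L i)) (L i)) s₁ :=
    ⟨fun v => hs₁.visited.level v (hl v), fun v => hs₁.visited.phase v (hl v),
      fun _ _ h => mk_mem_bfsCut_iff_treePhase h⟩
  have hcut₁ : HoldsCut nbr (roundGraph G L i).Adj s₁ := by
    rw [HoldsCut, hf₁.mem aCut rfl]
    exact hcut'
  refine (wp_cutAll hcut₁ (hin'.frame hf₁ rfl) hlev hA).mono ?_
  rintro t₂ s₂ ⟨ht₂, hs₂⟩
  exact ⟨by linarith, by simp, hs₂⟩

end Rounds

/-! ### Energies of components and enumeration of assignments -/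

section VertexEnergy

variable {V S : Type} [Fintype V] [LinearOrder V] {M : MRF V S} {H : SimpleGraph V} {x y : V → S}

open Classical in
/-- The share of the vertex `v` in the energy of the field restricted to the edges of `H`. An edge
is counted at its smaller endpoint, so that the program meets it once. -/
noncomputable def MRF.vertexEnergy (M : MRF V S) (H : SimpleGraph V) (x : V → S) (v : V) : ℝ :=
  M.φ v (x v) + ∑ u with H.Adj v u ∧ v < u, M.ψ v u (x v) (x u)

theorem MRF.vertexEnergy_nonneg (v : V) : 0 ≤ M.vertexEnergy H x v :=
  add_nonneg (M.φ_nonneg _ _) (Finset.sum_nonneg fun _ _ => M.ψ_nonneg _ _ _ _)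

theorem MRF.vertexEnergy_congr {v : V} (hv : x v = y v) (h : ∀ u, H.Adj v u → x u = y u) :
    M.vertexEnergy H x v = M.vertexEnergy H y v := by
  classical
  rw [MRF.vertexEnergy, MRF.vertexEnergy, hv]
  refine congrArg _ (Finset.sum_congr rfl fun u hu => ?_)
  rw [h u (Finset.mem_filter.1 hu).2.1]

open Classical in
/-- The energy of the component of `H` whose least vertex is `r`. -/
noncomputable def MRF.rootEnergy (M : MRF V S) (H : SimpleGraph V) (r : V) (x : V → S) : ℝ :=
  ∑ v with leastReachable H v = r, M.vertexEnergy H x v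

theorem MRF.rootEnergy_congr {r : V} (h : ∀ v, leastReachable H v = r → x v = y v) :
    M.rootEnergy H r x = M.rootEnergy H r y := by
  refine Finset.sum_congr rfl fun v hv => ?_
  have hv' := (Finset.mem_filter.1 hv).2
  refine MRF.vertexEnergy_congr (h v hv') fun u hvu => h u ?_
  rw [← hv', leastReachable_eq_iff]
  exact hvu.symm.reachable

theorem MRF.rootEnergy_eq_sum_map {r : V} {m : List V} (hm : m.Nodup)
    (h : ∀ v, v ∈ m ↔ leastReachable H v = r) :
    M.rootEnergy H r x = (m.map (M.vertexEnergy H x)).sum := by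
  classical
  rw [MRF.rootEnergy, ← List.sum_toFinset _ hm]
  exact Finset.sum_congr (by ext v; simp [h]) fun _ _ => rfl

open Classical in
theorem MRF.sum_edgeTerm_eq (C : Set V) (hC : ∀ v ∈ C, ∀ u, H.Adj v u → u ∈ C) :
    ∑ e with e ∈ H.edgeSet ∧ ∀ v ∈ e, v ∈ C, M.edgeTerm x e =
      ∑ v with v ∈ C, ∑ u with H.Adj v u ∧ v < u, M.ψ v u (x v) (x u) := by
  rw [Finset.sum_sigma']
  symm
  refine Finset.sum_nbij (fun p : (_ : V) × V => s(p.1, p.2)) ?_ ?_ ?_ fun _ _ => rfl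
  · rintro ⟨v, u⟩ h
    simp only [Finset.mem_sigma, Finset.mem_filter_univ, SimpleGraph.mem_edgeSet, Sym2.mem_iff,
      forall_eq_or_imp, forall_eq] at h ⊢
    exact ⟨h.2.1, h.1, hC v h.1 u h.2.1⟩
  · rintro ⟨v, u⟩ h ⟨v', u'⟩ h' heq
    simp only [Finset.coe_sigma, Set.mem_sigma_iff, Finset.mem_coe, Finset.mem_filter_univ] at h h'
    obtain ⟨rfl, rfl⟩ | ⟨rfl, rfl⟩ := Sym2.eq_iff.1 heq
    · rfl
    · exact absurd h.2.2 h'.2.2.not_gt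
  · intro e he
    induction e with
    | _ v u =>
      simp only [Finset.coe_filter, Finset.mem_univ, true_and, Set.mem_ofPred_eq,
        SimpleGraph.mem_edgeSet, Sym2.mem_iff, forall_eq_or_imp, forall_eq] at he
      obtain ⟨hvu, hv, hu⟩ := he
      obtain hlt | hlt := hvu.ne.lt_or_gt
      · exact ⟨⟨v, u⟩, by simp [hv, hvu, hlt], rfl⟩
      · exact ⟨⟨u, v⟩, by simp [hu, hvu.symm, hlt], Sym2.eq_swap⟩

theorem MRF.componentEnergy_connectedComponentMk (M : MRF V S) (B : Set (Sym2 V)) (v : V)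
    (x : V → S) :
    M.componentEnergy B ((M.graph.deleteEdges B).connectedComponentMk v) x =
      M.rootEnergy (M.graph.deleteEdges B) (leastReachable (M.graph.deleteEdges B) v) x := by
  classical
  set H := M.graph.deleteEdges B
  set C := (H.connectedComponentMk v).supp
  have hC : ∀ u, u ∈ C ↔ leastReachable H u = leastReachable H v := fun u => by
    rw [SimpleGraph.ConnectedComponent.mem_supp_iff, SimpleGraph.ConnectedComponent.eq,
      leastReachable_eq_iff]
  have hedges := MRF.sum_edgeTerm_eq (M := M) (x := x) C fun u hu w huw => by
    rw [hC] at hu ⊢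
    rw [← hu, leastReachable_eq_iff]
    exact huw.symm.reachable
  rw [MRF.componentEnergy, MRF.rootEnergy]
  simp only [MRF.vertexEnergy, Finset.sum_add_distrib]
  convert congrArg (∑ v with v ∈ C, M.φ v (x v) + ·) hedges <;> exact (hC _).symm

theorem MRF.isModeOutput_of_rootEnergy_le {B : Set (Sym2 V)}
    (h : ∀ r y, M.rootEnergy (M.graph.deleteEdges B) r y ≤
      M.rootEnergy (M.graph.deleteEdges B) r x) : M.IsModeOutput B x := by
  intro c y
  induction c using SimpleGraph.ConnectedComponent.ind with
  | _ v =>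
    rw [MRF.componentEnergy_connectedComponentMk, MRF.componentEnergy_connectedComponentMk]
    exact h _ _

end VertexEnergy

section Label

variable {V : Type*} [DecidableEq V] {q k : ℕ} {m : List V} {v : V}

/-- The label of `v` in the `k`-th assignment to the vertices of `m`, the digits of `k` in base `q`
being read as labels. The value is `0` outside `m`. -/
def labelAt (m : List V) (q k : ℕ) (v : V) : ℕ :=
  if v ∈ m then k / q ^ m.idxOf v % q else 0

/-- The carry into position `j` when `1` is added to `k` in base `q`. -/
def carry (q k j : ℕ) : ℕ :=
  if q ^ j ∣ k + 1 then 1 else 0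

theorem carry_lt_one_iff (j : ℕ) : carry q k j < 1 ↔ ¬ q ^ j ∣ k + 1 := by
  rw [carry]
  split_ifs with h <;> simp [h]

theorem labelAt_lt (hq : 0 < q) : labelAt m q k v < q := by
  rw [labelAt]
  split_ifs
  exacts [Nat.mod_lt _ hq, hq]

/-- The `k`-th assignment to the vertices of `m`. -/
def labeling (m : List V) (hq : 0 < q) (k : ℕ) (v : V) : Fin q :=
  ⟨labelAt m q k v, labelAt_lt hq⟩

theorem labelAt_zero : labelAt m q 0 v = 0 := by
  simp [labelAt]

theorem labelAt_pow_length : labelAt m q (q ^ m.length) v = 0 := by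
  rw [labelAt]
  split_ifs with hv
  · obtain rfl | hq := q.eq_zero_or_pos
    · simp [zero_pow (List.length_pos_of_mem hv).ne']
    · have hlt := List.idxOf_lt_length_iff.2 hv
      rw [Nat.pow_div hlt.le hq, ← Nat.dvd_iff_mod_eq_zero]
      exact dvd_pow_self q (Nat.sub_ne_zero_of_lt hlt)
  · rfl

theorem exists_labeling_eq (m : List V) (hq : 0 < q) (x : V → Fin q) :
    ∃ k < q ^ m.length, ∀ v ∈ m, labeling m hq k v = x v := by
  let f : Fin m.length → Fin q := fun j => x m[j]
  refine ⟨finFunctionFinEquiv f, Fin.is_lt _, fun v hv => Fin.ext ?_⟩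
  have hj := List.idxOf_lt_length_iff.2 hv
  have hf := congrArg Fin.val (congrFun (finFunctionFinEquiv.symm_apply_apply f) ⟨m.idxOf v, hj⟩)
  exact (if_pos hv).trans (hf.trans (by simp [f]))

theorem carry_le_one (j : ℕ) : carry q k j ≤ 1 := by
  rw [carry]
  split_ifs <;> simp

theorem labelAt_succ (hq : 0 < q) (hv : v ∈ m) :
    labelAt m q (k + 1) v = if labelAt m q k v + carry q k (m.idxOf v) < q then
      labelAt m q k v + carry q k (m.idxOf v) else 0 := by
  have hle := carry_le_one (q := q) (k := k) (m.idxOf v)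
  have hlt := Nat.mod_lt (k / q ^ m.idxOf v) hq
  rw [labelAt, labelAt, if_pos hv, if_pos hv, Nat.succ_div, ← carry, ← Nat.mod_add_mod]
  split_ifs with h
  · exact Nat.mod_eq_of_lt h
  · rw [show k / q ^ m.idxOf v % q + carry q k (m.idxOf v) = q by omega, Nat.mod_self]

theorem carry_succ (hq : 0 < q) (hv : v ∈ m) :
    carry q k (m.idxOf v + 1) = if labelAt m q k v + carry q k (m.idxOf v) < q then 0 else
      carry q k (m.idxOf v) := by
  have hlt := labelAt_lt (m := m) (k := k) (v := v) hq
  have hlabel := labelAt_succ (k := k) hq hv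
  by_cases hdvd : q ^ m.idxOf v ∣ k + 1
  · have hcarry : carry q k (m.idxOf v) = 1 := if_pos hdvd
    have hiff : q ^ (m.idxOf v + 1) ∣ k + 1 ↔ labelAt m q (k + 1) v = 0 := by
      rw [labelAt, if_pos hv, ← Nat.dvd_iff_mod_eq_zero, Nat.dvd_div_iff_mul_dvd hdvd, pow_succ]
    have hsucc : carry q k (m.idxOf v + 1) = if labelAt m q (k + 1) v = 0 then 1 else 0 :=
      if_congr hiff rfl rfl
    rw [hsucc, hlabel, hcarry]
    split_ifs <;> simp_all
  · have hcarry : carry q k (m.idxOf v) = 0 := if_neg hdvd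
    rw [hcarry, add_zero, if_pos hlt, carry, if_neg]
    exact fun h => hdvd ((pow_dvd_pow q (Nat.le_succ _)).trans h)

end Label

/-! ### Exact optimisation on the components -/

/-- Add the share of the edge from `rV` to `rU` to the current energy. -/
def energyNbr : Cmd :=
  .ifLt rV rU (.load rLabU aLab [rU] ;; .rload fTmp faPsi [rV, rIdx, rLab, rLabU] ;;
    .radd fCur fCur fTmp) .skip

/-- Add the share of the vertex `rV` to the current energy. -/
def energyVertex : Cmd :=
  .load rLab aLab [rV] ;; .rload fTmp faPhi [rV, rLab] ;; .radd fCur fCur fTmp ;; .forNbrs energyNbr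

def outputVertex : Cmd := .load rLab aLab [rV] ;; .store aOut [rV] rLab

/-- Output the current labels if they have a larger energy than the best ones so far. -/
def tryLabeling : Cmd :=
  .radd fCur fZero fZero ;; .forSegment energyVertex ;;
    .ifRLt fBest fCur (.radd fBest fCur fZero ;; .forSegment outputVertex) .skip

/-- Add the carry to the label of `rV`. -/
def incrVertex : Cmd :=
  .load rLab aLab [rV] ;; .add rLab rLab rCarry ;;
    .ifLt rLab rAlph (.set rCarry 0) (.set rLab 0) ;; .store aLab [rV] rLab

/-- Try all labellings of a segment of the queue. The loop ends with a carry out of the last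
position. -/
def mapSegment : Cmd :=
  .radd fBest fZero fZero ;; .set rCarry 0 ;;
    .whileLt rCarry rOne (tryLabeling ;; .set rCarry 1 ;; .forSegment incrVertex)

def mapRoot : Cmd := .load rStart aStart [rRoot] ;; .load rEnd aEnd [rRoot] ;; mapSegment

def mapAll : Cmd := .forLt rRoot rN mapRoot

section Map

variable {ω : ℕ → ℕ → ℕ} {n q Λ A : ℕ} {M : MRF (Fin n) (Fin q)} {nbr : Fin n → List (Fin n)}
  {H : SimpleGraph (Fin n)} {s : MState} {r v : Fin n} {m : List (Fin n)} {x y : Fin n → Fin q}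

def HoldsLabels (y : Fin n → Fin q) (s : MState) : Prop :=
  ∀ v : Fin n, s.mem aLab [(v : ℕ)] = y v

theorem HoldsLabels.wp_energyNbr {u : Fin n} {k : ℕ} (h : HoldsLabels y s)
    (hin : HoldsInput M nbr Λ s) (hk : k < (nbr v).length) (hu : (nbr v)[k] = u)
    (hv : s.reg rV = v) (hs : s.reg rU = u) (hidx : s.reg rIdx = k) (hlab : s.reg rLab = y v) :
    Wp ω energyNbr s fun t s' => t ≤ 4 ∧
      s'.rreg fCur = s.rreg fCur + if v < u then M.ψ v u (y v) (y u) else 0 := by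
  subst hu
  have hψ := hin.psi v k hk (y v) (y (nbr v)[k])
  simp only [energyNbr, wp_ifLt, hv, hs, Fin.val_fin_lt]
  split_ifs with hlt
  · simp [wp_seq, wp_load, wp_rload, wp_radd, hv, hs, hidx, hlab, h _, hψ]
  · simp [wp_skip]

theorem sum_map_ite_eq_sum {p : List (Fin n)} (hp : p.Nodup) {R : Fin n → Prop} [DecidablePred R]
    (hR : ∀ u, R u → u ∈ p) (f : Fin n → ℝ) :
    (p.map fun u => if R u then f u else 0).sum = ∑ u with R u, f u := by
  rw [← List.sum_toFinset _ hp, ← Finset.sum_filter]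
  refine Finset.sum_congr (Finset.ext fun u => ?_) fun _ _ => rfl
  simpa using hR u

theorem HoldsLabels.wp_energyVertex (h : HoldsLabels y s) (hin : HoldsInput M nbr Λ s)
    (hcut : HoldsCut nbr H.Adj s) (hnodup : (nbr v).Nodup) (hnbr : ∀ u, H.Adj v u → u ∈ nbr v)
    (hv : s.reg rV = v) :
    Wp ω energyVertex s fun t s' => t ≤ (nbr v).length * 10 + 6 ∧
      s'.rreg fCur = s.rreg fCur + M.vertexEnergy H y v := by
  classical
  simp only [energyVertex, wp_seq, wp_load, wp_rload, wp_radd, List.map_cons, List.map_nil]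
  set s₁ := ((s.setReg rLab _).setRReg fTmp _).setRReg fCur _ with hs₁
  have hf₁ : Frame energyVertex s s₁ :=
    ((Frame.setReg rfl _ _).trans (Frame.setRReg rfl _ _)).trans (Frame.setRReg rfl _ _)
  have hin₁ := hin.frame hf₁ rfl
  have hcur : s₁.rreg fCur = s.rreg fCur + M.φ v (y v) := by simp [hs₁, hv, h v, hin.phi]
  have hlab : s₁.reg rLab = y v := by simp [hs₁, hv, h v]
  refine (Wp.forNbrs 4 (fun p s' => s'.rreg fCur = s.rreg fCur + M.φ v (y v) +
    (p.map fun u => if H.Adj v u ∧ v < u then M.ψ v u (y v) (y u) else 0).sum) rfl hin₁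
    ((hf₁.reg rV rfl).trans hv) (fun _ _ _ _ _ h => h) (by simpa using hcur) ?_).mono ?_
  · intro p u s' hpre hf hu hidx hI
    have hmem : u ∈ nbr v := hpre.subset (by simp)
    have hiff : s'.mem aCut [(v : ℕ), (u : ℕ)] = 0 ↔ H.Adj v u := by
      rw [hf.mem aCut rfl, hf₁.mem aCut rfl]
      exact hcut v u hmem
    refine ⟨fun hne => by simp [hI, mt hiff.2 hne], fun h0 => ?_⟩
    have hlen : p.length < (nbr v).length := by simpa using hpre.length_le
    have hget : (nbr v)[p.length] = u := by rw [← hpre.getElem (by simp)]; simp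
    have hlabels : HoldsLabels y s' := by
      rw [HoldsLabels, hf.mem aLab rfl, hf₁.mem aLab rfl]
      exact h
    refine (hlabels.wp_energyNbr (hin₁.frame hf rfl) hlen hget
      ((hf.reg rV rfl).trans ((hf₁.reg rV rfl).trans hv)) hu hidx
      ((hf.reg rLab rfl).trans hlab)).mono fun t s'' ⟨ht, hs''⟩ => ⟨ht, ?_⟩
    simp [hs'', hI, hiff.1 h0, add_assoc]
  · rintro t s' ⟨ht, hs'⟩
    refine ⟨by omega, ?_⟩
    rw [hs', sum_map_ite_eq_sum hnodup (fun u hu => hnbr u hu.1), MRF.vertexEnergy, add_assoc]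

/-- `m` lists the component of `H` with least vertex `r`, and is the segment of the queue at which
the program works. -/
structure AtComponent (M : MRF (Fin n) (Fin q)) (nbr : Fin n → List (Fin n)) (Λ : ℕ)
    (H : SimpleGraph (Fin n)) (r : Fin n) (m : List (Fin n)) (s : MState) : Prop where
  input : HoldsInput M nbr Λ s
  cut : HoldsCut nbr H.Adj s
  segment : AtSegment m s
  nodup : m.Nodup
  mem_iff : ∀ v, v ∈ m ↔ leastReachable H v = r

/-- `c` writes nothing that `AtComponent` is about. -/
def Cmd.keepsComponent (c : Cmd) : Bool :=
  c.keepsInput && !c.wrMem aCut && (!c.wrReg rStart && !c.wrReg rEnd && !c.wrMem aQueue)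

theorem AtComponent.frame {c : Cmd} {s' : MState} (h : AtComponent M nbr Λ H r m s)
    (hf : Frame c s s') (hc : c.keepsComponent = true) : AtComponent M nbr Λ H r m s' := by
  simp only [Cmd.keepsComponent, Bool.and_eq_true, Bool.not_eq_true'] at hc
  obtain ⟨⟨hin, hcut⟩, ⟨hs, he⟩, hq⟩ := hc
  exact ⟨h.input.frame hf hin, fun v u hu => (hf.mem _ hcut) ▸ h.cut v u hu,
    h.segment.frame hf ⟨hs, he, hq⟩, h.nodup, h.mem_iff⟩

theorem AtComponent.wp_forSegment_energyVertex (h : AtComponent M nbr Λ H r m s)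
    (hy : HoldsLabels y s) (hnodup : ∀ v, (nbr v).Nodup) (hnbr : ∀ v u, H.Adj v u → u ∈ nbr v)
    (hA : ∀ v, (nbr v).length ≤ A) (hcur : s.rreg fCur = 0) :
    Wp ω (.forSegment energyVertex) s fun t s' => t ≤ m.length * (10 * A + 9) + 2 ∧
      s'.rreg fCur = M.rootEnergy H r y := by
  refine (Wp.forSegment (10 * A + 6)
    (fun p s' => s'.rreg fCur = (p.map (M.vertexEnergy H y)).sum) rfl h.segment h.input.one
    h.input.zero (fun _ _ _ _ _ h => h) (by simpa using hcur) ?_).mono ?_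
  · intro p v s' _ hf hv hI
    have h' := h.frame hf rfl
    have hy' : HoldsLabels y s' := fun v => (congrFun (hf.mem aLab rfl) _).trans (hy v)
    refine (hy'.wp_energyVertex h'.input h'.cut (hnodup v) (hnbr v) hv).mono ?_
    rintro t s'' ⟨ht, hs''⟩
    have := hA v
    exact ⟨by omega, by simp [hs'', hI]⟩
  · rintro t s' ⟨ht, hs'⟩
    exact ⟨ht, hs'.trans (M.rootEnergy_eq_sum_map h.nodup h.mem_iff).symm⟩

theorem AtSegment.wp_forSegment_outputVertex (h : AtSegment m s) (hone : s.reg rOne = 1)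
    (hzero : s.reg rZero = 0) (hx : Outputs s x) (hy : HoldsLabels y s) :
    Wp ω (.forSegment outputVertex) s fun t s' => t ≤ m.length * 5 + 2 ∧
      Outputs s' fun v => if v ∈ m then y v else x v := by
  refine Wp.forSegment 2 (fun p s' => Outputs s' fun v => if v ∈ p then y v else x v) rfl h hone
    hzero (fun _ _ _ _ _ h => h) (by simpa using hx) ?_
  intro p v s' _ hf hv hI
  have hy' : s'.mem aLab [(v : ℕ)] = y v := (congrFun (hf.mem aLab rfl) _).trans (hy v)
  simp only [outputVertex, wp_seq, wp_load, wp_store, List.map_cons, List.map_nil]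
  refine ⟨le_rfl, fun w => ?_⟩
  obtain rfl | hne := eq_or_ne w v
  · simp [hv, hy']
  · simpa [hv, hne, Fin.val_inj] using hI w

theorem AtComponent.wp_tryLabeling (h : AtComponent M nbr Λ H r m s) (hy : HoldsLabels y s)
    (hx : Outputs s x) (hbest : s.rreg fBest ≤ M.rootEnergy H r x) (hnodup : ∀ v, (nbr v).Nodup)
    (hnbr : ∀ v u, H.Adj v u → u ∈ nbr v) (hA : ∀ v, (nbr v).length ≤ A) :
    Wp ω tryLabeling s fun t s' => t ≤ m.length * (10 * A + 14) + 7 ∧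
      s.rreg fBest ≤ s'.rreg fBest ∧ M.rootEnergy H r y ≤ s'.rreg fBest ∧
      ∃ x', Outputs s' x' ∧ (∀ v ∉ m, x' v = x v) ∧ s'.rreg fBest ≤ M.rootEnergy H r x' := by
  refine wp_seq.2 <| wp_radd.2 <| wp_seq.2 ?_
  set s₁ := s.setRReg fCur _ with hs₁
  have h₁ : AtComponent M nbr Λ H r m s₁ := h.frame (c := tryLabeling) (.setRReg rfl _ _) rfl
  refine (h₁.wp_forSegment_energyVertex hy hnodup hnbr hA (by simp [hs₁, h.input.fzero])
    ).withFrame.mono ?_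
  rintro t₂ s₂ ⟨⟨ht₂, hcur⟩, hf₂⟩
  have hbest₂ : s₂.rreg fBest = s.rreg fBest := hf₂.rreg fBest rfl
  have hx₂ : Outputs s₂ x := fun v => (congrFun (hf₂.mem aOut rfl) _).trans (hx v)
  have hy₂ : HoldsLabels y s₂ := fun v => (congrFun (hf₂.mem aLab rfl) _).trans (hy v)
  have h₂ := h₁.frame hf₂ rfl
  simp only [wp_ifRLt, wp_seq, wp_radd, wp_skip, hcur, hbest₂, h₂.input.fzero, add_zero]
  split_ifs with hlt
  · refine (AtSegment.wp_forSegment_outputVertex (x := x) (y := y) (h₂.segment.frame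
      (c := tryLabeling) (.setRReg rfl _ _) ⟨rfl, rfl, rfl⟩) h₂.input.one h₂.input.zero hx₂ hy₂
      ).withFrame.mono ?_
    rintro t₃ s₃ ⟨⟨ht₃, hs₃⟩, hf₃⟩
    have hbest₃ : s₃.rreg fBest = M.rootEnergy H r y := by simp [hf₃.rreg fBest rfl]
    rw [hbest₃]
    refine ⟨by linarith, hlt.le, le_rfl, _, hs₃, fun v hv => if_neg hv, le_of_eq ?_⟩
    exact MRF.rootEnergy_congr fun v hv => by rw [if_pos ((h.mem_iff v).2 hv)]
  · exact ⟨by linarith, le_rfl, not_lt.1 hlt, x, hx₂, fun _ _ => rfl, hbest⟩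

theorem wp_incrVertex {a c : ℕ} (hv : s.reg rV = v) (hlab : s.mem aLab [(v : ℕ)] = a)
    (hcarry : s.reg rCarry = c) (halph : s.reg rAlph = q) :
    Wp ω incrVertex s fun t s' => t = 5 ∧ (∀ w : Fin n, s'.mem aLab [(w : ℕ)] =
      if w = v then if a + c < q then a + c else 0 else s.mem aLab [(w : ℕ)]) ∧
      s'.reg rCarry = if a + c < q then 0 else c := by
  simp only [incrVertex, wp_seq, wp_load, wp_add, wp_ifLt, wp_set, wp_store, List.map_cons,
    List.map_nil]
  split_ifs <;> simp_all [Fin.val_inj]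

theorem AtComponent.wp_forSegment_incrVertex {k : ℕ} (h : AtComponent M nbr Λ H r m s) (hq : 0 < q)
    (hy : HoldsLabels (labeling m hq k) s) (hcarry : s.reg rCarry = 1) :
    Wp ω (.forSegment incrVertex) s fun t s' => t ≤ m.length * 8 + 2 ∧
      HoldsLabels (labeling m hq (k + 1)) s' ∧ s'.reg rCarry = carry q k m.length := by
  refine (Wp.forSegment 5 (fun p s' => HoldsLabels (fun v => labeling m hq
    (if v ∈ p then k + 1 else k) v) s' ∧ s'.reg rCarry = carry q k p.length) rfl h.segment
    h.input.one h.input.zero (fun x hx _ _ _ h => ?_) ⟨by simpa using hy, by simp [hcarry, carry]⟩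
    ?_).mono ?_
  · fin_cases hx <;> exact h
  · rintro p v s' hpre hf hv ⟨hlab, hcarry'⟩
    have hvm : v ∈ m := hpre.subset (by simp)
    have hvp : v ∉ p := fun hvp =>
      (List.nodup_append.1 (h.nodup.sublist hpre.sublist)).2.2 v hvp v (by simp) rfl
    have hidx : m.idxOf v = p.length := by
      rw [← hpre.idxOf_eq_of_mem (by simp), List.idxOf_append_of_notMem hvp]
      simp
    have hlab_v : s'.mem aLab [(v : ℕ)] = labelAt m q k v := by simpa [hvp, labeling] using hlab v
    have hsucc := labelAt_succ (k := k) hq hvm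
    have hcarry_succ := carry_succ (k := k) hq hvm
    rw [hidx] at hsucc hcarry_succ
    refine (wp_incrVertex hv hlab_v hcarry' (h.input.frame hf rfl).alph).mono ?_
    rintro _ s'' ⟨rfl, hlab'', hcarry''⟩
    refine ⟨le_rfl, fun w => ?_, by simp [hcarry'', hcarry_succ]⟩
    rw [hlab'' w]
    obtain rfl | hne := eq_or_ne w v
    · simp [labeling, hsucc]
    · simpa [hne] using hlab w
  · rintro t s' ⟨ht, hlab, hcarry'⟩
    refine ⟨ht, fun v => (hlab v).trans ?_, hcarry'⟩
    by_cases hv : v ∈ m <;> simp [hv, labeling, labelAt]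

/-- The labels are those of the `k`-th assignment to `m`, and the output, which agrees with `x`
outside of `m`, is at least as good as the previous ones. -/
structure Enumerating (M : MRF (Fin n) (Fin q)) (H : SimpleGraph (Fin n)) (r : Fin n)
    (m : List (Fin n)) (hq : 0 < q) (x : Fin n → Fin q) (k : ℕ) (s : MState) : Prop where
  labels : HoldsLabels (labeling m hq k) s
  le_best : ∀ j < k, M.rootEnergy H r (labeling m hq j) ≤ s.rreg fBest
  output : ∃ y, Outputs s y ∧ (∀ v ∉ m, y v = x v) ∧ s.rreg fBest ≤ M.rootEnergy H r y
  carry_lt_iff : s.reg rCarry < 1 ↔ k < q ^ m.length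
  le_pow : k ≤ q ^ m.length

theorem Enumerating.wp_step {hq : 0 < q} {k : ℕ} (he : Enumerating M H r m hq x k s)
    (h : AtComponent M nbr Λ H r m s) (hk : k < q ^ m.length) (hnodup : ∀ v, (nbr v).Nodup)
    (hnbr : ∀ v u, H.Adj v u → u ∈ nbr v) (hA : ∀ v, (nbr v).length ≤ A) :
    Wp ω (tryLabeling ;; .set rCarry 1 ;; .forSegment incrVertex) s fun t s' =>
      t ≤ m.length * (10 * A + 22) + 10 ∧ Enumerating M H r m hq x (k + 1) s' := by
  obtain ⟨y, hy, hyx, hbest⟩ := he.output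
  refine wp_seq.2 <| (h.wp_tryLabeling he.labels hy hbest hnodup hnbr hA).withFrame.mono ?_
  rintro t₁ s₁ ⟨⟨ht₁, hmono, hle, y', hy', hyy', hbest'⟩, hf₁⟩
  have hlab₁ : HoldsLabels (labeling m hq k) s₁ := fun v =>
    (congrFun (hf₁.mem aLab rfl) _).trans (he.labels v)
  have h₁ : AtComponent M nbr Λ H r m (s₁.setReg rCarry 1) := (h.frame hf₁ rfl).frame
    (c := .set rCarry 1) (.setReg rfl _ _) rfl
  refine wp_seq.2 <| wp_set.2 <| (h₁.wp_forSegment_incrVertex hq hlab₁ (by simp)).withFrame.mono ?_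
  rintro t₂ s₂ ⟨⟨ht₂, hlab₂, hcarry⟩, hf₂⟩
  have hbest₂ : s₂.rreg fBest = s₁.rreg fBest := hf₂.rreg fBest rfl
  refine ⟨by linarith, hlab₂, fun j hj => ?_, ⟨y', fun v => ?_, fun v hv => ?_, ?_⟩, ?_, hk⟩
  · rw [hbest₂]
    obtain hj | rfl := Nat.lt_succ_iff_lt_or_eq.1 hj
    exacts [(he.le_best j hj).trans hmono, hle]
  · exact (congrFun (hf₂.mem aOut rfl) _).trans (hy' v)
  · exact (hyy' v hv).trans (hyx v hv)
  · rwa [hbest₂]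
  · rw [hcarry, carry_lt_one_iff]
    refine ⟨fun hdvd => lt_of_le_of_ne hk fun heq => hdvd heq.symm.dvd, fun hlt hdvd => ?_⟩
    exact hlt.not_ge (Nat.le_of_dvd k.succ_pos hdvd)

theorem AtComponent.wp_mapSegment (h : AtComponent M nbr Λ H r m s) (hq : 0 < q)
    (hlab : ∀ v : Fin n, s.mem aLab [(v : ℕ)] = 0) (hx : Outputs s x) (hnodup : ∀ v, (nbr v).Nodup)
    (hnbr : ∀ v u, H.Adj v u → u ∈ nbr v) (hA : ∀ v, (nbr v).length ≤ A) :
    Wp ω mapSegment s fun t s' => t ≤ q ^ m.length * (m.length * (10 * A + 22) + 11) + 3 ∧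
      (∀ v : Fin n, s'.mem aLab [(v : ℕ)] = 0) ∧
      ∃ y, Outputs s' y ∧ (∀ v ∉ m, y v = x v) ∧
        ∀ z, M.rootEnergy H r z ≤ M.rootEnergy H r y := by
  refine wp_seq.2 <| wp_radd.2 <| wp_seq.2 <| wp_set.2 ?_
  set s₁ := (s.setRReg fBest _).setReg rCarry 0 with hs₁
  have h₁ : AtComponent M nbr Λ H r m s₁ :=
    h.frame (c := mapSegment) ((Frame.setRReg rfl _ _).trans (.setReg rfl _ _)) rfl
  have he : Enumerating M H r m hq x 0 s₁ := by
    refine ⟨fun v => ?_, by simp, ⟨x, hx, fun _ _ => rfl, ?_⟩, ?_, Nat.zero_le _⟩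
    · simp [hs₁, hlab, labeling, labelAt_zero]
    · simpa [hs₁, h.input.fzero, MRF.rootEnergy] using
        Finset.sum_nonneg fun v _ => MRF.vertexEnergy_nonneg v
    · simp [hs₁, hq]
  refine (Wp.whileLt (q ^ m.length) (m.length * (10 * A + 22) + 10)
    (Enumerating M H r m hq x) he ?_).withFrame.mono ?_
  · intro k s' hf he' hlt
    have h' := h₁.frame hf rfl
    rw [h'.input.one, he'.carry_lt_iff] at hlt
    exact ⟨hlt, he'.wp_step h' hlt hnodup hnbr hA⟩
  · rintro t s' ⟨⟨k, ht, he', hn⟩, hf⟩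
    rw [(h₁.frame hf rfl).input.one, he'.carry_lt_iff] at hn
    obtain rfl : k = q ^ m.length := he'.le_pow.antisymm (not_lt.1 hn)
    obtain ⟨y, hy, hyx, hbest⟩ := he'.output
    refine ⟨by linarith, fun v => (he'.labels v).trans labelAt_pow_length, y, hy, hyx, fun z => ?_⟩
    obtain ⟨j, hj, hz⟩ := exists_labeling_eq m hq z
    refine le_trans (le_of_eq ?_) ((he'.le_best j hj).trans hbest)
    exact MRF.rootEnergy_congr fun v hv => (hz v ((h.mem_iff v).2 hv)).symm

/-- The queue holds the components of `H` in the segments given by the arrays of their bounds. -/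
def HoldsComponents (H : SimpleGraph (Fin n)) (s : MState) : Prop :=
  ∀ r : Fin n, ∃ m : List (Fin n), m.Nodup ∧ (∀ v, v ∈ m ↔ leastReachable H v = r) ∧
    s.mem aEnd [(r : ℕ)] = s.mem aStart [(r : ℕ)] + m.length ∧
    ∀ (j : ℕ) (h : j < m.length), s.mem aQueue [s.mem aStart [(r : ℕ)] + j] = m[j]

theorem Searched.holdsComponents {a : Fin n → ℕ} {l : List (Fin n)} (h : Searched H Λ a n l s) :
    HoldsComponents H s := by
  intro r
  obtain ⟨p, m, w, rfl, hm, hstart, hend⟩ := h.segment r r.is_lt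
  refine ⟨m, ?_, hm, by rw [hstart, hend], fun j hj => ?_⟩
  · exact h.nodup.sublist ((List.sublist_append_right p m).trans (List.sublist_append_left _ w))
  · rw [hstart, h.visited.queue _ (by simp; omega)]
    simp [hj]

theorem HoldsComponents.congr (h : HoldsComponents H s) {s' : MState}
    (hm : ∀ a ∈ [aQueue, aStart, aEnd], s'.mem a = s.mem a) : HoldsComponents H s' := by
  simp only [List.forall_mem_cons] at hm
  rw [HoldsComponents, hm.1, hm.2.1, hm.2.2.1]
  exact h

theorem HoldsComponents.wp_mapRoot {K : ℕ} (h : HoldsComponents H s) (hin : HoldsInput M nbr Λ s)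
    (hcut : HoldsCut nbr H.Adj s) (hroot : s.reg rRoot = r) (hq : 0 < q)
    (hlab : ∀ v : Fin n, s.mem aLab [(v : ℕ)] = 0) (hx : Outputs s x) (hnodup : ∀ v, (nbr v).Nodup)
    (hnbr : ∀ v u, H.Adj v u → u ∈ nbr v) (hA : ∀ v, (nbr v).length ≤ A)
    (hK : (Finset.univ.filter fun v => leastReachable H v = r).card ≤ K) :
    Wp ω mapRoot s fun t s' => t ≤ q ^ K *
        ((Finset.univ.filter fun v => leastReachable H v = r).card * (10 * A + 22) + 16) ∧
      (∀ v : Fin n, s'.mem aLab [(v : ℕ)] = 0) ∧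
      ∃ y, Outputs s' y ∧ (∀ v, leastReachable H v ≠ r → y v = x v) ∧
        ∀ z, M.rootEnergy H r z ≤ M.rootEnergy H r y := by
  obtain ⟨m, hm, hmem, hend, hqueue⟩ := h r
  have hcard : (Finset.univ.filter fun v => leastReachable H v = r).card = m.length := by
    rw [← List.toFinset_card_of_nodup hm]
    congr 1
    ext v
    simp [hmem]
  rw [hcard] at hK ⊢
  refine wp_seq.2 <| wp_load.2 <| wp_seq.2 <| wp_load.2 ?_
  set s₁ := (s.setReg rStart _).setReg rEnd _ with hs₁
  have hf₁ : Frame mapRoot s s₁ := (Frame.setReg rfl _ _).trans (.setReg rfl _ _)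
  have h₁ : AtComponent M nbr Λ H r m s₁ := by
    refine ⟨hin.frame hf₁ rfl, hcut, ⟨?_, fun j hj => ?_⟩, hm, hmem⟩
    · simpa [hs₁, hroot] using hend
    · simpa [hs₁, hroot] using hqueue j hj
  refine (h₁.wp_mapSegment hq hlab hx hnodup hnbr hA).mono ?_
  rintro t s' ⟨ht, hlab', y, hy, hyx, hmax⟩
  refine ⟨?_, hlab', y, hy, fun v hv => hyx v (mt (hmem v).1 hv), hmax⟩
  have hpow : q ^ m.length ≤ q ^ K := Nat.pow_le_pow_right hq hK
  have hone : 1 ≤ q ^ K := Nat.one_le_pow _ _ hq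
  nlinarith [Nat.mul_le_mul_right (m.length * (10 * A + 22) + 11) hpow]

theorem sum_card_leastReachable (H : SimpleGraph (Fin n)) :
    ∑ k ∈ Finset.range n, (Finset.univ.filter fun v : Fin n =>
      ((leastReachable H v : Fin n) : ℕ) = k).card = n := by
  rw [← Finset.card_eq_sum_card_fiberwise fun v _ => by simp, Finset.card_univ, Fintype.card_fin]

theorem HoldsComponents.wp_mapAll {K : ℕ} (h : HoldsComponents H s) (hin : HoldsInput M nbr Λ s)
    (hcut : HoldsCut nbr H.Adj s) (hq : 0 < q)
    (hlab : ∀ v : Fin n, s.mem aLab [(v : ℕ)] = 0) (hx : Outputs s x) (hnodup : ∀ v, (nbr v).Nodup)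
    (hnbr : ∀ v u, H.Adj v u → u ∈ nbr v) (hA : ∀ v, (nbr v).length ≤ A)
    (hK : ∀ r, (Finset.univ.filter fun v => leastReachable H v = r).card ≤ K) :
    Wp ω mapAll s fun t s' => t ≤ q ^ K * (n * (10 * A + 40)) + 2 ∧
      ∃ y, Outputs s' y ∧ ∀ r z, M.rootEnergy H r z ≤ M.rootEnergy H r y := by
  refine (Wp.forLt_sum (fun k => q ^ K * ((Finset.univ.filter fun v : Fin n =>
    ((leastReachable H v : Fin n) : ℕ) = k).card * (10 * A + 22) + 16)) (fun k s' =>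
      (∀ v : Fin n, s'.mem aLab [(v : ℕ)] = 0) ∧ ∃ y, Outputs s' y ∧
        ∀ r : Fin n, (r : ℕ) < k → ∀ z, M.rootEnergy H r z ≤ M.rootEnergy H r y)
    rfl hin.size hin.one ⟨hlab, x, hx, by simp⟩ ?_).mono ?_
  · rintro k hk s' hf hroot ⟨hlab', y, hy, hmax⟩
    have hcut' : HoldsCut nbr H.Adj s' := fun v u hu => (hf.mem aCut rfl) ▸ hcut v u hu
    refine ((h.congr fun a ha => hf.mem a (by fin_cases ha <;> rfl)).wp_mapRoot (r := ⟨k, hk⟩)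
      (hin.frame hf rfl) hcut' hroot hq hlab' hy hnodup hnbr hA (hK _)).mono ?_
    rintro t s'' ⟨ht, hlab'', y', hy', hyy', hmax'⟩
    refine ⟨by simpa only [Fin.ext_iff] using ht, hlab'', y', hy', fun r hr z => ?_⟩
    obtain hr | hr := Nat.lt_succ_iff_lt_or_eq.1 hr
    · rw [MRF.rootEnergy_congr (x := y') (y := y) fun v hv => hyy' v ?_]
      · exact hmax r hr z
      · rintro h
        exact hr.ne (by simp [← hv, h])
    · obtain rfl : r = ⟨k, hk⟩ := Fin.ext hr
      exact hmax' z
  · rintro t s' ⟨ht, -, y, hy, hmax⟩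
    refine ⟨ht.trans ?_, y, hy, fun r => hmax r r.is_lt⟩
    rw [Finset.sum_add_distrib, ← Finset.mul_sum, Finset.sum_add_distrib, ← Finset.sum_mul,
      sum_card_leastReachable, Finset.sum_const, Finset.sum_const, Finset.card_range, smul_eq_mul,
      smul_eq_mul]
    nlinarith [Nat.mul_le_mul_left n (Nat.one_le_pow K q hq)]

end Map

/-! ### The program -/

/-- With period `1` a round cuts every edge, which need not be discovered by a search. -/
def dropEdges : Cmd :=
  .ifLt rZero rRounds (.ifLt rOne rLam .skip (.forLt rV rN (.store aDeg [rV] rZero))) .skip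

def searchAndMap : Cmd := rounds ;; bfsAll ;; mapAll

def mode : Cmd := .set rOne 1 ;; dropEdges ;; searchAndMap

section Mode

variable {ω : ℕ → ℕ → ℕ} {n q r Λ A K : ℕ} {M : MRF (Fin n) (Fin q)} {nbr : Fin n → List (Fin n)}
  {G : SimpleGraph (Fin n)} {s : MState}

/-- The state holds the input and all working arrays are still zero. -/
structure HoldsInitial (M : MRF (Fin n) (Fin q)) (nbr : Fin n → List (Fin n)) (r Λ : ℕ)
    (s : MState) : Prop where
  input : HoldsInput M nbr Λ s
  numRounds : s.reg rRounds = r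
  cut : ∀ v u : Fin n, s.mem aCut [(v : ℕ), (u : ℕ)] = 0
  label : ∀ v : Fin n, s.mem aLab [(v : ℕ)] = 0
  output : ∀ v : Fin n, s.mem aOut [(v : ℕ)] = 0

theorem holdsInitial_inputState (M : MRF (Fin n) (Fin q)) (nbr : Fin n → List (Fin n)) (r Λ : ℕ) :
    HoldsInitial M nbr r Λ ((inputState M nbr r Λ).setReg rOne 1) where
  input :=
    { size := by simp [inputState]
      period := by simp [inputState]
      alph := by simp [inputState]
      one := by simp
      zero := by simp [inputState]
      fzero := by simp [inputState]
      deg := fun v => by simp [inputState]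
      adj := fun v k h => by simp [inputState, nbrAt, h]
      phi := fun v x => by simp [inputState]
      psi := fun v k h x y => by simp [inputState, nbrAt, h] }
  numRounds := by simp [inputState]
  cut v u := by simp [inputState]
  label v := by simp [inputState]
  output v := by simp [inputState]

theorem HoldsInitial.wp_clearDegrees (h : HoldsInitial M nbr r Λ s) :
    Wp ω (.forLt rV rN (.store aDeg [rV] rZero)) s fun t s' =>
      t ≤ n * 3 + 2 ∧ HoldsInitial M (fun _ => []) r Λ s' := by
  refine (Wp.forLt 1 (fun k s' => ∀ v < k, s'.mem aDeg [v] = 0) rfl h.input.size h.input.one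
    (by simp) ?_).withFrame.mono ?_
  · intro k _ s' hf hv hI
    rw [wp_store]
    refine ⟨le_rfl, fun v hvk => ?_⟩
    by_cases hne : v = k
    · simp [hne, hv, hf.reg rZero rfl, h.input.zero]
    · simp [hv, hne, hI v (by omega)]
  · rintro t s' ⟨⟨ht, hdeg⟩, hf⟩
    obtain ⟨⟨hn, hΛ, hq, h1, h0, hz, -, -, hphi, -⟩, hr, hcut, hlab, hout⟩ := h
    rw [← hf.reg _ rfl] at hn hΛ hq h1 h0 hr
    rw [← hf.rreg _ rfl] at hz
    rw [← hf.rmem _ rfl] at hphi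
    rw [← hf.mem _ rfl] at hcut hlab hout
    exact ⟨ht, ⟨hn, hΛ, hq, h1, h0, hz, fun v => hdeg v v.2, by simp, hphi, by simp⟩, hr, hcut,
      hlab, hout⟩

theorem HoldsInitial.wp_dropEdges (h : HoldsInitial M nbr r Λ s) (hΛ : 0 < Λ) :
    Wp ω dropEdges s fun t s' => t ≤ n * 3 + 4 ∧
      HoldsInitial M (if 0 < r ∧ Λ = 1 then fun _ => [] else nbr) r Λ s' := by
  rw [dropEdges, wp_ifLt, h.input.zero, h.numRounds]
  by_cases hr : 0 < r
  · rw [if_pos hr, wp_ifLt, h.input.one, h.input.period]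
    by_cases hΛ₁ : Λ = 1
    · rw [if_neg (by omega), if_pos ⟨hr, hΛ₁⟩]
      refine h.wp_clearDegrees.mono ?_
      rintro t s' ⟨ht, hs'⟩
      exact ⟨by omega, hs'⟩
    · rw [if_pos (by omega), if_neg (by tauto), wp_skip]
      exact ⟨by omega, h⟩
  · rw [if_neg hr, if_neg (by tauto), wp_skip]
    exact ⟨by omega, h⟩

theorem HoldsInitial.wp_searchAndMap (h : HoldsInitial M nbr r Λ s) (hq : 0 < q) (hΛ : 0 < Λ)
    (hG : IsAdjacencyList G nbr) (hA : ∀ v, (nbr v).length ≤ A) {L : ℕ → Fin n → Fin Λ}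
    (hL : ∀ i < r, ∀ v : Fin n, ω i v = L i v)
    (hK : ∀ c, (Finset.univ.filter fun v => leastReachable (roundGraph G L r) v = c).card ≤ K) :
    Wp ω searchAndMap s fun t s' =>
      t ≤ r * (n * (24 * A + 37) + 10) + n * (12 * A + 32) + q ^ K * (n * (10 * A + 40)) + 10 ∧
      ∃ x, Outputs s' x ∧
        ∀ c z, M.rootEnergy (roundGraph G L r) c z ≤ M.rootEnergy (roundGraph G L r) c x := by
  have hnbr : ∀ v u, (roundGraph G L r).Adj v u → u ∈ nbr v :=
    fun v u hvu => ((hG v).2 u).2 (roundGraph_le G L r hvu)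
  refine wp_seq.2 <| (wp_rounds h.input h.numRounds
    (fun v u hu => iff_of_true (h.cut v u) (((hG v).2 u).1 hu)) hΛ (fun v u => ((hG v).2 u).2) hA
    hL).withFrame.mono ?_
  rintro t₁ s₁ ⟨⟨ht₁, -, hcut₁⟩, hf₁⟩
  have hin₁ := h.input.frame hf₁ rfl
  refine wp_seq.2 <| (wp_bfsAll hin₁ hcut₁ hΛ hnbr hA fun v => rfl).withFrame.mono ?_
  rintro t₂ s₂ ⟨⟨ht₂, l, hl⟩, hf₂⟩
  have hlab : ∀ v : Fin n, s₂.mem aLab [(v : ℕ)] = 0 := by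
    rw [hf₂.mem aLab rfl, hf₁.mem aLab rfl]
    exact h.label
  have hout : Outputs s₂ fun _ : Fin n => (⟨0, hq⟩ : Fin q) := by
    rw [Outputs, hf₂.mem aOut rfl, hf₁.mem aOut rfl]
    exact h.output
  have hcut₂ : HoldsCut nbr (roundGraph G L r).Adj s₂ := by
    rwa [HoldsCut, hf₂.mem aCut rfl]
  refine (hl.holdsComponents.wp_mapAll (hin₁.frame hf₂ rfl) hcut₂ hq hlab hout (fun v => (hG v).1)
    hnbr hA hK).mono ?_
  rintro t₃ s₃ ⟨ht₃, hx⟩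
  exact ⟨by linarith, hx⟩

theorem wp_mode (hn : 0 < n) (hq : 0 < q) (hΛ : 0 < Λ) (hG : IsAdjacencyList M.graph nbr)
    (hA : ∀ v, (nbr v).length ≤ A) {L : ℕ → Fin n → Fin Λ}
    (hL : ∀ i < r, ∀ v : Fin n, ω i v = L i v)
    (hK : ∀ c, (Finset.univ.filter fun v =>
      leastReachable (roundGraph M.graph L r) v = c).card ≤ K) :
    Wp ω mode (inputState M nbr r Λ) fun t s' =>
      t ≤ 100 * ((r + 1) * (n * (((if 0 < r ∧ Λ = 1 then 0 else A) + 1) * q ^ K))) ∧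
      ∃ x, Outputs s' x ∧ ∀ c z, M.rootEnergy (roundGraph M.graph L r) c z ≤
        M.rootEnergy (roundGraph M.graph L r) c x := by
  set G := if 0 < r ∧ Λ = 1 then ⊥ else M.graph with hGdef
  have hround : roundGraph G L r = roundGraph M.graph L r := by
    by_cases h : 0 < r ∧ Λ = 1
    · obtain ⟨hr, rfl⟩ := h
      rw [roundGraph_eq_bot _ _ hr, roundGraph_eq_bot _ _ hr]
    · rw [hGdef, if_neg h]
  rw [← hround] at hK ⊢
  refine wp_seq.2 <| wp_set.2 <| wp_seq.2 <|
    ((holdsInitial_inputState M nbr r Λ).wp_dropEdges hΛ).mono ?_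
  rintro t₁ s₁ ⟨ht₁, h₁⟩
  refine (h₁.wp_searchAndMap (A := if 0 < r ∧ Λ = 1 then 0 else A) hq hΛ (G := G) ?_ ?_ hL hK).mono
    fun t₂ s₂ ⟨ht₂, hx⟩ => ⟨?_, hx⟩
  · by_cases h : 0 < r ∧ Λ = 1
    · simp [hGdef, h, IsAdjacencyList]
    · simpa only [hGdef, if_neg h] using hG
  · intro v
    split_ifs
    exacts [le_rfl, hA v]
  · generalize (if 0 < r ∧ Λ = 1 then 0 else A) = B at ht₂ ⊢
    obtain ⟨n, rfl⟩ := Nat.exists_eq_succ_of_ne_zero hn.ne'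
    obtain ⟨Q, hQ⟩ := Nat.exists_eq_succ_of_ne_zero (pow_pos hq K).ne'
    rw [hQ] at ht₂ ⊢
    simp only [Nat.succ_eq_add_one] at *
    ring_nf at ht₁ ht₂ ⊢
    omega

theorem exists_draws_extension (hΛ : 0 < Λ) (L : Draws n r Λ) :
    ∃ L' : ℕ → Fin n → Fin Λ, (L = fun i : Fin r => L' i) ∧
      ∀ i < r, ∀ v : Fin n, drawSource L i v = L' i v :=
  ⟨fun i v => if h : i < r then L ⟨i, h⟩ v else ⟨0, hΛ⟩, by simp,
    fun i hi v => by simp [drawSource, hi]⟩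

theorem exists_exec_mode (hn : 0 < n) (hq : 0 < q) (hΛ : 0 < Λ) (hG : IsAdjacencyList M.graph nbr)
    (hA : ∀ v, (nbr v).length ≤ A) (L : Draws n r Λ)
    (hK : ∀ c, (Finset.univ.filter fun v => leastReachable
      (M.graph.deleteEdges (minorE M.graph (leastRule (Fin n)) r L)) v = c).card ≤ K) :
    ∃ t s, Exec (drawSource L) mode (inputState M nbr r Λ) t s ∧
      t ≤ 100 * ((r + 1) * (n * (((if 0 < r ∧ Λ = 1 then 0 else A) + 1) * q ^ K))) ∧
      ∃ x, Outputs s x ∧ M.IsModeOutput (minorE M.graph (leastRule (Fin n)) r L) x := by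
  obtain ⟨L', rfl, hL'⟩ := exists_draws_extension hΛ L
  rw [deleteEdges_minorE] at hK
  obtain ⟨t, s, hexec, ht, x, hx, hmax⟩ := wp_mode hn hq hΛ hG hA hL' hK
  refine ⟨t, s, hexec, ht, x, hx, MRF.isModeOutput_of_rootEnergy_le ?_⟩
  rw [deleteEdges_minorE]
  exact hmax

theorem implementsMode_mode : ImplementsMode mode := by
  intro n q r Λ hn hq hΛ M nbr hG
  refine ⟨leastRule (Fin n), fun L => ?_⟩
  obtain ⟨t, s, hexec, -, x, hx⟩ := exists_exec_mode hn hq hΛ hG (fun _ => (hG _).1.length_le_card)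
    L fun _ => Finset.card_le_univ _
  exact ⟨t, s, x, hexec, hx⟩

theorem time_mode_le_of_card_le (hn : 0 < n) (hq : 0 < q) (hΛ : 0 < Λ)
    (hG : IsAdjacencyList M.graph nbr)
    (hA : ∀ v, (nbr v).length ≤ A) {L : Draws n r Λ}
    (hK : ∀ c, (Finset.univ.filter fun v => leastReachable
      (M.graph.deleteEdges (minorE M.graph (leastRule (Fin n)) r L)) v = c).card ≤ K) {t : ℕ}
    (hexec : Exec (drawSource L) mode (inputState M nbr r Λ) t s) :
    t ≤ 100 * ((r + 1) * (n * (((if 0 < r ∧ Λ = 1 then 0 else A) + 1) * q ^ K))) := by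
  obtain ⟨t', s', hexec', ht', -⟩ := exists_exec_mode hn hq hΛ hG hA L hK
  rwa [(hexec.deterministic hexec').1]

end Mode

/-! ### The approximation guarantee -/

section EdgeProbability

theorem expect_ite_apply_eq {ι α : Type*} [Fintype ι] [DecidableEq ι] [Fintype α] [DecidableEq α]
    [Nonempty α] (i : ι) (a : α) :
    (𝔼 f : ι → α, if f i = a then (1 : ℝ) else 0) = (Fintype.card α : ℝ)⁻¹ := by
  rw [Fintype.expect_equiv (Equiv.funSplitAt i α) (fun f => if f i = a then (1 : ℝ) else 0)
    (fun p => if p.1 = a then 1 else 0) fun _ => rfl, ← Finset.univ_product_univ,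
    Finset.expect_product' _ _ fun x _ => if x = a then (1 : ℝ) else 0]
  simp only [Fintype.expect_const, Fintype.expect_ite_eq']
  rw [NNRat.smul_def, NNRat.cast_inv, NNRat.cast_natCast, mul_one]

theorem expect_snoc {α : Type*} [Fintype α] {r : ℕ} (f : (Fin (r + 1) → α) → ℝ) :
    (𝔼 L, f L) = 𝔼 L : Fin r → α, 𝔼 a : α, f (Fin.snoc (α := fun _ => α) L a) := by
  rw [Finset.expect_comm, ← Finset.expect_product', Finset.univ_product_univ]
  exact (Fintype.expect_equiv (Fin.snocEquiv fun _ => α) _ f fun _ => rfl).symm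

variable {n Λ : ℕ}

theorem minorE_snoc (G : SimpleGraph (Fin n)) (ρ : RootRule (Fin n)) {r : ℕ} (L : Draws n r Λ)
    (ℓ : Fin n → Fin Λ) :
    minorE G ρ (r + 1) (Fin.snoc (α := fun _ => Fin n → Fin Λ) L ℓ) =
      minorE G ρ r L ∪ bfsCut (G.deleteEdges (minorE G ρ r L))
        (ρ.pick r (G.deleteEdges (minorE G ρ r L))) ℓ := by
  rw [minorE, Fin.init_snoc, Fin.snoc_last]

variable [NeZero Λ]

open Classical in
theorem expect_mem_bfsCut_le {V : Type} [Fintype V] [DecidableEq V] (H : SimpleGraph V)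
    (root : H.ConnectedComponent → V) (e : Sym2 V) :
    (𝔼 ℓ : V → Fin Λ, if e ∈ bfsCut H root ℓ then (1 : ℝ) else 0) ≤ (Λ : ℝ)⁻¹ := by
  by_cases he : e ∈ H.edgeSet
  · induction e with
    | _ v u =>
      rw [SimpleGraph.mem_edgeSet] at he
      set d := min (H.dist (root (H.connectedComponentMk v)) v)
        (H.dist (root (H.connectedComponentMk v)) u) with hd
      have hcut (ℓ : V → Fin Λ) (h : s(v, u) ∈ bfsCut H root ℓ) :
          ℓ (root (H.connectedComponentMk v)) = Fin.ofNat Λ d := by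
        obtain ⟨k, hk⟩ := (mk_mem_bfsCut_iff he).1 h
        ext
        rw [Fin.val_ofNat, hd, hk, Nat.mul_add_mod_of_lt (Fin.is_lt _)]
      calc (𝔼 ℓ : V → Fin Λ, if s(v, u) ∈ bfsCut H root ℓ then (1 : ℝ) else 0)
          ≤ 𝔼 ℓ : V → Fin Λ, if ℓ (root (H.connectedComponentMk v)) = Fin.ofNat Λ d
              then (1 : ℝ) else 0 := by
            refine Finset.expect_le_expect fun ℓ _ => ?_
            split_ifs with h h'
            · rfl
            · exact absurd (hcut ℓ h) h'
            · exact zero_le_one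
            · rfl
        _ = (Λ : ℝ)⁻¹ := by rw [expect_ite_apply_eq, Fintype.card_fin]
  · have hnot (ℓ : V → Fin Λ) : e ∉ bfsCut H root ℓ := fun h => he h.1
    simp [hnot]

open Classical in
theorem expect_mem_minorE_le (G : SimpleGraph (Fin n)) (ρ : RootRule (Fin n)) (e : Sym2 (Fin n))
    (r : ℕ) : (𝔼 L : Draws n r Λ, if e ∈ minorE G ρ r L then (1 : ℝ) else 0) ≤ r / Λ := by
  induction r with
  | zero => simp [minorE]
  | succ r ih =>
    have hunion {A B C : Set (Sym2 (Fin n))} (h : A = B ∪ C) : (if e ∈ A then (1 : ℝ) else 0) ≤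
        (if e ∈ B then 1 else 0) + if e ∈ C then 1 else 0 := by
      have hmem : e ∈ A ↔ e ∈ B ∨ e ∈ C := by rw [h, Set.mem_union]
      split_ifs <;> first | tauto | norm_num
    rw [expect_snoc (α := Fin n → Fin Λ)]
    calc _ ≤ 𝔼 L : Draws n r Λ, ((if e ∈ minorE G ρ r L then 1 else 0) + (Λ : ℝ)⁻¹) := by
          refine Finset.expect_le_expect fun L _ => ?_
          refine (Finset.expect_le_expect fun ℓ _ => hunion (minorE_snoc G ρ L ℓ)).trans ?_
          rw [Finset.expect_add_distrib, Fintype.expect_const]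
          gcongr
          exact expect_mem_bfsCut_le _ _ e
      _ ≤ r / Λ + (Λ : ℝ)⁻¹ := by
          rw [Finset.expect_add_distrib, Fintype.expect_const]
          gcongr
      _ = ((r + 1 : ℕ) : ℝ) / Λ := by push_cast; ring

end EdgeProbability

section Components

variable {V S : Type}

theorem forall_mem_supp_iff {H : SimpleGraph V} {v u : V} (h : H.Adj v u)
    (c : H.ConnectedComponent) :
    (∀ w ∈ s(v, u), w ∈ c.supp) ↔ H.connectedComponentMk v = c := by
  simp only [Sym2.mem_iff, forall_eq_or_imp, forall_eq,
    SimpleGraph.ConnectedComponent.mem_supp_iff]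
  exact and_iff_left_of_imp (SimpleGraph.ConnectedComponent.eq.2 h.symm.reachable).trans

theorem MRF.edgeTerm_nonneg (M : MRF V S) (x : V → S) (e : Sym2 V) : 0 ≤ M.edgeTerm x e := by
  induction e with
  | _ v u => exact M.ψ_nonneg _ _ _ _

variable [Fintype V]

open Classical in
theorem sum_sum_component_edges (H : SimpleGraph V) (f : Sym2 V → ℝ) :
    ∑ c : H.ConnectedComponent, ∑ e with e ∈ H.edgeSet ∧ ∀ v ∈ e, v ∈ c.supp, f e =
      ∑ e with e ∈ H.edgeSet, f e := by
  simp only [Finset.sum_filter]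
  rw [Finset.sum_comm]
  refine Finset.sum_congr rfl fun e _ => ?_
  induction e with
  | _ v u =>
    by_cases he : H.Adj v u
    · simp only [SimpleGraph.mem_edgeSet, he, true_and, if_true, forall_mem_supp_iff he,
        Finset.sum_ite_eq, Finset.mem_univ]
    · simp only [SimpleGraph.mem_edgeSet, he, false_and, if_false, Finset.sum_const_zero]

theorem MRF.energy_nonneg (M : MRF V S) (x : V → S) : 0 ≤ M.energy x :=
  add_nonneg (Finset.sum_nonneg fun v _ => M.φ_nonneg v _)
    (Finset.sum_nonneg fun e _ => M.edgeTerm_nonneg x e)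

open Classical in
theorem MRF.sum_componentEnergy_add_sum_cut (M : MRF V S) (B : Set (Sym2 V)) (x : V → S) :
    ∑ c, M.componentEnergy B c x + ∑ e with e ∈ M.graph.edgeSet ∧ e ∈ B, M.edgeTerm x e =
      M.energy x := by
  have hvertex : ∑ c : (M.graph.deleteEdges B).ConnectedComponent, ∑ v with v ∈ c.supp,
      M.φ v (x v) = ∑ v, M.φ v (x v) := by
    simp only [SimpleGraph.ConnectedComponent.mem_supp_iff]
    exact Finset.sum_fiberwise _ _ _
  have hedge : ∑ c : (M.graph.deleteEdges B).ConnectedComponent,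
      ∑ e with e ∈ (M.graph.deleteEdges B).edgeSet ∧ ∀ v ∈ e, v ∈ c.supp, M.edgeTerm x e =
        ∑ e with e ∈ M.graph.edgeSet ∧ e ∉ B, M.edgeTerm x e := by
    refine (Eq.trans (by congr!) (sum_sum_component_edges (M.graph.deleteEdges B) _)).trans ?_
    exact Finset.sum_congr (by ext; simp) fun _ _ => rfl
  have hsplit := Finset.sum_filter_add_sum_filter_not
    (Finset.univ.filter fun e => e ∈ M.graph.edgeSet) (· ∈ B) (M.edgeTerm x)
  rw [Finset.filter_filter, Finset.filter_filter] at hsplit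
  simp only [MRF.componentEnergy, MRF.energy, Finset.sum_add_distrib]
  linarith

open Classical in
theorem MRF.IsModeOutput.energy_sub_le {M : MRF V S} {B : Set (Sym2 V)} {x : V → S}
    (hx : M.IsModeOutput B x) (y : V → S) :
    M.energy y - M.energy x ≤
      ∑ e with e ∈ M.graph.edgeSet, (if e ∈ B then 1 else 0) * M.edgeTerm y e := by
  have hcomp : ∑ c, M.componentEnergy B c y ≤ ∑ c, M.componentEnergy B c x :=
    Finset.sum_le_sum fun c _ => hx c y
  have hcut : 0 ≤ ∑ e with e ∈ M.graph.edgeSet ∧ e ∈ B, M.edgeTerm x e :=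
    Finset.sum_nonneg fun e _ => M.edgeTerm_nonneg x e
  have hx := M.sum_componentEnergy_add_sum_cut B x
  have hy := M.sum_componentEnergy_add_sum_cut B y
  simp only [boole_mul]
  rw [← Finset.sum_filter, Finset.filter_filter]
  linarith

end Components

theorem MRF.expect_energy_sub_le {S : Type} {n r Λ : ℕ} (hΛ : 0 < Λ) {M : MRF (Fin n) S}
    {ρ : RootRule (Fin n)} {x : Draws n r Λ → Fin n → S}
    (hx : ∀ L, M.IsModeOutput (minorE M.graph ρ r L) (x L)) (y : Fin n → S) :
    (𝔼 L, (M.energy y - M.energy (x L))) ≤ r / Λ * M.energy y := by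
  classical
  have : NeZero Λ := ⟨hΛ.ne'⟩
  calc (𝔼 L, (M.energy y - M.energy (x L)))
      ≤ 𝔼 L : Draws n r Λ, ∑ e with e ∈ M.graph.edgeSet,
          (if e ∈ minorE M.graph ρ r L then 1 else 0) * M.edgeTerm y e :=
        Finset.expect_le_expect fun L _ => (hx L).energy_sub_le y
    _ = ∑ e with e ∈ M.graph.edgeSet, (𝔼 L : Draws n r Λ,
          if e ∈ minorE M.graph ρ r L then 1 else 0) * M.edgeTerm y e := by
        rw [Finset.expect_sum_comm]
        simp only [Finset.expect_mul]
    _ ≤ ∑ e with e ∈ M.graph.edgeSet, r / Λ * M.edgeTerm y e :=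
        Finset.sum_le_sum fun e _ => mul_le_mul_of_nonneg_right (expect_mem_minorE_le _ ρ e r)
          (M.edgeTerm_nonneg y e)
    _ ≤ r / Λ * M.energy y := by
        rw [← Finset.mul_sum]
        refine mul_le_mul_of_nonneg_left ?_ (by positivity)
        exact le_add_of_nonneg_left (Finset.sum_nonneg fun v _ => M.φ_nonneg v _)

/-! ### Components left by the decomposition have small weak diameter -/

section Geodesic

variable {V : Type*} {G H : SimpleGraph V} {s v : V}

theorem mem_ball_natCast_iff {R : ℕ} :
    v ∈ H.ball s R ↔ H.Reachable s v ∧ H.dist s v < R := by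
  rw [SimpleGraph.mem_ball, SimpleGraph.edist_comm]
  by_cases h : H.Reachable s v
  · rw [← h.coe_dist_eq_edist, Nat.cast_lt, and_iff_right h]
  · simp [SimpleGraph.edist_eq_top_of_not_reachable h, h]

theorem exists_dist_eq_of_le (hHG : H ≤ G) (h : H.Reachable s v) {k : ℕ} (hk : k ≤ G.dist s v) :
    ∃ y, H.Reachable s y ∧ G.dist s y = k := by
  rw [SimpleGraph.reachable_iff_reflTransGen] at h
  induction h with
  | refl => exact ⟨s, .rfl, by simpa using hk.antisymm' (by simp)⟩
  | @tail y v hsy hyv ih =>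
    rcases le_or_gt k (G.dist s y) with hky | hky
    · exact ih hky
    · have := dist_le_dist_add_one_of_adj (s := s) (hHG hyv)
      exact ⟨v, ((SimpleGraph.reachable_iff_reflTransGen ..).2 hsy).trans hyv.reachable, by omega⟩

variable {p : H.Walk s v} {e : ℕ}

theorem dist_getVert_of_length_eq_dist (hp : p.length = H.dist s v) {j : ℕ} (hj : j ≤ p.length) :
    H.dist s (p.getVert j) = j := by
  have htake := SimpleGraph.dist_le (p.take j)
  have hdrop := SimpleGraph.dist_le (p.drop j)
  have htri := (p.take j).reachable.dist_triangle_left v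
  rw [SimpleGraph.Walk.take_length] at htake
  rw [SimpleGraph.Walk.drop_length] at hdrop
  omega

theorem mem_support_drop_iff (he : e ≤ p.length) {y : V} :
    y ∈ (p.drop e).support ↔ ∃ j, e ≤ j ∧ j ≤ p.length ∧ p.getVert j = y := by
  simp only [SimpleGraph.Walk.mem_support_iff_exists_getVert, SimpleGraph.Walk.drop_getVert,
    SimpleGraph.Walk.drop_length]
  constructor
  · rintro ⟨j, rfl, hj⟩
    exact ⟨e + j, by omega, by omega, rfl⟩
  · rintro ⟨j, hej, hj, rfl⟩
    exact ⟨j - e, by rw [Nat.add_sub_cancel' hej], by omega⟩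

theorem le_dist_of_mem_support_drop (hp : p.length = H.dist s v) (he : e ≤ p.length) {y : V}
    (hy : y ∈ (p.drop e).support) : e ≤ H.dist s y := by
  obtain ⟨j, hej, hj, rfl⟩ := (mem_support_drop_iff he).1 hy
  rwa [dist_getVert_of_length_eq_dist hp hj]

theorem disjoint_ball_support_drop (hp : p.length = H.dist s v) (he : e ≤ p.length) :
    Disjoint (H.ball s e) {y | y ∈ (p.drop e).support} :=
  Set.disjoint_left.2 fun _ hy hy' =>
    (mem_ball_natCast_iff.1 hy).2.not_ge (le_dist_of_mem_support_drop hp he hy')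

theorem exists_adj_ball_support_drop (hp : p.length = H.dist s v) (he₀ : 0 < e)
    (he : e ≤ p.length) : ∃ y ∈ H.ball s e, ∃ z ∈ (p.drop e).support, H.Adj y z := by
  refine ⟨p.getVert (e - 1), mem_ball_natCast_iff.2 ⟨(p.take _).reachable, ?_⟩, p.getVert e,
    (mem_support_drop_iff he).2 ⟨e, le_rfl, he, rfl⟩, ?_⟩
  · rw [dist_getVert_of_length_eq_dist hp (by omega)]
    omega
  · have h := p.adj_getVert_succ (i := e - 1) (by omega)
    rwa [Nat.sub_add_cancel he₀] at h

theorem connected_induce_support_of_le (hHG : H ≤ G) (p : H.Walk s v) :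
    (G.induce {y | y ∈ p.support}).Connected := by
  have h := (p.mapLe hHG).connected_induce_support
  rwa [SimpleGraph.Walk.support_mapLe_eq_support] at h

theorem connected_induce_ball (hHG : H ≤ G) (s : V) (he : 0 < e) :
    (G.induce (H.ball s e)).Connected := by
  refine SimpleGraph.induce_connected_of_patches s
    (SimpleGraph.mem_ball_self (Nat.cast_pos.2 he)) fun {v} hv => ?_
  obtain ⟨hsv, hdist⟩ := mem_ball_natCast_iff.1 hv
  obtain ⟨p, hp⟩ := hsv.exists_walk_length_eq_dist
  refine ⟨{y | y ∈ p.support}, fun y hy => ?_, p.start_mem_support, p.end_mem_support,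
    (connected_induce_support_of_le hHG p).preconnected _ _⟩
  obtain ⟨j, rfl, hj⟩ := SimpleGraph.Walk.mem_support_iff_exists_getVert.1 hy
  refine mem_ball_natCast_iff.2 ⟨(p.take j).reachable, ?_⟩
  rw [dist_getVert_of_length_eq_dist hp hj]
  omega

end Geodesic

/-- The component of `w` in the subgraph `H'` of `H` lies between the levels `a` and `b`, `b`
excluded, of the breadth-first search of `H` from `s`, and `H'` has all edges of `H` between
consecutive levels in this band. -/
structure IsBand {V : Type*} (H H' : SimpleGraph V) (s w : V) (a b : ℕ) : Prop where
  le : H' ≤ H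
  reachable : H.Reachable s w
  le_dist : ∀ v, H'.Reachable w v → a ≤ H.dist s v
  dist_lt : ∀ v, H'.Reachable w v → H.dist s v < b
  adj : ∀ y v, H.Reachable s y → H.Adj y v → a ≤ H.dist s y → H.dist s v = H.dist s y + 1 →
    H.dist s v < b → H'.Adj y v

section Band

variable {V : Type} {Λ : ℕ} {H : SimpleGraph V} {root : H.ConnectedComponent → V} {L : V → Fin Λ}
  {s w : V}

theorem bandIndex_eq_of_adj {y v : V}
    (hroot : root (H.connectedComponentMk y) = s) (h : (H.deleteEdges (bfsCut H root L)).Adj y v)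
    (hle : H.dist s y ≤ H.dist s v) :
    (H.dist s y + (Λ - 1 - L s)) / Λ = (H.dist s v + (Λ - 1 - L s)) / Λ := by
  obtain ⟨hadj, hcut⟩ := SimpleGraph.deleteEdges_adj.1 h
  rw [mk_mem_bfsCut_iff hadj, hroot, min_eq_left hle] at hcut
  have hle' := dist_le_dist_add_one_of_adj (s := s) hadj
  have hL := (L s).isLt
  rcases hle.eq_or_lt with heq | hlt
  · rw [heq]
  rw [show H.dist s v + (Λ - 1 - L s) = H.dist s y + (Λ - 1 - L s) + 1 by omega, Nat.succ_div,
    if_neg, add_zero]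
  rintro ⟨k, hk⟩
  obtain _ | k := k
  · omega
  · rw [Nat.mul_succ, mul_comm] at hk
    exact hcut ⟨k, by omega⟩

theorem bandIndex_eq_of_reachable (hroot : root (H.connectedComponentMk w) = s) {v : V}
    (h : (H.deleteEdges (bfsCut H root L)).Reachable w v) :
    (H.dist s v + (Λ - 1 - L s)) / Λ = (H.dist s w + (Λ - 1 - L s)) / Λ := by
  rw [SimpleGraph.reachable_iff_reflTransGen] at h
  induction h with
  | refl => rfl
  | @tail y v hwy hyv ih =>
    have hy : root (H.connectedComponentMk y) = s := by
      rw [← hroot, SimpleGraph.ConnectedComponent.eq.2]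
      exact (((SimpleGraph.reachable_iff_reflTransGen ..).2 hwy).mono
        (SimpleGraph.deleteEdges_le _)).symm
    have hv : root (H.connectedComponentMk v) = s := by
      rw [← hy, SimpleGraph.ConnectedComponent.eq.2]
      exact (SimpleGraph.deleteEdges_adj.1 hyv).1.symm.reachable
    rw [← ih]
    rcases le_total (H.dist s y) (H.dist s v) with hle | hle
    · exact (bandIndex_eq_of_adj hy hyv hle).symm
    · exact bandIndex_eq_of_adj hv hyv.symm hle

theorem exists_isBand (L : V → Fin Λ) (hroot : root (H.connectedComponentMk w) = s)
    (hs : H.Reachable s w) :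
    ∃ a b, IsBand H (H.deleteEdges (bfsCut H root L)) s w a b ∧ b ≤ a + Λ := by
  have hL := (L s).isLt
  set k := (H.dist s w + (Λ - 1 - L s)) / Λ
  have hlevel (v) (hv : (H.deleteEdges (bfsCut H root L)).Reachable w v) :
      k * Λ ≤ H.dist s v + (Λ - 1 - L s) ∧ H.dist s v + (Λ - 1 - L s) < (k + 1) * Λ := by
    have hΛ : 0 < Λ := by omega
    rw [← Nat.le_div_iff_mul_le hΛ, ← Nat.div_lt_iff_lt_mul hΛ,
      show _ / Λ = k from bandIndex_eq_of_reachable hroot hv]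
    exact ⟨le_rfl, k.lt_succ_self⟩
  simp only [Nat.succ_mul] at hlevel
  refine ⟨k * Λ + L s + 1 - Λ, k * Λ + L s + 1, ⟨SimpleGraph.deleteEdges_le _, hs,
    fun v hv => ?_, fun v hv => ?_, fun y v hy hyv hay hd hb => ?_⟩, by omega⟩
  · have := hlevel v hv
    omega
  · have := hlevel v hv
    omega
  · refine SimpleGraph.deleteEdges_adj.2 ⟨hyv, fun hmem => ?_⟩
    rw [mk_mem_bfsCut_iff hyv, SimpleGraph.ConnectedComponent.eq.2 (hy.symm.trans hs), hroot,
      min_eq_left (by omega)] at hmem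
    obtain ⟨j, hj⟩ := hmem
    have hjk : j * Λ < k * Λ := by omega
    have hkj : k * Λ < (j + 1) * Λ := by rw [Nat.succ_mul]; omega
    have := Nat.lt_of_mul_lt_mul_right hjk
    have := Nat.lt_of_mul_lt_mul_right hkj
    omega

end Band

theorem IsBand.reachable_getVert {V : Type*} {H H' : SimpleGraph V} {s w u : V} {a b : ℕ}
    (h : IsBand H H' s w a b) (hu : H'.Reachable w u) {p : H.Walk s u} (hp : p.length = H.dist s u)
    {j : ℕ} (haj : a ≤ j) (hj : j ≤ p.length) :
    H'.Reachable u (p.getVert j) ∧ H'.dist u (p.getVert j) ≤ p.length - j := by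
  obtain ⟨k, hk⟩ := Nat.exists_eq_add_of_le hj
  induction k generalizing j with
  | zero =>
    obtain rfl : j = p.length := hk.symm
    simp
  | succ k ih =>
    obtain ⟨hreach, hdist⟩ := ih (j := j + 1) (by omega) (by omega) (by omega)
    have hjj := dist_getVert_of_length_eq_dist hp hj
    have hsucc := dist_getVert_of_length_eq_dist hp (j := j + 1) (by omega)
    have hadj := h.adj _ _ (p.take j).reachable (p.adj_getVert_succ (i := j) (by omega))
      (by omega) (by omega) (by have := h.dist_lt u hu; omega)
    have := dist_le_dist_add_one_of_adj (s := u) hadj.symm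
    exact ⟨hreach.trans hadj.symm.reachable, by omega⟩

/-- A complete bipartite minor of `G` with left branch sets `A l` and right branch sets `B t`, in
the component of `w` in `H`; the right branch sets are not required to be disjoint from each other,
but `B t` is near `x t`, and it contains a point `u t` such that the ball of radius `R` in `H`
around it avoids all left branch sets. -/
structure BandMinor {V T : Type*} (G H : SimpleGraph V) (w : V) (R : ℕ) (x : T → V) (K : ℕ) {m : ℕ}
    (A : Fin m → Set V) (B : T → Set V) (u : T → V) : Prop where
  connected_left : ∀ l, (G.induce (A l)).Connected
  connected_right : ∀ t, (G.induce (B t)).Connected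
  reachable_left : ∀ l, ∀ v ∈ A l, H.Reachable w v
  reachable_right : ∀ t, ∀ v ∈ B t, H.Reachable w v
  disjoint_left : ∀ l l', l ≠ l' → Disjoint (A l) (A l')
  disjoint : ∀ l t, Disjoint (A l) (B t)
  adj : ∀ l t, ∃ y ∈ A l, ∃ v ∈ B t, G.Adj y v
  near : ∀ t, ∀ v ∈ B t, G.Reachable (x t) v ∧ G.dist (x t) v ≤ K
  mem : ∀ t, u t ∈ B t
  avoids : ∀ t l v, H.Reachable (u t) v → H.dist (u t) v ≤ R → v ∉ A l

namespace BandMinor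

variable {V T : Type*} {G H H' : SimpleGraph V} {w : V} {R K m : ℕ} {x : T → V} {A : Fin m → Set V}
  {B : T → Set V} {u : T → V}

theorem isMinor (h : BandMinor G H w R x K A B u)
    (hfar : ∀ t t', t ≠ t' → 2 * K < G.dist (x t) (x t')) :
    IsMinor (completeBipartiteGraph (Fin m) T) G := by
  have hB (t t') (hne : t ≠ t') : Disjoint (B t) (B t') := by
    refine Set.disjoint_left.2 fun v hv hv' => (hfar t t' hne).not_ge ?_
    obtain ⟨hreach, hdist⟩ := h.near t v hv
    obtain ⟨-, hdist'⟩ := h.near t' v hv'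
    have := hreach.dist_triangle_left (x t')
    rw [G.dist_comm (u := v)] at this
    omega
  refine ⟨Sum.elim A B, ?_, ?_, ?_⟩
  · rintro (l | t)
    · exact h.connected_left l
    · exact h.connected_right t
  · rintro (l | t) (l' | t') hne
    · exact h.disjoint_left l l' (ne_of_apply_ne Sum.inl hne)
    · exact h.disjoint l t'
    · exact (h.disjoint l' t).symm
    · exact hB t t' (ne_of_apply_ne Sum.inr hne)
  · rintro (l | t) (l' | t') hadj
    · simp at hadj
    · exact h.adj l t'
    · obtain ⟨y, hy, v, hv, hyv⟩ := h.adj l' t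
      exact ⟨v, hv, y, hy, hyv.symm⟩
    · simp at hadj

theorem comp (h : BandMinor G H w R x K A B u) {T' : Type*} (f : T' → T) :
    BandMinor G H w R (x ∘ f) K A (B ∘ f) (u ∘ f) where
  connected_left := h.connected_left
  connected_right t := h.connected_right (f t)
  reachable_left := h.reachable_left
  reachable_right t := h.reachable_right (f t)
  disjoint_left := h.disjoint_left
  disjoint l t := h.disjoint l (f t)
  adj l t := h.adj l (f t)
  near t := h.near (f t)
  mem t := h.mem (f t)
  avoids t := h.avoids (f t)

theorem singleton (hx : ∀ t, H.Reachable w (x t)) :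
    BandMinor G H w R x 0 (m := 0) Fin.elim0 (fun t => {x t}) x where
  connected_left l := l.elim0
  connected_right t := by
    rw [SimpleGraph.induce_singleton_eq_top]
    exact SimpleGraph.connected_top
  reachable_left l := l.elim0
  reachable_right := by rintro t v rfl; exact hx t
  disjoint_left l := l.elim0
  disjoint l := l.elim0
  adj l := l.elim0
  near := by rintro t v rfl; simp
  mem t := rfl
  avoids t l := l.elim0

theorem near_support (hHG : H ≤ G) {s : V} {e : ℕ} (hM : BandMinor G H' w R x K A B u) {t : T}
    {p : H.Walk s (u t)} (he : e ≤ p.length) {v : V}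
    (hv : v ∈ (p.drop e).support) :
    G.Reachable (x t) v ∧ G.dist (x t) v ≤ K + (p.length - e) := by
  obtain ⟨j, hej, hj, rfl⟩ := (mem_support_drop_iff he).1 hv
  obtain ⟨hreach, hdist⟩ := hM.near t _ (hM.mem t)
  have htri := hreach.dist_triangle_left (p.getVert j)
  have hdrop := SimpleGraph.dist_le ((p.drop j).mapLe hHG)
  rw [SimpleGraph.Walk.length_mapLe, SimpleGraph.Walk.drop_length, G.dist_comm] at hdrop
  exact ⟨hreach.trans ((p.drop j).reachable.symm.mono hHG), by omega⟩

theorem cons (hM : BandMinor G H' w R x K A B u) (hle : H' ≤ H) {S : Set V} {P : T → Set V}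
    {u' : T → V} {K' : ℕ} (hK : K ≤ K') (hS : (G.induce S).Connected)
    (hP : ∀ t, (G.induce (P t)).Connected) (hwS : ∀ v ∈ S, H.Reachable w v)
    (hwP : ∀ t, ∀ v ∈ P t, H.Reachable w v) (hSA : ∀ l, Disjoint S (A l))
    (hSB : ∀ t, Disjoint S (B t)) (hSP : ∀ t, Disjoint S (P t)) (hAP : ∀ l t, Disjoint (A l) (P t))
    (hadj : ∀ t, ∃ y ∈ S, ∃ v ∈ P t, G.Adj y v)
    (hnear : ∀ t, ∀ v ∈ P t, G.Reachable (x t) v ∧ G.dist (x t) v ≤ K') (hu : ∀ t, u t ∈ P t)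
    (hu' : ∀ t, u' t ∈ P t)
    (havoids : ∀ t v, H.Reachable (u' t) v → H.dist (u' t) v ≤ R → v ∉ S ∧ ∀ l, v ∉ A l) :
    BandMinor G H w R x K' (Fin.cons S A : Fin (m + 1) → Set V) (fun t => B t ∪ P t) u' where
  connected_left := Fin.cases hS hM.connected_left
  connected_right t := SimpleGraph.induce_union_connected (hM.connected_right t).preconnected
    (hP t).preconnected ⟨u t, hM.mem t, hu t⟩
  reachable_left := Fin.cases hwS fun l v hv => (hM.reachable_left l v hv).mono hle
  reachable_right t v hv :=
    hv.elim (fun hvB => (hM.reachable_right t v hvB).mono hle) (hwP t v)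
  disjoint_left := Fin.cases (Fin.cases (fun h => (h rfl).elim) fun l _ => hSA l) fun l =>
    Fin.cases (fun _ => (hSA l).symm) fun l' hne => hM.disjoint_left l l' (ne_of_apply_ne _ hne)
  disjoint := Fin.cases (fun t => Set.disjoint_union_right.2 ⟨hSB t, hSP t⟩) fun l t =>
    Set.disjoint_union_right.2 ⟨hM.disjoint l t, hAP l t⟩
  adj := by
    refine Fin.cases (fun t => ?_) fun l t => ?_
    · obtain ⟨y, hy, v, hv, hyv⟩ := hadj t
      exact ⟨y, hy, v, Or.inr hv, hyv⟩
    · obtain ⟨y, hy, v, hv, hyv⟩ := hM.adj l t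
      exact ⟨y, hy, v, Or.inl hv, hyv⟩
  near t v hv := hv.elim (fun hvB => (hM.near t v hvB).imp_right fun h => h.trans hK) (hnear t v)
  mem t := Or.inr (hu' t)
  avoids t l v hv hdist := by
    obtain ⟨hvS, hvA⟩ := havoids t v hv hdist
    exact Fin.cases hvS hvA l

section Extension

variable {s : V} {e a b : ℕ} (hM : BandMinor G H' w R x K A B u) (hband : IsBand H H' s w a b)
include hM hband

theorem le_dist_mem (t : T) : a ≤ H.dist s (u t) :=
  hband.le_dist _ (hM.reachable_right t _ (hM.mem t))

theorem disjoint_ball_left (he : e ≤ a) (l : Fin m) : Disjoint (H.ball s e) (A l) := by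
  refine Set.disjoint_left.2 fun v hv hvA => ?_
  have := (mem_ball_natCast_iff.1 hv).2
  have := hband.le_dist v (hM.reachable_left l v hvA)
  omega

theorem disjoint_ball_right (he : e ≤ a) (t : T) : Disjoint (H.ball s e) (B t) := by
  refine Set.disjoint_left.2 fun v hv hvB => ?_
  have := (mem_ball_natCast_iff.1 hv).2
  have := hband.le_dist v (hM.reachable_right t v hvB)
  omega

variable {t : T} {p : H.Walk s (u t)} (hp : p.length = H.dist s (u t))
include hp

theorem disjoint_left_support (hb : b ≤ a + R) (he : e ≤ p.length) (l : Fin m) :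
    Disjoint (A l) {v | v ∈ (p.drop e).support} := by
  refine Set.disjoint_right.2 fun v hv hvA => ?_
  obtain ⟨j, -, hj, rfl⟩ := (mem_support_drop_iff he).1 hv
  have hut := hM.reachable_right t _ (hM.mem t)
  have haj : a ≤ j := by
    have := hband.le_dist _ (hM.reachable_left l _ hvA)
    rwa [dist_getVert_of_length_eq_dist hp hj] at this
  obtain ⟨hreach, hdist⟩ := hband.reachable_getVert hut hp haj hj
  have := hband.dist_lt _ hut
  exact hM.avoids t l _ hreach (by omega) hvA

theorem avoids_getVert (hea : e + 2 * R < a) {v : V} (hv : H.Reachable (p.getVert (e + R)) v)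
    (hdist : H.dist (p.getVert (e + R)) v ≤ R) : v ∉ H.ball s e ∧ ∀ l, v ∉ A l := by
  have hlevel := hM.le_dist_mem hband t
  have hc := dist_getVert_of_length_eq_dist hp (j := e + R) (by omega)
  have hsc : H.Reachable s (p.getVert (e + R)) := (p.take _).reachable
  have htri := hsc.dist_triangle_left v
  have htri' := (hsc.trans hv).dist_triangle_left (p.getVert (e + R))
  rw [H.dist_comm (u := v)] at htri'
  refine ⟨fun hvs => ?_, fun l hvA => ?_⟩
  · have := (mem_ball_natCast_iff.1 hvs).2
    omega
  · have := hband.le_dist v (hM.reachable_left l v hvA)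
    omega

end Extension

/-- The new left branch set consists of the levels below `e` of the breadth-first search; the right
branch sets are joined to it along shortest paths to the root. -/
theorem extend {s : V} {e a b : ℕ} (hHG : H ≤ G) (hM : BandMinor G H' w R x K A B u)
    (hband : IsBand H H' s w a b) (hb : b ≤ a + R) (he : 0 < e) (ha : a = e + 2 * R + 1) :
    ∃ (A' : Fin (m + 1) → Set V) (B' : T → Set V) (u' : T → V),
      BandMinor G H w R x (K + 3 * R) A' B' u' := by
  have hut (t) : H'.Reachable w (u t) := hM.reachable_right t _ (hM.mem t)
  choose p hp using fun t =>
    (hband.reachable.trans ((hut t).mono hband.le)).exists_walk_length_eq_dist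
  have hle (t) : e + 2 * R + 1 ≤ (p t).length := by
    rw [hp, ← ha]
    exact hM.le_dist_mem hband t
  have hlt (t) : (p t).length < e + 3 * R + 1 := by
    have := hband.dist_lt _ (hut t)
    rw [hp]
    omega
  have hep (t) : e ≤ (p t).length := by have := hle t; omega
  refine ⟨_, _, fun t => (p t).getVert (e + R), hM.cons hband.le (S := H.ball s e)
    (P := fun t => {v | v ∈ ((p t).drop e).support}) (Nat.le_add_right _ _)
    (connected_induce_ball hHG s he) (fun t => connected_induce_support_of_le hHG _)
    (fun v hv => hband.reachable.symm.trans (mem_ball_natCast_iff.1 hv).1) (fun t v hv => ?_)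
    (hM.disjoint_ball_left hband (by omega)) (hM.disjoint_ball_right hband (by omega))
    (fun t => disjoint_ball_support_drop (hp t) (hep t))
    (fun l t => hM.disjoint_left_support hband (hp t) hb (hep t) l) (fun t => ?_) (fun t v hv => ?_)
    (fun t => SimpleGraph.Walk.end_mem_support _) (fun t => ?_)
    (fun t v => hM.avoids_getVert hband (hp t) (by omega))⟩
  · obtain ⟨j, -, -, rfl⟩ := (mem_support_drop_iff (hep t)).1 hv
    exact hband.reachable.symm.trans ((p t).take j).reachable
  · obtain ⟨y, hy, v, hv, hyv⟩ := exists_adj_ball_support_drop (hp t) he (hep t)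
    exact ⟨y, hy, v, hv, hHG hyv⟩
  · refine (hM.near_support hHG (hep t) hv).imp_right fun h => h.trans ?_
    have := hlt t
    omega
  · have := hle t
    exact (mem_support_drop_iff (hep t)).2 ⟨e + R, by omega, by omega, rfl⟩

end BandMinor

section WeakDiameter

variable {V T : Type*} {G : SimpleGraph V} {H : ℕ → SimpleGraph V} {r Λ : ℕ} {w : V}

/-- If the band lies too close to the root for `BandMinor.extend`, then all points `x t` are close
to each other. -/
theorem exists_bandMinor (hHG : ∀ i, H i ≤ G)
    (hband : ∀ i < r, ∃ s a b, IsBand (H i) (H (i + 1)) s w a b ∧ b ≤ a + Λ) {x : T → V}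
    (hx : ∀ t, (H r).Reachable w (x t)) {t₀ t₁ : T} (hfar : 6 * Λ * r < G.dist (x t₀) (x t₁))
    {m i : ℕ} (hmi : m + i = r) :
    ∃ (A : Fin m → Set V) (B : T → Set V) (u : T → V),
      BandMinor G (H i) w Λ x (3 * Λ * m) A B u := by
  induction m generalizing i with
  | zero =>
    obtain rfl : i = r := by omega
    exact ⟨_, _, _, .singleton hx⟩
  | succ m ih =>
    obtain ⟨A, B, u, hM⟩ := ih (i := i + 1) (by omega)
    obtain ⟨s, a, b, hs, hb⟩ := hband i (by omega)
    by_cases ha : 2 * Λ + 1 < a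
    · exact hM.extend (hHG i) hs hb (e := a - (2 * Λ + 1)) (by omega) (by omega)
    have hsu (t) : G.Reachable s (u t) ∧ G.dist s (u t) ≤ 3 * Λ := by
      have hwu := hM.reachable_right t _ (hM.mem t)
      have hsu := hs.reachable.trans (hwu.mono hs.le)
      have := hs.dist_lt _ hwu
      have := hsu.dist_anti (hHG i)
      exact ⟨hsu.mono (hHG i), by omega⟩
    obtain ⟨hxu₀, hnear₀⟩ := hM.near t₀ _ (hM.mem t₀)
    obtain ⟨-, hnear₁⟩ := hM.near t₁ _ (hM.mem t₁)
    have htri₀ := hxu₀.dist_triangle_left (x t₁)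
    have htri₁ := (hsu t₀).1.symm.dist_triangle_left (x t₁)
    have htri₂ := (hsu t₁).1.dist_triangle_left (x t₁)
    rw [G.dist_comm (v := s)] at htri₁
    rw [G.dist_comm (u := u t₁)] at htri₂
    have hdist₀ := (hsu t₀).2
    have hdist₁ := (hsu t₁).2
    have : 6 * Λ * r = 2 * (3 * Λ * m) + 6 * Λ * (i + 1) := by rw [← hmi]; ring
    have : 6 * Λ ≤ 6 * Λ * (i + 1) := Nat.le_mul_of_pos_right _ i.succ_pos
    omega

theorem ExcludesKrr.pos (h : ExcludesKrr G r) : 0 < r := by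
  rw [Nat.pos_iff_ne_zero]
  rintro rfl
  refine h ⟨fun _ => Set.univ, fun t => ?_, fun t => ?_, fun t => ?_⟩ <;>
    exact (Sum.elim Fin.elim0 Fin.elim0 t)

/-- Points of a component at distances `0, K, …, r * K` from `w` are pairwise far apart. They serve
as the right branch sets of a minor with one left branch set for each round. -/
theorem ExcludesKrr.dist_lt_of_isBand (hG : ExcludesKrr G r) (hHG : ∀ i, H i ≤ G)
    (hband : ∀ i < r, ∃ s a b, IsBand (H i) (H (i + 1)) s w a b ∧ b ≤ a + Λ) {v : V}
    (hv : (H r).Reachable w v) : G.dist w v < r * (6 * Λ * r + 1) := by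
  have hr := hG.pos
  by_contra! hlt
  set K := 6 * Λ * r + 1
  have hpoint (t : Fin (r + 1)) : ∃ y, (H r).Reachable w y ∧ G.dist w y = t * K :=
    exists_dist_eq_of_le (hHG r) hv
      ((Nat.mul_le_mul_right _ (Nat.lt_succ_iff.1 t.isLt)).trans hlt)
  choose x hx hxd using hpoint
  have hfar_of_lt (t t') (htt : t < t') : K ≤ G.dist (x t) (x t') := by
    have htri := ((hx t).mono (hHG r)).dist_triangle_left (x t')
    rw [hxd, hxd] at htri
    have : ((t : ℕ) + 1) * K ≤ t' * K := Nat.mul_le_mul_right _ htt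
    rw [Nat.succ_mul] at this
    omega
  have hfar (t t') (hne : t ≠ t') : 6 * Λ * r < G.dist (x t) (x t') := by
    rcases hne.lt_or_gt with htt | htt
    · exact hfar_of_lt t t' htt
    · rw [G.dist_comm]
      exact hfar_of_lt t' t htt
  obtain ⟨A, B, u, hM⟩ := exists_bandMinor hHG hband hx
    (hfar 0 (Fin.last r) (by simp [Fin.ext_iff, hr.ne])) (add_zero r)
  refine hG ((hM.comp Fin.castSucc).isMinor fun t t' hne => ?_)
  rw [show 2 * (3 * Λ * r) = 6 * Λ * r by ring]
  exact hfar _ _ ((Fin.castSucc_injective r).ne hne)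

theorem ExcludesKrr.dist_lt {n : ℕ} {G : SimpleGraph (Fin n)} (hG : ExcludesKrr G r)
    {L : ℕ → Fin n → Fin Λ} {w v : Fin n} (hv : (roundGraph G L r).Reachable w v) :
    G.dist w v < r * (6 * Λ * r + 1) := by
  refine hG.dist_lt_of_isBand (roundGraph_le G L) (fun i _ => ?_) hv
  have hpick := (leastRule (Fin n)).pick_mem i _ ((roundGraph G L i).connectedComponentMk w)
  obtain ⟨a, b, h⟩ := exists_isBand (L i) rfl (SimpleGraph.ConnectedComponent.eq.1 hpick)
  exact ⟨_, a, b, h⟩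

end WeakDiameter

/-! ### The running time -/

section Counting

variable {V : Type*} {G : SimpleGraph V} [G.LocallyFinite]

theorem exists_finset_card_lt_of_ball {d : ℕ} (hd : 2 ≤ d)
    (hdeg : ∀ v, G.degree v ≤ d) (w : V) (R : ℕ) :
    ∃ S : Finset V, (∀ v, G.Reachable w v → G.dist w v < R → v ∈ S) ∧ S.card < d ^ R := by
  classical
  induction R with
  | zero => exact ⟨∅, by simp⟩
  | succ R ih =>
    obtain ⟨S, hS, hcard⟩ := ih
    refine ⟨insert w (S.biUnion fun y => G.neighborFinset y), fun v hv hdist => ?_, ?_⟩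
    · rcases eq_or_ne (G.dist w v) 0 with h₀ | hne
      · rw [hv.dist_eq_zero_iff.1 h₀]
        exact Finset.mem_insert_self _ _
      · obtain ⟨y, hyv, hwy, hy⟩ := exists_adj_dist_add_one_eq hv hne
        refine Finset.mem_insert_of_mem (Finset.mem_biUnion.2 ⟨y, hS y hwy (by omega), ?_⟩)
        exact (G.mem_neighborFinset y v).2 hyv
    · have hunion : (S.biUnion fun y => G.neighborFinset y).card ≤ S.card * d :=
        Finset.card_biUnion_le_card_mul _ _ _ fun y _ => hdeg y
      calc (insert w (S.biUnion fun y => G.neighborFinset y)).card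
          ≤ S.card * d + 1 := (Finset.card_insert_le _ _).trans (Nat.add_le_add_right hunion 1)
        _ < (S.card + 1) * d := by rw [Nat.succ_mul]; omega
        _ ≤ d ^ (R + 1) := Nat.mul_le_mul_right d hcard

theorem eq_or_adj_of_reachable (hdeg : ∀ v, G.degree v ≤ 1) {w v : V} (h : G.Reachable w v) :
    v = w ∨ G.Adj w v := by
  rw [SimpleGraph.reachable_iff_reflTransGen] at h
  induction h with
  | refl => exact Or.inl rfl
  | @tail y v _ hyv ih =>
    rcases ih with rfl | hwy
    · exact Or.inr hyv
    · refine Or.inl (Finset.card_le_one.1 (hdeg y) v ?_ w ?_)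
      · exact (G.mem_neighborFinset y v).2 hyv
      · exact (G.mem_neighborFinset y w).2 hwy.symm

end Counting

theorem ExcludesKrr.card_component_le {n r Λ d : ℕ} {G : SimpleGraph (Fin n)} [DecidableRel G.Adj]
    (hG : ExcludesKrr G r) (hΛ : 0 < Λ) (hdeg : ∀ v, G.degree v ≤ d) (L : ℕ → Fin n → Fin Λ)
    (c : Fin n) :
    (Finset.univ.filter fun v => leastReachable (roundGraph G L r) v = c).card ≤
      2 * max 1 d ^ (14 * r ^ 2 * (Λ - 1)) := by
  suffices ∃ S : Finset (Fin n), (∀ v, (roundGraph G L r).Reachable c v → v ∈ S) ∧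
      S.card ≤ 2 * max 1 d ^ (14 * r ^ 2 * (Λ - 1)) by
    obtain ⟨S, hS, hcard⟩ := this
    refine (Finset.card_le_card fun v hv => hS v ?_).trans hcard
    rw [← (Finset.mem_filter.1 hv).2]
    exact (reachable_leastReachable _ v).symm
  have hr := hG.pos
  obtain rfl | hΛ₂ : Λ = 1 ∨ 2 ≤ Λ := by omega
  · refine ⟨{c}, fun v hv => ?_, by simp⟩
    rw [roundGraph_eq_bot G L hr, SimpleGraph.reachable_bot] at hv
    exact Finset.mem_singleton.2 hv.symm
  obtain hd | hd := Nat.lt_or_ge 1 d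
  · obtain ⟨S, hS, hcard⟩ := exists_finset_card_lt_of_ball hd hdeg c (r * (6 * Λ * r + 1))
    refine ⟨S, fun v hv => hS v (hv.mono (roundGraph_le G L r)) (hG.dist_lt hv), ?_⟩
    have hexp : r * (6 * Λ * r + 1) ≤ 14 * r ^ 2 * (Λ - 1) := by
      obtain ⟨k, rfl⟩ := Nat.exists_eq_add_of_le' hΛ₂
      rw [show k + 2 - 1 = k + 1 from rfl]
      nlinarith [Nat.zero_le (r * r * k)]
    calc S.card ≤ d ^ (14 * r ^ 2 * (Λ - 1)) :=
          hcard.le.trans (Nat.pow_le_pow_right (by omega) hexp)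
      _ ≤ 2 * max 1 d ^ (14 * r ^ 2 * (Λ - 1)) := by
        rw [max_eq_right hd.le]
        exact Nat.le_mul_of_pos_left _ two_pos
  · refine ⟨insert c (G.neighborFinset c), fun v hv => ?_, ?_⟩
    · have := eq_or_adj_of_reachable (hdeg · |>.trans hd) (hv.mono (roundGraph_le G L r))
      simpa using this
    · calc (insert c (G.neighborFinset c)).card ≤ d + 1 :=
            (Finset.card_insert_le _ _).trans (Nat.add_le_add_right (hdeg c) 1)
        _ ≤ 2 * max 1 d ^ (14 * r ^ 2 * (Λ - 1)) := by simpa [max_eq_left hd] using hd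

theorem MRF.degree_le_maxDeg {V S : Type} [Fintype V] (M : MRF V S) [DecidableRel M.graph.Adj]
    (v : V) : M.graph.degree v ≤ M.maxDeg := by
  convert M.graph.degree_le_maxDegree v
  unfold MRF.maxDeg
  congr!

theorem IsAdjacencyList.length_eq_degree {n : ℕ} {G : SimpleGraph (Fin n)} [DecidableRel G.Adj]
    {nbr : Fin n → List (Fin n)} (h : IsAdjacencyList G nbr) (v : Fin n) :
    (nbr v).length = G.degree v := by
  rw [← List.toFinset_card_of_nodup (h v).1, ← G.card_neighborFinset_eq_degree]
  congr 1
  ext u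
  simp [(h v).2 u]

section RunningTime

variable {n q r Λ t : ℕ} {M : MRF (Fin n) (Fin q)} {nbr : Fin n → List (Fin n)} {L : Draws n r Λ}
  {s : MState}

theorem ExcludesKrr.time_mode_le (hn : 0 < n) (hq : 0 < q) (hΛ : 0 < Λ)
    (hG : ExcludesKrr M.graph r) (hnbr : IsAdjacencyList M.graph nbr)
    (hexec : Exec (drawSource L) mode (inputState M nbr r Λ) t s) :
    t ≤ 100 * ((r + 1) * (n * (((if Λ = 1 then 0 else M.maxDeg) + 1) *
      q ^ (2 * max 1 M.maxDeg ^ (14 * r ^ 2 * (Λ - 1)))))) := by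
  classical
  have hlength (v) : (nbr v).length ≤ M.maxDeg :=
    (hnbr.length_eq_degree v).trans_le (M.degree_le_maxDeg v)
  obtain ⟨L', rfl, -⟩ := exists_draws_extension hΛ L
  have h := time_mode_le_of_card_le hn hq hΛ hnbr hlength (fun c => by
    rw [deleteEdges_minorE]
    exact hG.card_component_le hΛ M.degree_le_maxDeg L' c) hexec
  simpa only [hG.pos, true_and] using h

theorem ExcludesKrr.time_mode_le_pow (hn : 0 < n) (hq : 0 < q) (hΛ : 0 < Λ)
    (hG : ExcludesKrr M.graph r) (hnbr : IsAdjacencyList M.graph nbr)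
    (hexec : Exec (drawSource L) mode (inputState M nbr r Λ) t s) :
    t ≤ (200 * (r + 1) + 14 * r ^ 2) * n * max 2 M.maxDeg *
      q ^ max 2 M.maxDeg ^ ((200 * (r + 1) + 14 * r ^ 2) * Λ) := by
  set C := 200 * (r + 1) + 14 * r ^ 2 with hC
  set D := max 2 M.maxDeg
  have hD : 2 ≤ D := le_max_left _ _
  have hA : (if Λ = 1 then 0 else M.maxDeg) + 1 ≤ 2 * D := by
    have : M.maxDeg ≤ D := le_max_right _ _
    split_ifs <;> omega
  have hK : 2 * max 1 M.maxDeg ^ (14 * r ^ 2 * (Λ - 1)) ≤ D ^ (C * Λ) :=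
    calc 2 * max 1 M.maxDeg ^ (14 * r ^ 2 * (Λ - 1))
        ≤ D * D ^ (14 * r ^ 2 * (Λ - 1)) := by gcongr; exact max_le_max_right _ one_le_two
      _ = D ^ (14 * r ^ 2 * (Λ - 1) + 1) := (pow_succ' _ _).symm
      _ ≤ D ^ (C * Λ) := by
        refine Nat.pow_le_pow_right (by omega) ?_
        calc 14 * r ^ 2 * (Λ - 1) + 1 ≤ 14 * r ^ 2 * Λ + 200 * (r + 1) * Λ := by
              gcongr
              · omega
              · nlinarith
          _ = C * Λ := by rw [hC]; ring
  calc t ≤ 100 * ((r + 1) * (n * ((2 * D) * q ^ D ^ (C * Λ)))) := by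
        refine (hG.time_mode_le hn hq hΛ hnbr hexec).trans ?_
        gcongr
    _ = 200 * (r + 1) * n * D * q ^ D ^ (C * Λ) := by ring
    _ ≤ C * n * D * q ^ D ^ (C * Λ) := by
      gcongr
      exact Nat.le_add_right _ _

theorem max_one_pow_le_sqrt_log {d e : ℕ} (hn : 1 < Real.log n)
    (h : 2 * (e * Real.log d) ≤ Real.log (Real.log n)) :
    ((max 1 d ^ e : ℕ) : ℝ) ≤ √(Real.log n) := by
  have hlog : Real.log (max 1 d : ℕ) = Real.log d := by rcases d with _ | d <;> simp
  rw [Real.le_sqrt' (by positivity), ← Real.log_le_log_iff (by positivity) (by positivity),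
    Real.log_pow, Nat.cast_pow, Real.log_pow, hlog]
  exact_mod_cast h

/-- The assumption says that the sizes of the components are `O(√(log n))`. -/
theorem ExcludesKrr.time_mode_le_exp (hn : 1 < Real.log n) (hq : 0 < q) (hΛ : 0 < Λ)
    (hG : ExcludesKrr M.graph r) (hnbr : IsAdjacencyList M.graph nbr)
    (hsmall : 28 * r ^ 2 * (((Λ : ℝ) - 1) * Real.log M.maxDeg) ≤ Real.log (Real.log n))
    (hexec : Exec (drawSource L) mode (inputState M nbr r Λ) t s) :
    (t : ℝ) ≤ 200 * (r + 1) * (n * Real.exp ((2 * Real.log q + 1) * √(Real.log n))) := by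
  have hn₀ : 0 < n := Nat.pos_of_ne_zero (by rintro rfl; norm_num at hn)
  have hq₀ : (0 : ℝ) < q := Nat.cast_pos.2 hq
  set Y := max 1 M.maxDeg ^ (14 * r ^ 2 * (Λ - 1))
  have hYn : (Y : ℝ) ≤ √(Real.log n) := by
    refine max_one_pow_le_sqrt_log hn ?_
    push_cast [Nat.cast_sub hΛ]
    linarith
  have hA : (if Λ = 1 then 0 else M.maxDeg) + 1 ≤ 2 * Y := by
    have hr := hG.pos
    have hY₁ : 1 ≤ Y := Nat.one_le_pow _ _ (by omega)
    split_ifs with h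
    · omega
    · have : max 1 M.maxDeg ≤ Y :=
        Nat.le_self_pow (Nat.mul_ne_zero (by positivity) (by omega)) _
      omega
  have hqY : (q : ℝ) ^ (2 * Y) = Real.exp (2 * Real.log q * Y) := by
    rw [← Real.rpow_natCast, Real.rpow_def_of_pos hq₀]
    push_cast
    ring_nf
  have ht : t ≤ 100 * ((r + 1) * (n * ((2 * Y) * q ^ (2 * Y)))) :=
    (hG.time_mode_le hn₀ hq hΛ hnbr hexec).trans (by gcongr)
  calc (t : ℝ) ≤ 100 * ((r + 1) * (n * ((2 * Y) * q ^ (2 * Y)))) := by exact_mod_cast ht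
    _ = 200 * (r + 1) * (n * (Y * Real.exp (2 * Real.log q * Y))) := by rw [hqY]; ring
    _ ≤ 200 * (r + 1) * (n * (Real.exp √(Real.log n) *
        Real.exp (2 * Real.log q * √(Real.log n)))) := by
      gcongr
      exact hYn.trans (by linarith [Real.add_one_le_exp √(Real.log n)])
    _ = _ := by rw [← Real.exp_add]; ring_nf

theorem isLittleO_mul_exp_sqrt_log (b : ℝ) {δ : ℝ} (hδ : 0 < δ) :
    (fun m : ℕ => (m : ℝ) * Real.exp (b * √(Real.log m))) =o[atTop]
      fun m : ℕ => (m : ℝ) ^ (1 + δ) := by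
  have hsqrt : Tendsto (fun m : ℕ => √(Real.log m)) atTop atTop :=
    Real.tendsto_sqrt_atTop.comp (Real.tendsto_log_atTop.comp tendsto_natCast_atTop_atTop)
  have hpoly : Tendsto (fun y : ℝ => δ * y ^ 2 - b * y) atTop atTop := by
    have : Tendsto (fun y : ℝ => y * (δ * y + -b)) atTop atTop :=
      tendsto_id.atTop_mul_atTop₀ (tendsto_atTop_add_const_right _ _
        (tendsto_id.const_mul_atTop hδ))
    exact this.congr fun y => by ring
  have hexp : (fun m : ℕ => Real.exp (b * √(Real.log m))) =o[atTop]
      fun m : ℕ => Real.exp (δ * √(Real.log m) ^ 2) :=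
    Real.isLittleO_exp_comp_exp_comp.2 (hpoly.comp hsqrt)
  refine ((isBigO_refl (fun m : ℕ => (m : ℝ)) atTop).mul_isLittleO hexp).congr' .rfl ?_
  filter_upwards [eventually_gt_atTop 0] with m hm
  have hm' : (0 : ℝ) < m := Nat.cast_pos.2 hm
  rw [Real.sq_sqrt (Real.log_natCast_nonneg m), Real.rpow_add hm', Real.rpow_one,
    Real.rpow_def_of_pos hm', mul_comm δ]

theorem isLittleO_time_mode {n Λ t : ℕ → ℕ} {M : ∀ k, MRF (Fin (n k)) (Fin q)}
    {nbr : ∀ k, Fin (n k) → List (Fin (n k))} {L : ∀ k, Draws (n k) r (Λ k)} {s : ℕ → MState}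
    (hn : Tendsto n atTop atTop) (hq : 0 < q) (hΛ : ∀ k, 0 < Λ k)
    (hG : ∀ k, ExcludesKrr (M k).graph r) (hnbr : ∀ k, IsAdjacencyList (M k).graph (nbr k))
    (hsmall : (fun k => ((Λ k : ℝ) - 1) * Real.log (M k).maxDeg) =o[atTop]
      fun k => Real.log (Real.log (n k)))
    (hexec : ∀ k, Exec (drawSource (L k)) mode (inputState (M k) (nbr k) r (Λ k)) (t k) (s k))
    {δ : ℝ} (hδ : 0 < δ) : (fun k => (t k : ℝ)) =o[atTop] fun k => (n k : ℝ) ^ (1 + δ) := by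
  have hlog : Tendsto (fun k => Real.log (n k)) atTop atTop :=
    Real.tendsto_log_atTop.comp (tendsto_natCast_atTop_atTop.comp hn)
  have hr : (0 : ℝ) < r := Nat.cast_pos.2 (hG 0).pos
  refine IsBigO.trans_isLittleO (IsBigO.of_bound (200 * (r + 1)) ?_)
    ((isLittleO_mul_exp_sqrt_log (2 * Real.log q + 1) hδ).comp_tendsto hn)
  filter_upwards [hlog.eventually_gt_atTop 1,
    hsmall.def (c := (28 * (r : ℝ) ^ 2)⁻¹) (by positivity)] with k hk hbound
  rw [Real.norm_natCast, Function.comp_apply, Real.norm_of_nonneg (by positivity)]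
  refine (hG k).time_mode_le_exp hk hq (hΛ k) (hnbr k) ?_ (hexec k)
  rw [Real.norm_of_nonneg (Real.log_nonneg hk.le), Real.norm_eq_abs] at hbound
  exact (le_inv_mul_iff₀ (by positivity)).1 ((le_abs_self _).trans hbound)

end RunningTime

theorem lam_pos {n q r : ℕ} {M : MRF (Fin n) (Fin q)} {ε : ℝ} (hε : 0 < ε) (hr : 0 < r) :
    0 < lam M r ε := by
  rw [lam, Nat.ceil_pos]
  positivity

theorem div_lam_le {n q r : ℕ} {M : MRF (Fin n) (Fin q)} {ε : ℝ} (hε : 0 < ε) (hr : 0 < r) :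
    (r : ℝ) / lam M r ε ≤ ε := by
  have h : (r : ℝ) * ((M.maxDeg : ℝ) + 1) ≤ lam M r ε * ε := (div_le_iff₀ hε).1 (Nat.le_ceil _)
  rw [div_le_iff₀ (Nat.cast_pos.2 (lam_pos hε hr)), mul_comm ε]
  exact (le_mul_of_one_le_right r.cast_nonneg (by simp)).trans h

theorem norm_lam_sub_one_mul_log_le {n q r : ℕ} {M : MRF (Fin n) (Fin q)} {ε : ℝ} (hε : 0 < ε)
    (hr : 0 < r) :
    ‖((lam M r ε : ℝ) - 1) * Real.log M.maxDeg‖ ≤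
      2 * r * ‖ε⁻¹ * (M.maxDeg * Real.log M.maxDeg)‖ := by
  rcases Nat.eq_zero_or_pos M.maxDeg with hd | hd
  · simp [hd]
  have hd₁ : (1 : ℝ) ≤ M.maxDeg := Nat.one_le_cast.2 hd
  have hlog : 0 ≤ Real.log M.maxDeg := Real.log_nonneg hd₁
  have hlam₁ : (1 : ℝ) ≤ lam M r ε := Nat.one_le_cast.2 (lam_pos hε hr)
  have hlam : (lam M r ε : ℝ) < r * ((M.maxDeg : ℝ) + 1) / ε + 1 :=
    Nat.ceil_lt_add_one (by positivity)
  rw [Real.norm_of_nonneg (mul_nonneg (sub_nonneg.2 hlam₁) hlog),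
    Real.norm_of_nonneg (by positivity)]
  calc ((lam M r ε : ℝ) - 1) * Real.log M.maxDeg
      ≤ r * (M.maxDeg + M.maxDeg) / ε * Real.log M.maxDeg := by
        gcongr
        rw [sub_le_iff_le_add]
        exact hlam.le.trans (by gcongr)
    _ = 2 * r * (ε⁻¹ * (M.maxDeg * Real.log M.maxDeg)) := by ring

theorem mainTheorem4_general :
    (∀ (S : Type) (n r Λ : ℕ) (M : MRF (Fin n) S), 0 < Λ →
      ∀ (ρ : RootRule (Fin n)) (xhat : Draws n r Λ → Fin n → S),
        (∀ L, M.IsModeOutput (minorE M.graph ρ r L) (xhat L)) →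
        ∀ y : Fin n → S, (𝔼 L, (M.energy y - M.energy (xhat L))) ≤ r / Λ * M.energy y) ∧
    ∃ P : Cmd, ImplementsMode P ∧
      (∀ r : ℕ, ∃ C : ℕ, ∀ (n q Λ : ℕ) (M : MRF (Fin n) (Fin q)),
        0 < n → 0 < q → 0 < Λ → ExcludesKrr M.graph r →
        ∀ nbr : Fin n → List (Fin n), IsAdjacencyList M.graph nbr →
        ∀ (L : Draws n r Λ) (t : ℕ) (s : MState),
          Exec (drawSource L) P (inputState M nbr r Λ) t s →
          t ≤ C * n * max 2 M.maxDeg * q ^ max 2 M.maxDeg ^ (C * Λ)) ∧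
      (∀ (r q : ℕ) (n Λ : ℕ → ℕ) (M : ∀ k, MRF (Fin (n k)) (Fin q)),
        0 < q → Tendsto n atTop atTop → (∀ k, 0 < Λ k) → (∀ k, ExcludesKrr (M k).graph r) →
        (fun k => ((Λ k : ℝ) - 1) * Real.log (M k).maxDeg) =o[atTop]
          (fun k => Real.log (Real.log (n k))) →
        ∀ nbr : ∀ k, Fin (n k) → List (Fin (n k)), (∀ k, IsAdjacencyList (M k).graph (nbr k)) →
        ∀ (L : ∀ k, Draws (n k) r (Λ k)) (t : ℕ → ℕ) (s : ℕ → MState),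
          (∀ k, Exec (drawSource (L k)) P (inputState (M k) (nbr k) r (Λ k)) (t k) (s k)) →
          ∀ δ : ℝ, 0 < δ → (fun k => (t k : ℝ)) =o[atTop] (fun k => (n k : ℝ) ^ (1 + δ))) :=
  ⟨fun _ _ _ _ _ hΛ _ _ hx y => MRF.expect_energy_sub_le hΛ hx y,
    mode, implementsMode_mode,
    fun r => ⟨200 * (r + 1) + 14 * r ^ 2, fun _ _ _ _ hn hq hΛ hG _ hnbr _ _ _ hexec =>
      hG.time_mode_le_pow hn hq hΛ hnbr hexec⟩,
    fun _ _ _ _ _ hq hn hΛ hG hsmall _ hnbr _ _ _ hexec _ hδ =>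
      isLittleO_time_mode hn hq hΛ hG hnbr hsmall hexec hδ⟩

theorem mainTheorem4 :
    -- The approximation guarantee, for all choices of roots and of exact MAP assignments.
    (∀ (n q r : ℕ) (M : MRF (Fin n) (Fin q)) (ε : ℝ), 0 < ε → ExcludesKrr M.graph r →
      ∀ (ρ : RootRule (Fin n)) (xhat : Draws n r (lam M r ε) → Fin n → Fin q),
        (∀ L, M.IsModeOutput (minorE M.graph ρ r L) (xhat L)) →
        ∀ xstar : Fin n → Fin q, M.IsMAP xstar →
          (𝔼 L, (M.energy xstar - M.energy (xhat L))) ≤ ε * M.energy xstar) ∧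
    -- The running time.
    ∃ P : Cmd, ImplementsMode P ∧
      (∀ r : ℕ, ∃ C : ℕ, ∀ (n q : ℕ) (M : MRF (Fin n) (Fin q)) (ε : ℝ),
        0 < n → 0 < q → 0 < ε → ExcludesKrr M.graph r →
        ∀ nbr : Fin n → List (Fin n), IsAdjacencyList M.graph nbr →
        ∀ (L : Draws n r (lam M r ε)) (t : ℕ) (s : MState),
          Exec (drawSource L) P (inputState M nbr r (lam M r ε)) t s →
          t ≤ C * n * max 2 M.maxDeg * q ^ (max 2 M.maxDeg) ^ (C * lam M r ε)) ∧
      (∀ (r q : ℕ) (n : ℕ → ℕ) (M : ∀ k, MRF (Fin (n k)) (Fin q)) (ε : ℕ → ℝ),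
        0 < q → (∀ k, 0 < n k) → Tendsto n atTop atTop → (∀ k, 0 < ε k) →
        (∀ k, ExcludesKrr (M k).graph r) →
        (fun k => (ε k)⁻¹ * (((M k).maxDeg : ℝ) * Real.log ((M k).maxDeg : ℝ)))
          =o[atTop] (fun k => Real.log (Real.log (n k : ℝ))) →
        ∀ nbr : ∀ k, Fin (n k) → List (Fin (n k)), (∀ k, IsAdjacencyList (M k).graph (nbr k)) →
        ∀ (L : ∀ k, Draws (n k) r (lam (M k) r (ε k))) (t : ℕ → ℕ) (s : ℕ → MState),
          (∀ k, Exec (drawSource (L k)) P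
            (inputState (M k) (nbr k) r (lam (M k) r (ε k))) (t k) (s k)) →
          ∀ δ : ℝ, 0 < δ →
            (fun k => (t k : ℝ)) =o[atTop] (fun k => (n k : ℝ) ^ (1 + δ))) := by
  obtain ⟨happrox, P, hP, htime, hsublinear⟩ := mainTheorem4_general
  refine ⟨?_, P, hP, fun r => ?_, ?_⟩
  · intro n q r M ε hε hG ρ xhat hx y _
    exact (happrox _ n r _ M (lam_pos hε hG.pos) ρ xhat hx y).trans
      (mul_le_mul_of_nonneg_right (div_lam_le hε hG.pos) (M.energy_nonneg y))
  · exact (htime r).imp fun C hC n q M ε hn hq hε hG => hC n q _ M hn hq (lam_pos hε hG.pos) hG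
  · intro r q n M ε hq _ htop hε hG hsmall
    refine hsublinear r q n _ M hq htop (fun k => lam_pos (hε k) (hG k).pos) hG ?_
    exact (IsBigO.of_bound (2 * r) (.of_forall fun k =>
      norm_lam_sub_one_mul_log_le (hε k) (hG k).pos)).trans_isLittleO hsmall
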